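/- **Theorem 1.** Let $d\in\mathbb N$, and for $\rho>0$ put $$\mathbb T^d_\rho=\{\theta\in\mathbb C^d/\mathbb Z^d:\ |\operatorname{Im}\theta_j|\le\rho\ \text{for all } j\},\qquad \mathcal B_\rho=\{I\in\mathbb C^d:\ \operatorname{dist}(I,[-1,1]^d)\le\rho/10\},$$ $$\mathcal M_\rho=\mathbb T^d_\rho\times\mathcal B_\rho,\qquad \mathcal E_\rho=\{\varepsilon\in\mathbb C:\ |\varepsilon|<\rho\},\qquad f(\theta,I)=(\theta+I,I).$$ Let $\mathcal G$ be a complex unital Banach algebra. An *analytic family* on $\mathcal E_\rho\times\mathcal M_\rho$ is a continuous map $(\varepsilon,\theta,I)\mapsto\eta_\varepsilon(\theta,I)\in\mathcal G$ on $\mathcal E_\rho\times\mathcal M_\rho$ that is holomorphic in the interior of $\mathcal E_\rho\times\mathcal M_\rho$. Fix $\rho>0$ and an analytic family $\eta_\varepsilon$ on $\mathcal E_\rho\times\mathcal M_\rho$ with $\eta_0=\operatorname{Id}$. Then the following are equivalent. * (A) (Periodic Orbit Condition.) There is $\rho'\in(0,\rho]$ such that for every $\varepsilon\in\mathcal E_\rho$,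 every $N\ge1$ and every $p\in\mathcal M_{\rho'}$ with $f^N(p)=p$, $$\eta_\varepsilon(f^{N-1}(p))\cdots\eta_\varepsilon(f(p))\cdot\eta_\varepsilon(p)=\operatorname{Id}.$$ * (B) (Formal solution.) There are $\rho'\in(0,\rho]$ and continuous functions $\phi^j:\mathcal M_{\rho'}\to\mathcal G$, $j\ge1$, such that the formal power series $\phi_\varepsilon=\operatorname{Id}+\sum_{j\ge1}\varepsilon^j\phi^j$, with formal inverse $\phi_\varepsilon^{-1}$, has the following property: for every $L\in\mathbb N$ there are $C_L$ and $r_L>0$ such that for all $|\varepsilon|<r_L$ and all $p\in\mathcal M_{\rho'}$ with $f(p)\in\mathcal M_{\rho'}$, $$\bigl\|\eta_\varepsilon(p)-(\phi_\varepsilon^{-1})^{[\le L]}(f(p))\cdot\phi_\varepsilon^{[\le L]}(p)\bigr\|\le C_L|\varepsilon|^{L+1},$$ where $^{[\le L]}$ denotes the truncation of a power series in $\varepsilon$ to degree at most $L$. * (C) (Analytic solution.) There are $\rho'\in(0,\rho]$ and an analytic family $\phi_\varepsilon$ on $\mathcal E_{\rho'}\times\mathcal M_{\rho'}$ with invertible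 values such that for all $\varepsilon\in\mathcal E_{\rho'}$ and all $p\in\mathcal M_{\rho'}$ with $f(p)\in\mathcal M_{\rho'}$, $$\eta_\varepsilon(p)=\phi_\varepsilon(f(p))^{-1}\cdot\phi_\varepsilon(p).$$ Moreover, let $x\mapsto\bar x$ be a real structure on $\mathcal G$, that is, a continuous conjugate-linear multiplicative involution (such as entrywise conjugation of complex matrices; its fixed points form a real Banach algebra, with complexification $\mathcal G$). If $\eta$ is real-analytic in the sense that $\overline{\eta_{\bar\varepsilon}(\bar\theta,\bar I)}=\eta_\varepsilon(\theta,I)$ on $\mathcal E_\rho\times\mathcal M_\rho$, then the equivalence of (A), (B), (C) also holds when the solution in (C) is required to be real-analytic in the same sense, that is, $\overline{\phi_{\bar\varepsilon}(\bar\theta,\bar I)}=\phi_\varepsilon(\theta,I)$ on $\mathcal E_{\rho'}\times\mathcal M_{\rho'}$. -/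

import Mathlib

open scoped ComplexConjugate

noncomputable section

/-- Points `(θ, I)` of `ℂ^d × ℂ^d`. Functions on the complexified annulus
`(ℂ^d/ℤ^d) × ℂ^d` are represented by their lifts, which are `ℤ^d`-periodic in `θ`. -/
abbrev Phase (d : ℕ) : Type := EuclideanSpace ℂ (Fin d) × EuclideanSpace ℂ (Fin d)

/-- The integer vector `m` as a vector of `ℂ^d`. -/
def intVec {d : ℕ} (m : Fin d → ℤ) : EuclideanSpace ℂ (Fin d) :=
  WithLp.toLp 2 (fun j => (m j : ℂ))

/-- The base dynamics `f(θ, I) = (θ + I, I)`. -/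
def shear {d : ℕ} (p : Phase d) : Phase d := (p.1 + p.2, p.2)

/-- Two lifts represent the same point of `(ℂ^d/ℤ^d) × ℂ^d`. -/
def SamePoint {d : ℕ} (p q : Phase d) : Prop :=
  (∃ m : Fin d → ℤ, p.1 = q.1 + intVec m) ∧ p.2 = q.2

/-- The real cube `[-1,1]^d`, as a subset of `ℂ^d`. -/
def realCube (d : ℕ) : Set (EuclideanSpace ℂ (Fin d)) :=
  {I | ∀ j, (I j).im = 0 ∧ (I j).re ∈ Set.Icc (-1 : ℝ) 1}

/-- The lift of `𝓜_ρ = 𝕋_ρ^d × 𝓑_ρ`: all `(θ, I)` with `|Im θ_j| ≤ ρ` for every `j` and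
`dist(I, [-1,1]^d) ≤ ρ/10`. -/
def phaseDomain (d : ℕ) (ρ : ℝ) : Set (Phase d) :=
  {p | (∀ j, |(p.1 j).im| ≤ ρ) ∧ Metric.infDist p.2 (realCube d) ≤ ρ / 10}

/-- The parameter disk `𝓔_ρ = {ε ∈ ℂ : |ε| < ρ}`. -/
def paramDisk (ρ : ℝ) : Set ℂ := Metric.ball 0 ρ

/-- A function on the lift of `𝓜_ρ` is `ℤ^d`-periodic in `θ`, that is, it descends to `𝓜_ρ`. -/
def IsPeriodicOn {d : ℕ} {G : Type*} (ρ : ℝ) (g : Phase d → G) : Prop :=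
  ∀ p ∈ phaseDomain d ρ, ∀ m : Fin d → ℤ, g (p.1 + intVec m, p.2) = g p

section BanachAlgebra

variable {d : ℕ} {G : Type*} [NormedRing G] [NormedAlgebra ℂ G]

/-- Analytic families on `𝓔_ρ × 𝓜_ρ`: jointly holomorphic in `(ε, θ, I)` in the interior,
continuous up to the boundary of `𝓜_ρ`, and well defined on the torus. -/
structure IsAnalyticFamily (ρ : ℝ) (η : ℂ → Phase d → G) : Prop where
  periodic : ∀ ε ∈ paramDisk ρ, IsPeriodicOn ρ (η ε)
  continuousOn : ContinuousOn (fun x : ℂ × Phase d => η x.1 x.2) (paramDisk ρ ×ˢ phaseDomain d ρ)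
  holomorphic : DifferentiableOn ℂ (fun x : ℂ × Phase d => η x.1 x.2)
    (interior (paramDisk ρ ×ˢ phaseDomain d ρ))

/-- The product `η(f^{N-1}(p)) ⋯ η(f(p)) · η(p)` along an orbit. -/
def orbitProduct (g : Phase d → G) (p : Phase d) : ℕ → G
  | 0 => 1
  | n + 1 => g (shear^[n] p) * orbitProduct g p n

/-- The Periodic Orbit Condition for `g`, at all the periodic points of `f` in `𝓜_ρ`. -/
def PeriodicOrbitCondition (ρ : ℝ) (g : Phase d → G) : Prop :=
  ∀ p ∈ phaseDomain d ρ, ∀ N : ℕ, 0 < N → SamePoint (shear^[N] p) p → orbitProduct g p N = 1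

/-- The coefficients of the inverse of the formal power series `1 + ∑_{j ≥ 1} a_j ε^j`. -/
def inverseCoeff (a : ℕ → G) (n : ℕ) : G :=
  PowerSeries.coeff n (PowerSeries.invOfUnit (PowerSeries.mk a) 1)

/-- The truncation `∑_{j ≤ L} ε^j a_j`. -/
def truncated (a : ℕ → G) (L : ℕ) (ε : ℂ) : G :=
  ∑ j ∈ Finset.range (L + 1), ε ^ j • a j

/-- `φ_ε = 1 + ∑_{j ≥ 1} ε^j φ^j`, with continuous coefficients `φ^j : 𝓜_ρ → G`, satisfies the
coboundary equation `η_ε = (φ_ε ∘ f)⁻¹ · φ_ε` in the sense of formal power series. The equation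
is considered at the points `p` of `𝓜_ρ` with `f(p) ∈ 𝓜_ρ`. -/
structure IsFormalSolution (ρ : ℝ) (η : ℂ → Phase d → G) (φ : ℕ → Phase d → G) : Prop where
  zero : ∀ p ∈ phaseDomain d ρ, φ 0 p = 1
  periodic : ∀ j, IsPeriodicOn ρ (φ j)
  continuousOn : ∀ j, ContinuousOn (φ j) (phaseDomain d ρ)
  truncation : ∀ L : ℕ, ∃ C r : ℝ, 0 < r ∧ ∀ ε : ℂ, ‖ε‖ < r →
    ∀ p ∈ phaseDomain d ρ, shear p ∈ phaseDomain d ρ →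
      ‖η ε p - truncated (inverseCoeff (fun j => φ j (shear p))) L ε
          * truncated (fun j => φ j p) L ε‖ ≤ C * ‖ε‖ ^ (L + 1)

/-- `φ` is an analytic solution on `𝓔_ρ × 𝓜_ρ` of the coboundary equation
`η_ε = (φ_ε ∘ f)⁻¹ · φ_ε`, considered at the points `p` of `𝓜_ρ` with `f(p) ∈ 𝓜_ρ`. -/
structure IsAnalyticSolution (ρ : ℝ) (η φ : ℂ → Phase d → G) : Prop where
  analytic : IsAnalyticFamily ρ φ
  isUnit : ∀ ε ∈ paramDisk ρ, ∀ p ∈ phaseDomain d ρ, IsUnit (φ ε p)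
  coboundary : ∀ ε ∈ paramDisk ρ, ∀ p ∈ phaseDomain d ρ, shear p ∈ phaseDomain d ρ →
    η ε p = Ring.inverse (φ ε (shear p)) * φ ε p

variable (G) in
/-- A real structure on a complex Banach algebra: a continuous conjugate-linear multiplicative
involution (a complex conjugation). Its fixed points form a real Banach algebra, of which `G` is a
complexification; an example is entrywise conjugation of complex matrices. -/
structure RealStructure where
  toMap : G →SL[starRingEnd ℂ] G
  map_mul : ∀ x y, toMap (x * y) = toMap x * toMap y
  involutive : ∀ x, toMap (toMap x) = x

/-- Complex conjugation of the coordinates. -/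
def conjPhase (p : Phase d) : Phase d :=
  (WithLp.toLp 2 (fun j => conj (p.1 j)), WithLp.toLp 2 (fun j => conj (p.2 j)))

/-- The real symmetry: the conjugate of `η_{ε̄}(θ̄, Ī)` is `η_ε(θ, I)`, on `𝓔_ρ × 𝓜_ρ`. -/
def IsRealSymmetric (τ : RealStructure G) (ρ : ℝ) (η : ℂ → Phase d → G) : Prop :=
  ∀ ε ∈ paramDisk ρ, ∀ p ∈ phaseDomain d ρ, τ.toMap (η (conj ε) (conjPhase p)) = η ε p

end BanachAlgebra

end

/-!
The substance is the passage from the Periodic Orbit Condition to an analytic solution. It is a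
Newton scheme in powers of `ε`, and it rests on writing the coboundary equation in the linear form
`φ_ε(f(p)) η_ε(p) = φ_ε(p)`.

Since `η_0 = 1`, the family is `η = 1 + ε w₀` on a small disk of parameters. Suppose that it has been
conjugated to `1 + ε^m w` with `m = 2^n`. To first order in `ε^m`, the product along a periodic orbit
is the sum of `w` along it, so the Taylor coefficients of `w` in `ε` of degree less than `m` have
vanishing sums over periodic orbits. Such functions are coboundaries of the shear: on the Fourier
mode `k` in `θ` the equation `U - U ∘ f = W` is the division `U_k = W_k / (1 - exp(2πi k·I))`, and the
orbit sums show that `W_k` vanishes wherever `k·I` is an integer, first at real rational `I` and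
then, by density and analytic continuation, at all complex ones. The quotient is therefore
holomorphic, with a bound by a power of the loss of domain and without small divisors
(`exists_sub_shear_eq`). Conjugating by `1 + ε^m U` leaves `1 + ε^(2m) w'`
(`IsReducedCocycle.exists_newton_step`). The factor lost in the estimates grows geometrically
with `n`, while shrinking the disk by `exp(-L/2^n)` gains `exp(-L)` on `ε^m`; as `∑ L_n / 2^n`
converges for `L_n` linear in `n`, the disk keeps a positive radius. The product of the conjugacies
converges to a solution with `‖φ - 1‖ = O(ε)`, which is invertible for small `ε`
(`IsReducedCocycle.exists_solution`).

A real structure sends solutions of the linear form to solutions, so that the average of `φ` and its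
conjugate is a real-analytic solution, again near the identity.

The other implications are softer. An analytic solution, normalised to be the identity at `ε = 0`,
has Taylor coefficients that form a formal solution; the bounds are uniform because the torus is
compact (`IsAnalyticSolution.exists_isFormalSolution`). For a formal solution, the product along a
periodic orbit telescopes up to `O(ε^(L+1))` for every `L`, so that it differs from the identity by a
holomorphic function of `ε` that vanishes to infinite order at `0`, hence identically
(`IsFormalSolution.periodicOrbitCondition`).
-/

noncomputable section

/-! ### Holomorphic functions on normed spaces -/

section Holomorphic

variable {E F : Type*} [NormedAddCommGroup E] [NormedSpace ℂ E]
  [NormedAddCommGroup F] [NormedSpace ℂ F]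

/-- Cauchy's estimate for the derivative. -/
theorem norm_fderiv_le_of_norm_le_on_ball {f : E → F} {c : E} {r B : ℝ} (hr : 0 < r)
    (hd : DifferentiableOn ℂ f (Metric.ball c r)) (hB : ∀ x ∈ Metric.ball c r, ‖f x‖ ≤ B) :
    ‖fderiv ℂ f c‖ ≤ 2 * B / r := by
  refine Complex.norm_fderiv_le_div_of_mapsTo_ball hd (fun x hx => ?_) hr
  rw [Metric.mem_closedBall, dist_eq_norm]
  calc ‖f x - f c‖ ≤ ‖f x‖ + ‖f c‖ := norm_sub_le _ _
    _ ≤ B + B := add_le_add (hB x hx) (hB c (Metric.mem_ball_self hr))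
    _ = 2 * B := by ring

theorem norm_fderiv_le_on_half_ball {f : E → F} {c y : E} {r B : ℝ} (hr : 0 < r)
    (hd : DifferentiableOn ℂ f (Metric.ball c r)) (hB : ∀ x ∈ Metric.ball c r, ‖f x‖ ≤ B)
    (hy : y ∈ Metric.ball c (r / 2)) : ‖fderiv ℂ f y‖ ≤ 2 * B / (r / 2) := by
  have hsub : Metric.ball y (r / 2) ⊆ Metric.ball c r := by
    apply Metric.ball_subset_ball'
    rw [Metric.mem_ball] at hy
    linarith
  exact norm_fderiv_le_of_norm_le_on_ball (by positivity) (hd.mono hsub) fun x hx => hB x (hsub hx)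

/-- A normally convergent series of holomorphic functions is holomorphic. -/
theorem differentiableOn_tsum_of_norm_le [CompleteSpace F] {ι : Type*} {U : Set E} (hU : IsOpen U)
    {u : ι → E → F} {b : ι → ℝ} (hb : Summable b) (hd : ∀ i, DifferentiableOn ℂ (u i) U)
    (hub : ∀ i, ∀ x ∈ U, ‖u i x‖ ≤ b i) : DifferentiableOn ℂ (fun x => ∑' i, u i x) U := by
  intro x hx
  obtain ⟨r, hr, hrU⟩ := Metric.isOpen_iff.1 hU x hx
  have hx2 : x ∈ Metric.ball x (r / 2) := Metric.mem_ball_self (by positivity)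
  have hs : Summable fun i => 2 * b i / (r / 2) := (hb.mul_left 2).div_const _
  have hhalf : Metric.ball x (r / 2) ⊆ U :=
    (Metric.ball_subset_ball (by linarith)).trans hrU
  refine (hasFDerivAt_tsum_of_isPreconnected (𝕜 := ℂ) (f := u) (f' := fun i y => fderiv ℂ (u i) y)
    hs Metric.isOpen_ball (convex_ball x (r / 2)).isPreconnected (fun i y hy => ?_) (fun i y hy => ?_)
    hx2 ?_ hx2).differentiableAt.differentiableWithinAt
  · exact ((hd i).differentiableAt (hU.mem_nhds (hhalf hy))).hasFDerivAt
  · exact norm_fderiv_le_on_half_ball hr ((hd i).mono hrU) (fun z hz => hub i z (hrU hz)) hy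
  · exact Summable.of_norm_bounded hb fun i => hub i x hx

/-- A sequence of holomorphic functions with summable increments has a holomorphic limit. -/
theorem differentiableOn_of_tendsto_of_norm_sub_le [CompleteSpace F] {U : Set E} (hU : IsOpen U)
    {u : ℕ → E → F} {f : E → F} {b : ℕ → ℝ} (hb : Summable b)
    (hd : ∀ n, DifferentiableOn ℂ (u n) U)
    (hub : ∀ n, ∀ x ∈ U, ‖u (n + 1) x - u n x‖ ≤ b n)
    (hlim : ∀ x ∈ U, Filter.Tendsto (fun n => u n x) Filter.atTop (nhds (f x))) :
    DifferentiableOn ℂ f U := by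
  have h := (hd 0).add (differentiableOn_tsum_of_norm_le hU hb (fun n => (hd (n + 1)).sub (hd n)) hub)
  refine h.congr fun x hx => ?_
  have hs : Summable fun n => u (n + 1) x - u n x :=
    Summable.of_norm_bounded hb fun n => hub n x hx
  have h1 := hs.hasSum.tendsto_sum_nat
  simp only [Finset.sum_range_sub (fun n => u n x)] at h1
  have h2 := (hlim x hx).sub_const (u 0 x)
  have := tendsto_nhds_unique h1 h2
  simp only [Pi.add_apply, Pi.sub_apply]
  rw [this]; abel

/-- Holomorphic dependence of an integral on a parameter: the integrand is jointly continuous,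
and holomorphic in the parameter. -/
theorem differentiableOn_setIntegral [ProperSpace E] {T : Type*} [TopologicalSpace T]
    [SecondCountableTopology T] [MeasurableSpace T] [OpensMeasurableSpace T]
    (μ : MeasureTheory.Measure T) [MeasureTheory.IsFiniteMeasureOnCompacts μ] {K : Set T}
    (hK : IsCompact K) (hKm : MeasurableSet K) {U : Set E} (hU : IsOpen U) {f : E → T → F}
    (hf : ContinuousOn (Function.uncurry f) (U ×ˢ K))
    (hd : ∀ t ∈ K, DifferentiableOn ℂ (fun x => f x t) U) :
    DifferentiableOn ℂ (fun x => ∫ t in K, f x t ∂μ) U := by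
  intro x hx
  obtain ⟨r, hr, hrU⟩ := Metric.nhds_basis_closedBall.mem_iff.1 (hU.mem_nhds hx)
  have hbU : Metric.ball x r ⊆ U := Metric.ball_subset_closedBall.trans hrU
  have hfr : ContinuousOn (Function.uncurry f) (Metric.closedBall x r ×ˢ K) :=
    hf.mono (Set.prod_mono hrU subset_rfl)
  obtain ⟨B, hB⟩ := ((isCompact_closedBall x r).prod hK).exists_bound_of_continuousOn hfr
  have hcont : ∀ y ∈ U, ContinuousOn (f y) K := fun y hy =>
    hf.comp (f := fun t => (y, t)) (by fun_prop) fun t ht => ⟨hy, ht⟩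
  have hfin : μ K ≠ ⊤ := hK.measure_lt_top.ne
  have hfinm : MeasureTheory.IsFiniteMeasure (μ.restrict K) :=
    ⟨by simpa using hK.measure_lt_top⟩
  -- Cauchy's estimate on a fixed compact ball makes the derivative continuous in `t`.
  have hderiv : ContinuousOn (fun t => fderiv ℂ (fun y => f y t) x) K := by
    intro t₀ ht₀
    rw [ContinuousWithinAt, Metric.tendsto_nhds]
    intro η hη
    have hev : ∀ᶠ t in nhdsWithin t₀ K, ∀ y ∈ Metric.closedBall x r,
        t ∈ K → ‖f y t - f y t₀‖ < η * r / 4 := by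
      rw [eventually_nhdsWithin_iff]
      have : ∀ᶠ t in nhds t₀, ∀ y ∈ Metric.closedBall x r,
          t ∈ K → ‖f y t - f y t₀‖ < η * r / 4 := by
        refine (isCompact_closedBall x r).eventually_forall_of_forall_eventually
          (P := fun t y => t ∈ K → ‖f y t - f y t₀‖ < η * r / 4) fun y hy => ?_
        have h2 : ContinuousOn (fun z : T × E => f z.2 z.1 - f z.2 t₀) (K ×ˢ U) := by
          refine ContinuousOn.sub (hf.comp (f := fun z : T × E => (z.2, z.1)) (by fun_prop) ?_)
            (hf.comp (f := fun z : T × E => (z.2, t₀)) (by fun_prop) ?_)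
          · exact fun z hz => ⟨hz.2, hz.1⟩
          · exact fun z hz => ⟨hz.2, ht₀⟩
        have h3 := h2 (t₀, y) ⟨ht₀, hrU hy⟩
        have h4 : ∀ᶠ z in nhdsWithin (t₀, y) (K ×ˢ U), ‖f z.2 z.1 - f z.2 t₀‖ < η * r / 4 := by
          have := h3.norm
          refine this.eventually_lt_const ?_
          simp only [sub_self, norm_zero]
          positivity
        rw [eventually_nhdsWithin_iff] at h4
        have h5 : ∀ᶠ z : T × E in nhds (t₀, y), z.2 ∈ U :=
          continuous_snd.continuousAt.eventually (hU.mem_nhds (hrU hy))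
        filter_upwards [h4, h5] with z hz hzU hzK
        exact hz ⟨hzK, hzU⟩
      filter_upwards [this] with t ht _ using ht
    filter_upwards [hev, self_mem_nhdsWithin] with t ht htK
    have hd1 : ∀ s ∈ K, DifferentiableAt ℂ (fun y => f y s) x := fun s hs =>
      (hd s hs).differentiableAt (hU.mem_nhds hx)
    rw [dist_eq_norm, ← fderiv_fun_sub (hd1 t htK) (hd1 t₀ ht₀)]
    refine (norm_fderiv_le_of_norm_le_on_ball (B := η * r / 4) hr
      (((hd t htK).sub (hd t₀ ht₀)).mono hbU) fun y hy =>
        (ht y (Metric.ball_subset_closedBall hy) htK).le).trans_lt ?_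
    have : 2 * (η * r / 4) / r = η / 2 := by field_simp; norm_num
    rw [this]; linarith
  refine (hasFDerivAt_integral_of_dominated_of_fderiv_le (𝕜 := ℂ)
    (F := f) (F' := fun y t => fderiv ℂ (fun z => f z t) y) (bound := fun _ => 2 * B / (r / 2))
    (s := Metric.ball x (r / 2)) (Metric.ball_mem_nhds x (by positivity)) ?_ ?_ ?_ ?_ ?_
    ?_).differentiableAt.differentiableWithinAt
  · filter_upwards [hU.mem_nhds hx] with y hy
    exact (hcont y hy).aestronglyMeasurable hKm
  · exact (hcont x hx).integrableOn_compact' hK hKm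
  · exact hderiv.aestronglyMeasurable hKm
  · filter_upwards [MeasureTheory.ae_restrict_mem hKm] with t ht y hy
    exact norm_fderiv_le_on_half_ball hr ((hd t ht).mono hbU)
      (fun z hz => hB (z, t) ⟨Metric.ball_subset_closedBall hz, ht⟩) hy
  · exact MeasureTheory.integrable_const _
  · filter_upwards [MeasureTheory.ae_restrict_mem hKm] with t ht y hy
    exact ((hd t ht).differentiableAt (hU.mem_nhds
      (hbU (Metric.ball_subset_ball (by linarith) hy)))).hasFDerivAt

/-- Holomorphic dependence of a circle integral on a parameter. -/
theorem differentiableOn_circleIntegral [ProperSpace E] {U : Set E} (hU : IsOpen U) {c : ℂ}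
    {R : ℝ} (hR : 0 ≤ R) {f : E → ℂ → F}
    (hf : ContinuousOn (Function.uncurry f) (U ×ˢ Metric.sphere c R))
    (hd : ∀ z ∈ Metric.sphere c R, DifferentiableOn ℂ (fun x => f x z) U) :
    DifferentiableOn ℂ (fun x => ∮ z in C(c, R), f x z) U := by
  have h := differentiableOn_setIntegral (MeasureTheory.volume : MeasureTheory.Measure ℝ)
    (K := Set.Icc 0 (2 * Real.pi)) isCompact_Icc measurableSet_Icc hU
    (f := fun x θ => deriv (circleMap c R) θ • f x (circleMap c R θ)) ?_ ?_
  · refine h.congr fun x _ => ?_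
    rw [circleIntegral, intervalIntegral.integral_of_le (by positivity),
      MeasureTheory.integral_Icc_eq_integral_Ioc]
  · have h1 : Continuous fun y : E × ℝ => deriv (circleMap c R) y.2 := by
      simp only [deriv_circleMap]; fun_prop
    refine h1.continuousOn.smul (hf.comp (f := fun y : E × ℝ => (y.1, circleMap c R y.2))
      (by fun_prop) fun y hy => ⟨hy.1, circleMap_mem_sphere c hR _⟩)
  · intro θ _
    exact (hd _ (circleMap_mem_sphere c hR θ)).const_smul _

end Holomorphic

/-! ### Division by `1 - exp (2πi ℓ)` -/

/-- The character `w ↦ exp (2πi w)` of `ℂ/ℤ`. -/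
def expTwoPiI (w : ℂ) : ℂ := Complex.exp (2 * Real.pi * Complex.I * w)

theorem expTwoPiI_add (v w : ℂ) : expTwoPiI (v + w) = expTwoPiI v * expTwoPiI w := by
  rw [expTwoPiI, mul_add, Complex.exp_add]; rfl

theorem expTwoPiI_eq_one_iff {w : ℂ} : expTwoPiI w = 1 ↔ ∃ n : ℤ, w = n := by
  rw [expTwoPiI, Complex.exp_eq_one_iff]
  have h := Complex.two_pi_I_ne_zero
  refine exists_congr fun n => ⟨fun h1 => ?_, fun h1 => by rw [h1]; ring⟩
  apply mul_left_cancel₀ h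
  rw [h1]; ring

theorem expTwoPiI_intCast (n : ℤ) : expTwoPiI n = 1 := expTwoPiI_eq_one_iff.2 ⟨n, rfl⟩

theorem differentiable_expTwoPiI : Differentiable ℂ expTwoPiI := by
  unfold expTwoPiI; fun_prop

theorem hasDerivAt_expTwoPiI (w : ℂ) :
    HasDerivAt expTwoPiI (2 * Real.pi * Complex.I * expTwoPiI w) w := by
  have h := ((hasDerivAt_id w).const_mul (2 * Real.pi * Complex.I)).cexp
  exact h.congr_deriv (by simp only [expTwoPiI, id]; ring)

theorem norm_expTwoPiI (w : ℂ) : ‖expTwoPiI w‖ = Real.exp (-(2 * Real.pi * w.im)) := by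
  rw [expTwoPiI, Complex.norm_exp]
  congr 1
  simp [Complex.mul_re, Complex.mul_im]

theorem norm_expTwoPiI_ofReal (x : ℝ) : ‖expTwoPiI x‖ = 1 := by simp [norm_expTwoPiI]

/-- The distance from `w` to the integers controls `1 - exp (2πi w)` from below. -/
theorem half_le_norm_one_sub_expTwoPiI {w : ℂ} {t : ℝ} (ht0 : 0 ≤ t) (ht : t ≤ 1)
    (h : ∀ n : ℤ, t ≤ ‖w - n‖) : t / 2 ≤ ‖1 - expTwoPiI w‖ := by
  set n := round w.re
  set v := w - n with hv
  have hvt : t ≤ ‖v‖ := h n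
  have hwv : expTwoPiI w = expTwoPiI v := by
    have : w = v + n := by rw [hv]; ring
    rw [this, expTwoPiI_add, expTwoPiI_intCast, mul_one]
  rw [hwv]
  have hre : |v.re| ≤ 1 / 2 := by
    have := abs_sub_round w.re
    simpa [hv] using this
  set a := Real.exp (-(2 * Real.pi * v.im)) with ha
  have ha0 : 0 < a := Real.exp_pos _
  have hexp : expTwoPiI v = a * (Real.cos (2 * Real.pi * v.re) : ℂ)
      + a * (Real.sin (2 * Real.pi * v.re) : ℂ) * Complex.I := by
    have h1 : 2 * Real.pi * Complex.I * v
        = ((-(2 * Real.pi * v.im) : ℝ) : ℂ) + ((2 * Real.pi * v.re : ℝ) : ℂ) * Complex.I := by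
      conv_lhs => rw [← Complex.re_add_im v]
      push_cast
      linear_combination 2 * (Real.pi : ℂ) * v.im * Complex.I_sq
    rw [expTwoPiI, h1, Complex.exp_add, Complex.exp_mul_I, ← Complex.ofReal_exp,
      ← Complex.ofReal_cos, ← Complex.ofReal_sin]
    ring
  set α := 2 * Real.pi * v.re with hα
  have hsq : ‖1 - expTwoPiI v‖ ^ 2 = (a - Real.cos α) ^ 2 + Real.sin α ^ 2 := by
    rw [hexp, Complex.sq_norm, Complex.normSq_apply]
    simp only [Complex.sub_re, Complex.add_re, Complex.mul_re, Complex.sub_im, Complex.add_im,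
      Complex.mul_im, Complex.ofReal_re, Complex.ofReal_im, Complex.I_re, Complex.I_im,
      Complex.one_re, Complex.one_im]
    have := Real.sin_sq_add_cos_sq α
    linear_combination (a ^ 2 - 1) * this
  have hsplit : t / 2 ≤ |v.im| ∨ t / 2 ≤ |v.re| := by
    by_contra! hc
    have := Complex.norm_le_abs_re_add_abs_im v
    linarith
  have hpi := Real.pi_gt_three
  have key : ∀ s : ℝ, t / 2 ≤ |s| → s ^ 2 ≤ ‖1 - expTwoPiI v‖ ^ 2 →
      t / 2 ≤ ‖1 - expTwoPiI v‖ := fun s hs hs2 =>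
    hs.trans (abs_le_of_sq_le_sq hs2 (norm_nonneg _))
  rcases hsplit with him | hre2
  · refine key (a - 1) ?_ ?_
    · rcases le_or_gt v.im 0 with h0 | h0
      · have h1 : -(2 * Real.pi * v.im) + 1 ≤ a := Real.add_one_le_exp _
        rw [abs_of_nonpos h0] at him
        rw [le_abs]; left
        nlinarith
      · rw [abs_of_pos h0] at him
        rw [le_abs]; right
        have h1 : 2 * Real.pi * v.im + 1 ≤ a⁻¹ := by
          rw [ha, ← Real.exp_neg, neg_neg]; exact Real.add_one_le_exp _
        have h2 : 1 + t ≤ a⁻¹ := by nlinarith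
        have h3 : a ≤ (1 + t)⁻¹ := by
          rw [le_inv_comm₀ ha0 (by linarith)]; exact h2
        have h4 : (1 + t)⁻¹ ≤ 1 - t / 2 := by
          rw [inv_le_iff_one_le_mul₀ (by linarith)]; nlinarith
        linarith
    · rw [hsq]
      have := Real.sin_sq_add_cos_sq α
      nlinarith [Real.cos_le_one α]
  · rcases le_or_gt |v.re| (1 / 4) with h4 | h4
    · refine key (Real.sin α) ?_ (by rw [hsq]; nlinarith [sq_nonneg (a - Real.cos α)])
      have h5 : |α| = 2 * Real.pi * |v.re| := by
        rw [hα, abs_mul, abs_of_pos (by positivity)]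
      have h6 : |α| ≤ Real.pi / 2 := by rw [h5]; nlinarith
      have h7 := Real.mul_abs_le_abs_sin h6
      rw [h5] at h7
      have h8 : 2 / Real.pi * (2 * Real.pi * |v.re|) = 4 * |v.re| := by
        field_simp; ring
      rw [h8] at h7
      linarith
    · have hcos : Real.cos α ≤ 0 := by
        rw [← Real.cos_abs]
        have h5 : |α| = 2 * Real.pi * |v.re| := by
          rw [hα, abs_mul, abs_of_pos (by positivity)]
        apply Real.cos_nonpos_of_pi_div_two_le_of_le
        · rw [h5]; nlinarith
        · rw [h5]; nlinarith
      refine key 1 (by rw [abs_one]; linarith) ?_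
      rw [hsq]
      have := Real.sin_sq_add_cos_sq α
      nlinarith

section Division

variable {E F : Type*} [NormedAddCommGroup E] [NormedSpace ℂ E]
  [NormedAddCommGroup F] [NormedSpace ℂ F]

/-- The quotient of `h` by `1 - exp (2πi ℓ)`; where the denominator vanishes, its value is the
quotient of the derivatives in the direction `v`, normalised by `ℓ v = 1`. -/
def divOneSubExp (ℓ : E →L[ℂ] ℂ) (v : E) (h : E → F) (x : E) : F :=
  if expTwoPiI (ℓ x) = 1 then (-(2 * Real.pi * Complex.I))⁻¹ • deriv (fun z : ℂ => h (x + z • v)) 0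
  else (1 - expTwoPiI (ℓ x))⁻¹ • h x

variable {ℓ : E →L[ℂ] ℂ} {v : E} {h : E → F} {U : Set E}

theorem one_sub_expTwoPiI_smul_divOneSubExp (hvan : ∀ x ∈ U, expTwoPiI (ℓ x) = 1 → h x = 0)
    {x : E} (hx : x ∈ U) : (1 - expTwoPiI (ℓ x)) • divOneSubExp ℓ v h x = h x := by
  by_cases h1 : expTwoPiI (ℓ x) = 1
  · rw [h1, sub_self, zero_smul, hvan x hx h1]
  · rw [divOneSubExp, if_neg h1, smul_smul, mul_inv_cancel₀ (sub_ne_zero.2 (Ne.symm h1)), one_smul]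

/-- Along the direction `v`, the zeros of the denominator are simple, hence removable. -/
theorem differentiableOn_divOneSubExp_line [CompleteSpace F] (hU : IsOpen U)
    (hd : DifferentiableOn ℂ h U)
    (hvan : ∀ x ∈ U, expTwoPiI (ℓ x) = 1 → h x = 0) (hv : ℓ v = 1) (x : E) :
    DifferentiableOn ℂ (fun z : ℂ => divOneSubExp ℓ v h (x + z • v)) {z | x + z • v ∈ U} := by
  intro z₀ hz₀
  have hVo : IsOpen {z : ℂ | x + z • v ∈ U} := hU.preimage (by fun_prop)
  have hVn : {z : ℂ | x + z • v ∈ U} ∈ nhds z₀ := hVo.mem_nhds hz₀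
  set a : ℂ → F := fun z => h (x + z • v) with ha
  set b : ℂ → ℂ := fun z => 1 - expTwoPiI (ℓ (x + z • v)) with hb
  have had : DifferentiableOn ℂ a {z | x + z • v ∈ U} :=
    hd.comp (by fun_prop) fun z hz => hz
  have hbz : ∀ z, b z = 1 - expTwoPiI (ℓ x + z) := fun z => by simp [hb, hv]
  have hbd : Differentiable ℂ b := by
    have := differentiable_expTwoPiI
    rw [funext hbz]
    fun_prop
  apply DifferentiableAt.differentiableWithinAt
  by_cases h1 : expTwoPiI (ℓ (x + z₀ • v)) = 1
  · have ha0 : a z₀ = 0 := hvan _ hz₀ h1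
    have hb0 : b z₀ = 0 := by simp only [hb, h1, sub_self]
    have hbderiv : deriv b z₀ = -(2 * Real.pi * Complex.I) := by
      have h2 : HasDerivAt b (-(2 * Real.pi * Complex.I * expTwoPiI (ℓ x + z₀))) z₀ := by
        rw [funext hbz]
        have := (hasDerivAt_expTwoPiI (ℓ x + z₀)).comp_const_add (ℓ x) z₀
        exact this.const_sub 1
      rw [h2.deriv]
      have h3 : expTwoPiI (ℓ x + z₀) = 1 := by
        have := hbz z₀; rw [hb0] at this; exact (sub_eq_zero.1 this.symm).symm
      rw [h3, mul_one]
    have hds : DifferentiableAt ℂ (dslope b z₀) z₀ :=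
      ((Complex.differentiableOn_dslope Filter.univ_mem).2 hbd.differentiableOn).differentiableAt
        Filter.univ_mem
    have hdsa : DifferentiableAt ℂ (dslope a z₀) z₀ :=
      ((Complex.differentiableOn_dslope hVn).2 had).differentiableAt hVn
    have hne : dslope b z₀ z₀ ≠ 0 := by
      rw [dslope_same, hbderiv]; exact neg_ne_zero.2 Complex.two_pi_I_ne_zero
    have hev : (fun z : ℂ => divOneSubExp ℓ v h (x + z • v)) =ᶠ[nhds z₀]
        fun z => (dslope b z₀ z)⁻¹ • dslope a z₀ z := by
      filter_upwards [hds.continuousAt.eventually_ne hne] with z hz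
      rcases eq_or_ne z z₀ with rfl | hzz
      · rw [divOneSubExp, if_pos h1, dslope_same, dslope_same, hbderiv]
        congr 1
        have := deriv_comp_const_add a z 0
        rw [add_zero] at this
        rw [← this]
        congr 1
        ext w
        simp only [ha]
        congr 1
        rw [add_smul]; abel
      · have hbz : b z = (z - z₀) • dslope b z₀ z := by
          rw [sub_smul_dslope, hb0, sub_zero]
        have haz : a z = (z - z₀) • dslope a z₀ z := by
          rw [sub_smul_dslope, ha0, sub_zero]
        have hzz' : z - z₀ ≠ 0 := sub_ne_zero.2 hzz
        have hbne : b z ≠ 0 := by rw [hbz]; exact mul_ne_zero hzz' hz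
        have h2 : expTwoPiI (ℓ (x + z • v)) ≠ 1 := fun h3 => hbne (by simp only [hb, h3, sub_self])
        rw [divOneSubExp, if_neg h2]
        change (b z)⁻¹ • a z = _
        rw [hbz, haz, smul_smul, smul_eq_mul, mul_inv]
        congr 1
        field_simp
    exact (hds.inv hne |>.smul hdsa).congr_of_eventuallyEq hev
  · have h2 : ∀ᶠ z in nhds z₀, b z ≠ 0 :=
      hbd.continuous.continuousAt.eventually_ne (sub_ne_zero.2 (Ne.symm h1))
    have hev : (fun z : ℂ => divOneSubExp ℓ v h (x + z • v)) =ᶠ[nhds z₀]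
        fun z => (b z)⁻¹ • a z := by
      filter_upwards [h2] with z hz
      rw [divOneSubExp, if_neg fun h3 => hz (by simp only [hb, h3, sub_self])]
    exact ((hbd z₀).inv (sub_ne_zero.2 (Ne.symm h1)) |>.smul (had.differentiableAt hVn)).congr_of_eventuallyEq hev

/-- On a circle of radius `σ ≤ 1/4` around a point within `σ/2` of an integer, every point has
distance at least `σ/2` from all the integers. -/
theorem half_le_norm_sub_intCast {w z : ℂ} {σ : ℝ} {n : ℤ} (hσ : σ ≤ 1 / 4)
    (hn : ‖w - n‖ < σ / 2) (hz : ‖z‖ = σ) (m : ℤ) : σ / 2 ≤ ‖w + z - m‖ := by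
  rcases eq_or_ne m n with rfl | hmn
  · have h1 := norm_sub_norm_le z (-(w - m))
    rw [norm_neg, sub_neg_eq_add] at h1
    have : z + (w - m) = w + z - m := by ring
    rw [this] at h1
    linarith
  · have h1 : (1 : ℝ) ≤ ‖((n : ℂ) - m)‖ := by
      rw [← Int.cast_sub, Complex.norm_intCast]
      exact_mod_cast Int.one_le_abs (sub_ne_zero.2 (Ne.symm hmn))
    have h2 : (n : ℂ) - m = (w + z - m) - (w - n) - z := by ring
    have h3 : ‖(n : ℂ) - m‖ ≤ ‖w + z - m‖ + ‖w - n‖ + ‖z‖ := by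
      rw [h2]; exact (norm_sub_le _ _).trans (add_le_add_left (norm_sub_le _ _) _)
    linarith

/-- The loss in the small divisor estimate is one power of the distance `σ` to the boundary. -/
theorem norm_divOneSubExp_le [CompleteSpace F] (hU : IsOpen U) (hd : DifferentiableOn ℂ h U)
    (hvan : ∀ x ∈ U, expTwoPiI (ℓ x) = 1 → h x = 0) (hv : ℓ v = 1) {x : E} {σ M : ℝ}
    (hσ0 : 0 < σ) (hσ : σ ≤ 1 / 4) (hx : ∀ z : ℂ, ‖z‖ ≤ σ → x + z • v ∈ U)
    (hM : ∀ z : ℂ, ‖z‖ ≤ σ → ‖h (x + z • v)‖ ≤ M) :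
    ‖divOneSubExp ℓ v h x‖ ≤ 4 * M / σ := by
  have hfar : ∀ z : ℂ, ‖z‖ ≤ σ → (∀ m : ℤ, σ / 2 ≤ ‖ℓ x + z - m‖) →
      ‖divOneSubExp ℓ v h (x + z • v)‖ ≤ 4 * M / σ := by
    intro z hz hm
    have hM0 : 0 ≤ M := (norm_nonneg _).trans (hM z hz)
    have h1 := half_le_norm_one_sub_expTwoPiI (by positivity) (by linarith) hm
    have h2 : ℓ (x + z • v) = ℓ x + z := by simp [hv]
    have h3 : expTwoPiI (ℓ x + z) ≠ 1 := fun h3 => by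
      rw [h3, sub_self, norm_zero] at h1; linarith
    rw [divOneSubExp, h2, if_neg h3, norm_smul, norm_inv]
    calc ‖1 - expTwoPiI (ℓ x + z)‖⁻¹ * ‖h (x + z • v)‖ ≤ (σ / 2 / 2)⁻¹ * M := by
          gcongr
          exact hM z hz
      _ = 4 * M / σ := by field_simp; ring
  by_cases hn : ∃ n : ℤ, ‖ℓ x - n‖ < σ / 2
  · obtain ⟨n, hn⟩ := hn
    have hq := differentiableOn_divOneSubExp_line hU hd hvan hv x
    have hq2 : DiffContOnCl ℂ (fun z : ℂ => divOneSubExp ℓ v h (x + z • v)) (Metric.ball 0 σ) := by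
      apply DifferentiableOn.diffContOnCl
      refine hq.mono fun z hz => hx z ?_
      rw [closure_ball _ hσ0.ne'] at hz
      simpa using hz
    have := Complex.norm_le_of_forall_mem_frontier_norm_le (C := 4 * M / σ) (z := 0)
      Metric.isBounded_ball hq2 (fun z hz => ?_)
      (subset_closure (Metric.mem_ball_self hσ0))
    · simpa using this
    · rw [frontier_ball _ hσ0.ne', mem_sphere_zero_iff_norm] at hz
      exact hfar z hz.le (half_le_norm_sub_intCast hσ hn hz)
  · push Not at hn
    have := hfar 0 (by simpa using hσ0.le) (by simpa using hn)
    simpa using this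

/-- The quotient is holomorphic also across the zeros of the denominator, since it is there given
by Cauchy's integral over a circle in the direction `v` that avoids them. -/
theorem differentiableOn_divOneSubExp [CompleteSpace F] [ProperSpace E] (hU : IsOpen U)
    (hd : DifferentiableOn ℂ h U) (hvan : ∀ x ∈ U, expTwoPiI (ℓ x) = 1 → h x = 0) (hv : ℓ v = 1) :
    DifferentiableOn ℂ (divOneSubExp ℓ v h) U := by
  intro x₀ hx₀
  apply DifferentiableAt.differentiableWithinAt
  have hbd : Differentiable ℂ fun x => 1 - expTwoPiI (ℓ x) := by
    have := differentiable_expTwoPiI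
    fun_prop
  by_cases h1 : expTwoPiI (ℓ x₀) = 1
  · obtain ⟨n, hn⟩ := expTwoPiI_eq_one_iff.1 h1
    obtain ⟨σ₁, hσ₁, hσ₁U⟩ : ∃ σ > 0, ∀ z : ℂ, ‖z‖ ≤ σ → x₀ + z • v ∈ U := by
      have hc : Continuous fun z : ℂ => x₀ + z • v := by fun_prop
      have : {z : ℂ | x₀ + z • v ∈ U} ∈ nhds (0 : ℂ) :=
        hc.continuousAt.preimage_mem_nhds (by simpa using hU.mem_nhds hx₀)
      obtain ⟨σ, hσ, hσU⟩ := Metric.nhds_basis_closedBall.mem_iff.1 this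
      exact ⟨σ, hσ, fun z hz => hσU (by simpa using hz)⟩
    set σ := min σ₁ (1 / 4) with hσdef
    have hσ0 : 0 < σ := lt_min hσ₁ (by norm_num)
    have hσ4 : σ ≤ 1 / 4 := min_le_right _ _
    have hdisk : ∀ᶠ x in nhds x₀, ∀ z ∈ Metric.closedBall (0 : ℂ) σ, x + z • v ∈ U := by
      refine (isCompact_closedBall (0 : ℂ) σ).eventually_forall_of_forall_eventually
        (P := fun x z => x + z • v ∈ U) fun z hz => ?_
      have hc : Continuous fun y : E × ℂ => y.1 + y.2 • v := by fun_prop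
      refine hc.continuousAt.eventually (hU.mem_nhds ?_)
      exact hσ₁U z ((mem_closedBall_zero_iff.1 hz).trans (min_le_left _ _))
    have hnear : ∀ᶠ x in nhds x₀, ‖ℓ x - n‖ < σ / 2 := by
      have hc : Continuous fun x => ‖ℓ x - n‖ := by fun_prop
      refine hc.continuousAt.eventually_lt_const ?_
      simp only [hn, sub_self, norm_zero]; positivity
    obtain ⟨W, hWsub, hWo, hxW⟩ := mem_nhds_iff.1 (hdisk.and hnear)
    have hcircle : ∀ x ∈ W, ∀ z ∈ Metric.sphere (0 : ℂ) σ, expTwoPiI (ℓ (x + z • v)) ≠ 1 := by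
      intro x hx z hz h2
      obtain ⟨m, hm⟩ := expTwoPiI_eq_one_iff.1 h2
      have h3 := half_le_norm_sub_intCast hσ4 (hWsub hx).2 (mem_sphere_zero_iff_norm.1 hz) m
      have h4 : ℓ (x + z • v) = ℓ x + z := by simp [hv]
      rw [← h4, hm, sub_self, norm_zero] at h3
      linarith
    have hcU : ∀ x ∈ W, ∀ z ∈ Metric.sphere (0 : ℂ) σ, x + z • v ∈ U := fun x hx z hz =>
      (hWsub hx).1 z (Metric.sphere_subset_closedBall hz)
    have hint : DifferentiableOn ℂ (fun x => ∮ z in C((0 : ℂ), σ),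
        (z - 0)⁻¹ • ((1 - expTwoPiI (ℓ (x + z • v)))⁻¹ • h (x + z • v))) W := by
      refine differentiableOn_circleIntegral hWo hσ0.le ?_ fun z hz => ?_
      · have hz0 : ∀ y ∈ W ×ˢ Metric.sphere (0 : ℂ) σ, y.2 - 0 ≠ 0 := fun y hy => by
          rw [sub_zero]; exact Metric.ne_of_mem_sphere hy.2 hσ0.ne'
        refine ContinuousOn.smul (ContinuousOn.inv₀ (by fun_prop) hz0) (ContinuousOn.smul
          (ContinuousOn.inv₀ (f := fun y : E × ℂ => 1 - expTwoPiI (ℓ (y.1 + y.2 • v))) ?_ ?_) ?_)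
        · exact (hbd.continuous.comp (by fun_prop : Continuous fun y : E × ℂ => y.1 + y.2 • v)).continuousOn
        · exact fun y hy => sub_ne_zero.2 (hcircle y.1 hy.1 y.2 hy.2).symm
        · exact hd.continuousOn.comp (f := fun y : E × ℂ => y.1 + y.2 • v) (by fun_prop)
            fun y hy => hcU y.1 hy.1 y.2 hy.2
      · have h4 : DifferentiableOn ℂ (fun y => 1 - expTwoPiI (ℓ (y + z • v))) W :=
          (hbd.comp (by fun_prop : Differentiable ℂ fun y => y + z • v)).differentiableOn
        refine DifferentiableOn.const_smul (DifferentiableOn.smul (h4.inv ?_) ?_) _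
        · exact fun y hy => sub_ne_zero.2 (hcircle y hy z hz).symm
        · exact hd.comp (f := fun y => y + z • v) (by fun_prop) fun y hy => hcU y hy z hz
    have hev : divOneSubExp ℓ v h =ᶠ[nhds x₀] fun x => (2 * Real.pi * Complex.I)⁻¹ •
        ∮ z in C((0 : ℂ), σ), (z - 0)⁻¹ • ((1 - expTwoPiI (ℓ (x + z • v)))⁻¹ • h (x + z • v)) := by
      filter_upwards [hWo.mem_nhds hxW] with x hx
      have hq : DifferentiableOn ℂ (fun z : ℂ => divOneSubExp ℓ v h (x + z • v))
          (Metric.closedBall 0 σ) :=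
        (differentiableOn_divOneSubExp_line hU hd hvan hv x).mono fun z hz => (hWsub hx).1 z hz
      have hC := hq.circleIntegral_sub_inv_smul (Metric.mem_ball_self hσ0)
      rw [zero_smul, add_zero] at hC
      have hcongr : (∮ z in C((0 : ℂ), σ),
          (z - 0)⁻¹ • ((1 - expTwoPiI (ℓ (x + z • v)))⁻¹ • h (x + z • v)))
          = ∮ z in C((0 : ℂ), σ), (z - 0)⁻¹ • divOneSubExp ℓ v h (x + z • v) := by
        refine circleIntegral.integral_congr hσ0.le fun z hz => ?_
        simp only [divOneSubExp, if_neg (hcircle x hx z hz)]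
      rw [hcongr, hC, smul_smul, inv_mul_cancel₀ Complex.two_pi_I_ne_zero, one_smul]
    exact ((hint.differentiableAt (hWo.mem_nhds hxW)).const_smul _).congr_of_eventuallyEq hev
  · have h2 : ∀ᶠ x in nhds x₀, 1 - expTwoPiI (ℓ x) ≠ 0 :=
      hbd.continuous.continuousAt.eventually_ne (sub_ne_zero.2 (Ne.symm h1))
    have hev : divOneSubExp ℓ v h =ᶠ[nhds x₀] fun x => (1 - expTwoPiI (ℓ x))⁻¹ • h x := by
      filter_upwards [h2] with x hx
      rw [divOneSubExp, if_neg fun h3 => hx (by rw [h3, sub_self])]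
    exact ((hbd x₀).inv (sub_ne_zero.2 (Ne.symm h1)) |>.smul
      (hd.differentiableAt (hU.mem_nhds hx₀))).congr_of_eventuallyEq hev

end Division

/-! ### Taylor expansion in the parameter -/

section Taylor

variable {P F : Type*} [NormedAddCommGroup F] [NormedSpace ℂ F]

/-- The `j`-th Taylor coefficient at `ε = 0` of `ε ↦ w (ε, p)`, as an integral over the circle of
radius `r`. -/
def paramCoeff (r : ℝ) (w : ℂ × P → F) (j : ℕ) (p : P) : F :=
  (2 * Real.pi * Complex.I : ℂ)⁻¹ • ∮ z in C(0, r), (z ^ (j + 1))⁻¹ • w (z, p)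

/-- The quotient by `ε ^ m` of the Taylor remainder of order `m` of `ε ↦ w (ε, p)`. -/
def paramRemainder (r : ℝ) (w : ℂ × P → F) (m : ℕ) (x : ℂ × P) : F :=
  (2 * Real.pi * Complex.I : ℂ)⁻¹ • ∮ z in C(0, r), (z ^ m * (z - x.1))⁻¹ • w (z, x.2)

variable {r R M : ℝ} {w : ℂ × P → F} {V : Set P}

theorem sphere_ne_zero (hr : 0 < r) {z : ℂ} (hz : z ∈ Metric.sphere (0 : ℂ) r) : z ≠ 0 :=
  Metric.ne_of_mem_sphere hz hr.ne'

theorem sphere_sub_ne_zero {z ε : ℂ} (hz : z ∈ Metric.sphere (0 : ℂ) r)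
    (hε : ε ∈ paramDisk r) : z - ε ≠ 0 := by
  intro h
  rw [sub_eq_zero] at h
  rw [← h, paramDisk, mem_ball_zero_iff, mem_sphere_zero_iff_norm.1 hz] at hε
  exact lt_irrefl _ hε

theorem sphere_subset_paramDisk (hrR : r < R) : Metric.sphere (0 : ℂ) r ⊆ paramDisk R :=
  fun z hz => by
    rw [paramDisk, mem_ball_zero_iff, mem_sphere_zero_iff_norm.1 hz]; exact hrR

theorem norm_two_pi_I_inv : ‖(2 * Real.pi * Complex.I : ℂ)⁻¹‖ = (2 * Real.pi)⁻¹ := by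
  rw [norm_inv]; simp [abs_of_pos Real.pi_pos]

theorem norm_paramCoeff_le (hr : 0 < r) {p : P} (hM : ∀ z ∈ Metric.sphere (0 : ℂ) r, ‖w (z, p)‖ ≤ M)
    (j : ℕ) : ‖paramCoeff r w j p‖ ≤ M / r ^ j := by
  have h := circleIntegral.norm_integral_le_of_norm_le_const (C := M / r ^ (j + 1)) (c := (0 : ℂ))
    (f := fun z => (z ^ (j + 1))⁻¹ • w (z, p)) hr.le fun z hz => ?_
  · rw [paramCoeff, norm_smul, norm_two_pi_I_inv]
    calc (2 * Real.pi)⁻¹ * _ ≤ (2 * Real.pi)⁻¹ * (2 * Real.pi * r * (M / r ^ (j + 1))) := by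
          gcongr
      _ = M / r ^ j := by rw [pow_succ]; field_simp
  · rw [norm_smul, norm_inv, norm_pow, mem_sphere_zero_iff_norm.1 hz, ← div_eq_inv_mul]
    gcongr
    exact hM z hz

theorem norm_paramRemainder_le (hr : 0 < r) {x : ℂ × P} (hx : ‖x.1‖ < r)
    (hM : ∀ z ∈ Metric.sphere (0 : ℂ) r, ‖w (z, x.2)‖ ≤ M) (m : ℕ) :
    ‖paramRemainder r w m x‖ ≤ M / r ^ m * (r / (r - ‖x.1‖)) := by
  have hpos : 0 < r - ‖x.1‖ := sub_pos.2 hx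
  have h := circleIntegral.norm_integral_le_of_norm_le_const (C := M / (r ^ m * (r - ‖x.1‖)))
    (c := (0 : ℂ)) (f := fun z => (z ^ m * (z - x.1))⁻¹ • w (z, x.2)) hr.le fun z hz => ?_
  · rw [paramRemainder, norm_smul, norm_two_pi_I_inv]
    calc (2 * Real.pi)⁻¹ * _ ≤ (2 * Real.pi)⁻¹ * (2 * Real.pi * r * (M / (r ^ m * (r - ‖x.1‖)))) := by
          gcongr
      _ = M / r ^ m * (r / (r - ‖x.1‖)) := by field_simp
  · have hz' := mem_sphere_zero_iff_norm.1 hz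
    have h1 : r - ‖x.1‖ ≤ ‖z - x.1‖ := by rw [← hz']; exact norm_sub_norm_le _ _
    have hM0 : 0 ≤ M := (norm_nonneg _).trans (hM z hz)
    rw [norm_smul, norm_inv, norm_mul, norm_pow, hz', ← div_eq_inv_mul]
    exact div_le_div₀ hM0 (hM z hz) (by positivity) (by gcongr)

variable [NormedAddCommGroup P] [NormedSpace ℂ P]

theorem differentiableOn_slice {A : Set ℂ} (hw : DifferentiableOn ℂ w (A ×ˢ V)) {z : ℂ}
    (hz : z ∈ A) : DifferentiableOn ℂ (fun p => w (z, p)) V :=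
  hw.comp (f := fun p => (z, p)) (by fun_prop) fun _ hp => ⟨hz, hp⟩

theorem differentiableOn_param {A : Set ℂ} (hw : DifferentiableOn ℂ w (A ×ˢ V)) {p : P}
    (hp : p ∈ V) : DifferentiableOn ℂ (fun z => w (z, p)) A :=
  hw.comp (f := fun z => (z, p)) (by fun_prop) fun _ hz => ⟨hz, hp⟩

theorem differentiableOn_paramCoeff [ProperSpace P] (hr : 0 < r) (hrR : r < R) (hV : IsOpen V)
    (hw : DifferentiableOn ℂ w (paramDisk R ×ˢ V)) (j : ℕ) :
    DifferentiableOn ℂ (paramCoeff r w j) V := by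
  have hs := sphere_subset_paramDisk hrR
  refine DifferentiableOn.const_smul (differentiableOn_circleIntegral hV hr.le ?_ fun z hz => ?_) _
  · refine ContinuousOn.smul (ContinuousOn.inv₀ (by fun_prop) fun y hy =>
      pow_ne_zero _ (sphere_ne_zero hr hy.2)) ?_
    exact hw.continuousOn.comp (f := fun y : P × ℂ => (y.2, y.1)) (by fun_prop)
      fun y hy => ⟨hs hy.2, hy.1⟩
  · exact (differentiableOn_slice hw (hs hz)).const_smul _

theorem differentiableOn_paramRemainder [ProperSpace P] (hr : 0 < r) (hrR : r < R) (hV : IsOpen V)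
    (hw : DifferentiableOn ℂ w (paramDisk R ×ˢ V)) (m : ℕ) :
    DifferentiableOn ℂ (paramRemainder r w m) (paramDisk r ×ˢ V) := by
  have hs := sphere_subset_paramDisk hrR
  have hne : ∀ z ∈ Metric.sphere (0 : ℂ) r, ∀ x ∈ paramDisk r ×ˢ V, z ^ m * (z - x.1) ≠ 0 :=
    fun z hz x hx => mul_ne_zero (pow_ne_zero _ (sphere_ne_zero hr hz)) (sphere_sub_ne_zero hz hx.1)
  refine DifferentiableOn.const_smul (differentiableOn_circleIntegral
    (Metric.isOpen_ball.prod hV) hr.le ?_ fun z hz => ?_) _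
  · refine ContinuousOn.smul (ContinuousOn.inv₀ (by fun_prop) fun y hy => hne _ hy.2 _ hy.1) ?_
    exact hw.continuousOn.comp (f := fun y : (ℂ × P) × ℂ => (y.2, y.1.2)) (by fun_prop)
      fun y hy => ⟨hs hy.2, hy.1.2⟩
  · have h1 : DifferentiableOn ℂ (fun x : ℂ × P => z ^ m * (z - x.1)) (paramDisk r ×ˢ V) := by
      fun_prop
    exact (h1.inv fun x hx => hne z hz x hx).smul
      ((differentiableOn_slice hw (hs hz)).comp (f := fun x : ℂ × P => x.2) (by fun_prop)
        fun x hx => hx.2)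

theorem eq_sum_paramCoeff_add_paramRemainder [CompleteSpace F] (hr : 0 < r) (hrR : r < R)
    (hw : DifferentiableOn ℂ w (paramDisk R ×ˢ V)) (m : ℕ) {x : ℂ × P} (hx : x ∈ paramDisk r ×ˢ V) :
    w x = (∑ j ∈ Finset.range m, x.1 ^ j • paramCoeff r w j x.2)
      + x.1 ^ m • paramRemainder r w m x := by
  obtain ⟨ε, p⟩ := x
  obtain ⟨hε, hp⟩ := hx
  simp only at hε hp ⊢
  have hs := sphere_subset_paramDisk hrR
  have hwp := differentiableOn_param hw hp
  have hC := (hwp.mono (Metric.closedBall_subset_ball hrR)).circleIntegral_sub_inv_smul hε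
  have hcw : ContinuousOn (fun z => w (z, p)) (Metric.sphere 0 r) := hwp.continuousOn.mono hs
  have hint : ∀ j ∈ Finset.range m,
      CircleIntegrable (fun z => ε ^ j • ((z ^ (j + 1))⁻¹ • w (z, p))) 0 r := fun j _ =>
    ContinuousOn.circleIntegrable hr.le (ContinuousOn.const_smul (ContinuousOn.smul
      (ContinuousOn.inv₀ (by fun_prop) fun z hz => pow_ne_zero _ (sphere_ne_zero hr hz)) hcw) _)
  have hint2 : CircleIntegrable (fun z => ε ^ m • ((z ^ m * (z - ε))⁻¹ • w (z, p))) 0 r :=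
    ContinuousOn.circleIntegrable hr.le (ContinuousOn.const_smul (ContinuousOn.smul
      (ContinuousOn.inv₀ (by fun_prop) fun z hz => mul_ne_zero (pow_ne_zero _ (sphere_ne_zero hr hz))
        (sphere_sub_ne_zero hz hε)) hcw) _)
  have hgeom : ∀ z ∈ Metric.sphere (0 : ℂ) r, (z - ε)⁻¹ • w (z, p)
      = (∑ j ∈ Finset.range m, ε ^ j • ((z ^ (j + 1))⁻¹ • w (z, p)))
        + ε ^ m • ((z ^ m * (z - ε))⁻¹ • w (z, p)) := by
    intro z hz
    have hz0 := sphere_ne_zero hr hz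
    have hzε := sphere_sub_ne_zero hz hε
    simp only [smul_smul, ← Finset.sum_smul, ← add_smul]
    congr 1
    have key : ∀ n : ℕ, (z - ε)⁻¹ = (∑ j ∈ Finset.range n, ε ^ j * (z ^ (j + 1))⁻¹)
        + ε ^ n * (z ^ n * (z - ε))⁻¹ := by
      intro n
      induction n with
      | zero => simp
      | succ n ih =>
        rw [ih, Finset.sum_range_succ, add_assoc]
        congr 1
        field_simp
        ring
    exact key m
  have h2 : (∮ z in C(0, r), (z - ε)⁻¹ • w (z, p))
      = (∑ j ∈ Finset.range m, ε ^ j • ∮ z in C(0, r), (z ^ (j + 1))⁻¹ • w (z, p))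
        + ε ^ m • ∮ z in C(0, r), (z ^ m * (z - ε))⁻¹ • w (z, p) := by
    rw [circleIntegral.integral_congr hr.le hgeom, circleIntegral.integral_add
      (CircleIntegrable.fun_sum _ hint) hint2, circleIntegral.integral_fun_sum hint]
    simp only [circleIntegral.integral_smul]
  rw [h2] at hC
  simp only [paramCoeff, paramRemainder]
  calc w (ε, p) = (2 * Real.pi * Complex.I : ℂ)⁻¹ • ((2 * Real.pi * Complex.I : ℂ) • w (ε, p)) := by
        rw [smul_smul, inv_mul_cancel₀ Complex.two_pi_I_ne_zero, one_smul]
    _ = _ := by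
        rw [← hC, smul_add, Finset.smul_sum]
        simp only [smul_comm (2 * (Real.pi : ℂ) * Complex.I)⁻¹ (_ : ℂ)]

/-- If `∑ i, w (ε, q i)` is divisible by `ε ^ m`, its Taylor coefficients of degree less than `m`
vanish. -/
theorem sum_paramCoeff_eq_zero (hr : 0 < r) (hrR : r < R)
    (hw : DifferentiableOn ℂ w (paramDisk R ×ˢ V)) {ι : Type*} (s : Finset ι) {q : ι → P}
    (hq : ∀ i ∈ s, q i ∈ V) {m j : ℕ} (hj : j < m) {b : ℂ → F}
    (hb : DifferentiableOn ℂ b (paramDisk R))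
    (h : ∀ z ∈ Metric.sphere (0 : ℂ) r, ∑ i ∈ s, w (z, q i) = z ^ m • b z) :
    ∑ i ∈ s, paramCoeff r w j (q i) = 0 := by
  have hs := sphere_subset_paramDisk hrR
  have hint : ∀ i ∈ s, CircleIntegrable (fun z => (z ^ (j + 1))⁻¹ • w (z, q i)) 0 r := fun i hi =>
    ContinuousOn.circleIntegrable hr.le (ContinuousOn.smul (ContinuousOn.inv₀ (by fun_prop)
      fun z hz => pow_ne_zero _ (sphere_ne_zero hr hz))
      ((differentiableOn_param hw (hq i hi)).continuousOn.mono hs))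
  simp only [paramCoeff]
  rw [← Finset.smul_sum, ← circleIntegral.integral_fun_sum hint]
  have hcongr : ∀ z ∈ Metric.sphere (0 : ℂ) r,
      ∑ i ∈ s, (z ^ (j + 1))⁻¹ • w (z, q i) = z ^ (m - (j + 1)) • b z := by
    intro z hz
    have hz0 := sphere_ne_zero hr hz
    rw [← Finset.smul_sum, h z hz, smul_smul]
    congr 1
    rw [inv_mul_eq_iff_eq_mul₀ (pow_ne_zero _ hz0), ← pow_add, Nat.add_sub_cancel' hj]
  rw [circleIntegral.integral_congr hr.le hcongr]
  have hd : DifferentiableOn ℂ (fun z => z ^ (m - (j + 1)) • b z) (paramDisk R) :=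
    DifferentiableOn.smul (by fun_prop) hb
  have h0 := DiffContOnCl.circleIntegral_eq_zero (c := (0 : ℂ)) hr.le
    (DifferentiableOn.diffContOnCl (s := Metric.ball (0 : ℂ) r)
      (hd.mono (by rw [closure_ball _ hr.ne']; exact Metric.closedBall_subset_ball hrR)))
  rw [h0, smul_zero]

end Taylor

/-! ### Complex neighbourhoods of the real phase space -/

section Geometry

variable {d : ℕ}

/-- The counterpart of `phaseDomain` with strict inequalities: an open convex set of lifts, invariant
under real translations of `θ`. -/
def openPhase (d : ℕ) (s : ℝ) : Set (Phase d) :=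
  {p | (∀ j, |(p.1 j).im| < s) ∧ Metric.infDist p.2 (realCube d) < s / 10}

/-- A real vector as a vector of `ℂ^d`. -/
def realVec (t : Fin d → ℝ) : EuclideanSpace ℂ (Fin d) := WithLp.toLp 2 fun j => (t j : ℂ)

@[simp] theorem realVec_apply (t : Fin d → ℝ) (j : Fin d) : realVec t j = t j := rfl

@[simp] theorem intVec_apply (m : Fin d → ℤ) (j : Fin d) : intVec m j = m j := rfl

theorem intVec_eq_realVec (m : Fin d → ℤ) : intVec m = realVec fun j => (m j : ℝ) := by
  ext j; simp

theorem continuous_realVec : Continuous (realVec : (Fin d → ℝ) → EuclideanSpace ℂ (Fin d)) := by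
  unfold realVec
  exact (PiLp.continuous_toLp 2 _).comp (by fun_prop)

theorem realVec_add (s t : Fin d → ℝ) : realVec (s + t) = realVec s + realVec t := by
  ext j; simp

theorem realVec_zero : realVec (0 : Fin d → ℝ) = 0 := by ext j; simp

/-- The real part of a vector of `ℂ^d`. -/
def reVec (I : EuclideanSpace ℂ (Fin d)) : Fin d → ℝ := fun j => (I j).re

/-- The imaginary part of a vector of `ℂ^d`. -/
def imVec (I : EuclideanSpace ℂ (Fin d)) : Fin d → ℝ := fun j => (I j).im

theorem realVec_reVec_add_I_smul (I : EuclideanSpace ℂ (Fin d)) :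
    realVec (reVec I) + Complex.I • realVec (imVec I) = I := by
  ext j
  simp only [reVec, imVec, PiLp.add_apply, PiLp.smul_apply, realVec_apply, smul_eq_mul]
  rw [mul_comm]; exact Complex.re_add_im _

theorem zero_mem_realCube : (0 : EuclideanSpace ℂ (Fin d)) ∈ realCube d := fun j => by simp

theorem convex_realCube : Convex ℝ (realCube d) := by
  intro x hx y hy a b ha hb hab j
  obtain ⟨hx1, hx2, hx3⟩ := hx j
  obtain ⟨hy1, hy2, hy3⟩ := hy j
  simp only [PiLp.add_apply, PiLp.smul_apply, Complex.add_im, Complex.smul_im, hx1, hy1,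
    Complex.add_re, Complex.smul_re, smul_eq_mul, mul_zero, add_zero, true_and, Set.mem_Icc]
  constructor <;> nlinarith

theorem isOpen_openPhase (s : ℝ) : IsOpen (openPhase d s) := by
  have h : openPhase d s = (⋂ j, {p : Phase d | |(p.1 j).im| < s})
      ∩ {p : Phase d | Metric.infDist p.2 (realCube d) < s / 10} := by
    ext p; simp [openPhase]
  rw [h]
  refine (isOpen_iInter_of_finite fun j => ?_).inter ?_
  · exact isOpen_lt (by fun_prop) continuous_const
  · exact isOpen_lt ((Metric.continuous_infDist_pt _).comp continuous_snd) continuous_const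

theorem convex_openPhase (s : ℝ) : Convex ℝ (openPhase d s) := by
  intro p hp q hq a b ha hb hab
  refine ⟨fun j => ?_, ?_⟩
  · have h1 := abs_lt.1 (hp.1 j)
    have h2 := abs_lt.1 (hq.1 j)
    simp only [Prod.fst_add, Prod.smul_fst, PiLp.add_apply, PiLp.smul_apply, Complex.add_im,
      Complex.smul_im, smul_eq_mul]
    rcases ha.eq_or_lt with rfl | ha
    · rw [zero_add] at hab; subst hab; simpa using hq.1 j
    · rw [abs_lt]; constructor <;> nlinarith
  · have h := Metric.isOpen_thickening (δ := s / 10) (E := realCube d)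
    have hc := convex_realCube (d := d) |>.thickening (s / 10)
    have hmem : ∀ I, I ∈ Metric.thickening (s / 10) (realCube d)
        ↔ Metric.infDist I (realCube d) < s / 10 := fun I =>
      Metric.mem_thickening_iff_infDist_lt ⟨0, zero_mem_realCube⟩
    exact (hmem _).1 (hc ((hmem _).2 hp.2) ((hmem _).2 hq.2) ha hb hab)

theorem openPhase_mono {s t : ℝ} (h : s ≤ t) : openPhase d s ⊆ openPhase d t := fun _ hp =>
  ⟨fun j => (hp.1 j).trans_le h, hp.2.trans_le (by linarith)⟩

theorem openPhase_subset_phaseDomain (s : ℝ) : openPhase d s ⊆ phaseDomain d s := fun _ hp =>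
  ⟨fun j => (hp.1 j).le, hp.2.le⟩

theorem phaseDomain_subset_openPhase {s t : ℝ} (h : s < t) : phaseDomain d s ⊆ openPhase d t :=
  fun _ hp => ⟨fun j => (hp.1 j).trans_lt h, hp.2.trans_lt (by linarith)⟩

theorem pos_of_mem_openPhase {s : ℝ} {p : Phase d} (hp : p ∈ openPhase d s) : 0 < s := by
  have h := Metric.infDist_nonneg.trans_lt hp.2
  linarith

theorem add_fst_mem_openPhase {s t : ℝ} (ht : 0 ≤ t) {p : Phase d} (hp : p ∈ openPhase d s)
    {c : EuclideanSpace ℂ (Fin d)} (hc : ∀ j, |(c j).im| ≤ t) :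
    (p.1 + c, p.2) ∈ openPhase d (s + t) := by
  refine ⟨fun j => ?_, hp.2.trans_le (by linarith)⟩
  have h1 := abs_lt.1 (hp.1 j)
  have h2 := abs_le.1 (hc j)
  rw [PiLp.add_apply, Complex.add_im, abs_lt]
  constructor <;> linarith

theorem add_realVec_mem_openPhase {s : ℝ} {p : Phase d} (hp : p ∈ openPhase d s)
    (t : Fin d → ℝ) : (p.1 + realVec t, p.2) ∈ openPhase d s := by
  simpa using add_fst_mem_openPhase le_rfl hp (c := realVec t) fun j => by simp

theorem add_snd_mem_openPhase {s t : ℝ} (ht : 0 ≤ t) {p : Phase d} (hp : p ∈ openPhase d s)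
    {v : EuclideanSpace ℂ (Fin d)} (hv : ‖v‖ ≤ t / 10) : (p.1, p.2 + v) ∈ openPhase d (s + t) := by
  refine ⟨fun j => (hp.1 j).trans_le (by linarith), ?_⟩
  have h1 := Metric.infDist_le_infDist_add_dist (s := realCube d) (x := p.2 + v) (y := p.2)
  rw [dist_eq_norm, add_sub_cancel_left] at h1
  have := hp.2
  dsimp only
  linarith

theorem zero_fst_mem_openPhase {s : ℝ} {p : Phase d} (hp : p ∈ openPhase d s) :
    ((0 : EuclideanSpace ℂ (Fin d)), p.2) ∈ openPhase d s :=
  ⟨fun j => by simpa using pos_of_mem_openPhase hp, hp.2⟩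

theorem realVec_reVec_mem_openPhase {s : ℝ} {p : Phase d} (hp : p ∈ openPhase d s) :
    (p.1, realVec (reVec p.2)) ∈ openPhase d s := by
  refine ⟨hp.1, ?_⟩
  have hne : (realCube d).Nonempty := ⟨0, zero_mem_realCube⟩
  obtain ⟨y, hy, hlt⟩ := (Metric.infDist_lt_iff hne).1 hp.2
  refine (Metric.infDist_lt_iff hne).2 ⟨y, hy, lt_of_le_of_lt ?_ hlt⟩
  rw [EuclideanSpace.dist_eq, EuclideanSpace.dist_eq]
  refine Real.sqrt_le_sqrt (Finset.sum_le_sum fun j _ => ?_)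
  rw [Complex.dist_eq, Complex.dist_eq]
  refine pow_le_pow_left₀ (norm_nonneg _) ?_ 2
  have h1 : realVec (reVec p.2) j - y j = ((p.2 j - y j).re : ℂ) := by
    apply Complex.ext <;> simp [reVec, (hy j).1]
  rw [h1, Complex.norm_real]
  exact Complex.abs_re_le_norm _

theorem shear_iterate (p : Phase d) (n : ℕ) : shear^[n] p = (p.1 + (n : ℂ) • p.2, p.2) := by
  induction n with
  | zero => simp
  | succ n ih =>
    rw [Function.iterate_succ_apply', ih, shear]
    ext1
    · simp only [Nat.cast_add, Nat.cast_one, add_smul, one_smul, add_assoc]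
    · rfl

/-- `ℤ^d`-periodicity in `θ` on a set of lifts. -/
def IsIntPeriodic {G : Type*} (V : Set (Phase d)) (g : Phase d → G) : Prop :=
  ∀ p ∈ V, ∀ m : Fin d → ℤ, g (p.1 + intVec m, p.2) = g p

theorem add_intVec_mem_openPhase {s : ℝ} {p : Phase d} (hp : p ∈ openPhase d s)
    (m : Fin d → ℤ) : (p.1 + intVec m, p.2) ∈ openPhase d s := by
  rw [intVec_eq_realVec]; exact add_realVec_mem_openPhase hp _

end Geometry

/-! ### Fourier modes in the angle -/

section Fourier

variable {d : ℕ}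

/-- The linear form `I ↦ k · I`. -/
def dotInt (k : Fin d → ℤ) : EuclideanSpace ℂ (Fin d) →L[ℂ] ℂ :=
  ∑ j, (k j : ℂ) • EuclideanSpace.proj j

theorem dotInt_apply (k : Fin d → ℤ) (c : EuclideanSpace ℂ (Fin d)) :
    dotInt k c = ∑ j, (k j : ℂ) * c j := by
  simp [dotInt]

theorem dotInt_intVec (k m : Fin d → ℤ) : dotInt k (intVec m) = (∑ j, k j * m j : ℤ) := by
  rw [dotInt_apply]; push_cast; rfl

theorem dotInt_realVec (k : Fin d → ℤ) (t : Fin d → ℝ) :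
    dotInt k (realVec t) = (∑ j, (k j : ℝ) * t j : ℝ) := by
  rw [dotInt_apply]; push_cast; rfl

/-- The projection `ℝ^d → (ℝ/ℤ)^d`. -/
def torusMk (t : Fin d → ℝ) : UnitAddTorus (Fin d) := fun j => (t j : UnitAddCircle)

theorem isOpenQuotientMap_torusMk : IsOpenQuotientMap (torusMk (d := d)) :=
  IsOpenQuotientMap.piMap fun _ => QuotientAddGroup.isOpenQuotientMap_mk

/-- A chosen representative in `ℝ^d` of a point of the torus. -/
def torusRep (t : UnitAddTorus (Fin d)) : Fin d → ℝ :=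
  Function.surjInv isOpenQuotientMap_torusMk.surjective t

theorem torusMk_torusRep (t : UnitAddTorus (Fin d)) : torusMk (torusRep t) = t :=
  Function.surjInv_eq _ t

theorem exists_torusRep_torusMk (t : Fin d → ℝ) :
    ∃ m : Fin d → ℤ, realVec (torusRep (torusMk t)) = realVec t + intVec m := by
  have h := torusMk_torusRep (torusMk t)
  have h1 : ∀ j, ∃ n : ℤ, torusRep (torusMk t) j = t j + n := fun j => by
    have h2 : ((torusRep (torusMk t) j : ℝ) : UnitAddCircle) = (t j : UnitAddCircle) := congrFun h j
    rw [QuotientAddGroup.eq_iff_sub_mem, AddSubgroup.mem_zmultiples_iff] at h2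
    obtain ⟨n, hn⟩ := h2
    refine ⟨n, ?_⟩
    rw [zsmul_one] at hn
    linarith
  choose m hm using h1
  refine ⟨m, ?_⟩
  ext j
  simp [hm]

theorem mFourier_torusMk (k : Fin d → ℤ) (t : Fin d → ℝ) :
    UnitAddTorus.mFourier k (torusMk t) = expTwoPiI (dotInt k (realVec t)) := by
  rw [dotInt_apply, expTwoPiI, Finset.mul_sum, Complex.exp_sum]
  simp only [UnitAddTorus.mFourier, ContinuousMap.coe_mk]
  refine Finset.prod_congr rfl fun j _ => ?_
  rw [torusMk, fourier_coe_apply]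
  congr 1
  simp only [realVec_apply]
  push_cast
  ring

theorem norm_mFourier_apply (k : Fin d → ℤ) (t : UnitAddTorus (Fin d)) :
    ‖UnitAddTorus.mFourier k t‖ = 1 := by
  rw [← torusMk_torusRep t, mFourier_torusMk, dotInt_realVec, norm_expTwoPiI_ofReal]

/-- The invariant probability measure of the torus. -/
def torusMeasure (d : ℕ) : MeasureTheory.Measure (UnitAddTorus (Fin d)) :=
  MeasureTheory.Measure.pi fun _ => AddCircle.haarAddCircle

instance : MeasureTheory.IsProbabilityMeasure (torusMeasure d) := by
  unfold torusMeasure; infer_instance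

instance : (torusMeasure d).IsAddLeftInvariant := by
  unfold torusMeasure; infer_instance

variable {G : Type*} [NormedAddCommGroup G] [NormedSpace ℂ G]

theorem mFourierCoeff_eq_integral_torusMeasure (f : UnitAddTorus (Fin d) → G) (k : Fin d → ℤ) :
    UnitAddTorus.mFourierCoeff f k
      = ∫ t, UnitAddTorus.mFourier (-k) t • f t ∂torusMeasure d := rfl

/-- The function `t ↦ g (θ + t, I)` on the torus. -/
def torusFun (g : Phase d → G) (p : Phase d) (t : UnitAddTorus (Fin d)) : G :=
  g (p.1 + realVec (torusRep t), p.2)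

/-- The Fourier mode `g_k(I) exp (2πi k · θ)` of a function `g` which is periodic in `θ`. -/
def fourierMode (g : Phase d → G) (k : Fin d → ℤ) (p : Phase d) : G :=
  ∫ t, UnitAddTorus.mFourier (-k) t • torusFun g p t ∂torusMeasure d

variable {g : Phase d → G} {s M : ℝ}

omit [NormedAddCommGroup G] [NormedSpace ℂ G] in
theorem torusFun_torusMk (hg : IsIntPeriodic (openPhase d s) g) {p : Phase d}
    (hp : p ∈ openPhase d s) (t : Fin d → ℝ) :
    torusFun g p (torusMk t) = g (p.1 + realVec t, p.2) := by
  obtain ⟨m, hm⟩ := exists_torusRep_torusMk t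
  rw [torusFun, hm, ← add_assoc]
  exact hg _ (add_realVec_mem_openPhase hp t) m

omit [NormedSpace ℂ G] in
theorem continuousOn_torusFun (hg : IsIntPeriodic (openPhase d s) g)
    (hc : ContinuousOn g (openPhase d s)) :
    ContinuousOn (Function.uncurry (torusFun g)) (openPhase d s ×ˢ Set.univ) := by
  have hq : IsOpenQuotientMap (Prod.map (id : openPhase d s → openPhase d s) (torusMk (d := d))) :=
    IsOpenQuotientMap.id.prodMap isOpenQuotientMap_torusMk
  have h1 : Continuous fun x : openPhase d s × UnitAddTorus (Fin d) => torusFun g x.1 x.2 := by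
    rw [hq.isQuotientMap.continuous_iff]
    have h2 : (fun x : openPhase d s × UnitAddTorus (Fin d) => torusFun g x.1 x.2) ∘
        (Prod.map (id : openPhase d s → openPhase d s) (torusMk (d := d)))
        = fun x => g (x.1.1.1 + realVec x.2, x.1.1.2) := by
      ext x; exact torusFun_torusMk hg x.1.2 x.2
    rw [h2]
    have := continuous_realVec (d := d)
    refine hc.comp_continuous (f := fun x : openPhase d s × (Fin d → ℝ) =>
      (x.1.1.1 + realVec x.2, x.1.1.2)) (by fun_prop) fun x => ?_
    exact add_realVec_mem_openPhase x.1.2 _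
  rw [continuousOn_iff_continuous_domRestrict]
  exact h1.comp (f := fun x : (openPhase d s ×ˢ Set.univ : Set (Phase d × UnitAddTorus (Fin d))) =>
    ((⟨x.1.1, x.2.1⟩ : openPhase d s), x.1.2)) (by fun_prop)

omit [NormedSpace ℂ G] in
theorem continuous_torusFun (hg : IsIntPeriodic (openPhase d s) g)
    (hc : ContinuousOn g (openPhase d s)) {p : Phase d} (hp : p ∈ openPhase d s) :
    Continuous (torusFun g p) :=
  (continuousOn_torusFun hg hc).comp_continuous (f := fun t => (p, t)) (by fun_prop)
    fun _ => ⟨hp, trivial⟩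

theorem integrable_fourierMode (hg : IsIntPeriodic (openPhase d s) g)
    (hc : ContinuousOn g (openPhase d s)) {p : Phase d} (hp : p ∈ openPhase d s) (k : Fin d → ℤ) :
    MeasureTheory.Integrable (fun t => UnitAddTorus.mFourier (-k) t • torusFun g p t)
      (torusMeasure d) := by
  have := ((UnitAddTorus.mFourier (-k)).continuous.smul (continuous_torusFun hg hc hp)).continuousOn
    (s := Set.univ) |>.integrableOn_compact' (μ := torusMeasure d) isCompact_univ MeasurableSet.univ
  rwa [MeasureTheory.integrableOn_univ] at this

theorem differentiableOn_fourierMode (hg : IsIntPeriodic (openPhase d s) g)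
    (hd : DifferentiableOn ℂ g (openPhase d s)) (k : Fin d → ℤ) :
    DifferentiableOn ℂ (fourierMode g k) (openPhase d s) := by
  have h := differentiableOn_setIntegral (torusMeasure d) isCompact_univ MeasurableSet.univ
    (isOpen_openPhase (d := d) s)
    (f := fun p t => UnitAddTorus.mFourier (-k) t • torusFun g p t) ?_ fun t _ => ?_
  · simpa only [MeasureTheory.Measure.restrict_univ] using! h
  · have h1 : Continuous fun x : Phase d × UnitAddTorus (Fin d) =>
        UnitAddTorus.mFourier (-k) x.2 := (UnitAddTorus.mFourier (-k)).continuous.comp continuous_snd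
    exact h1.continuousOn.smul (continuousOn_torusFun hg hd.continuousOn)
  · refine DifferentiableOn.const_smul ?_ _
    exact hd.comp (f := fun p : Phase d => (p.1 + realVec (torusRep t), p.2)) (by fun_prop)
      fun p hp => add_realVec_mem_openPhase hp _

theorem norm_fourierMode_le (hM : ∀ p ∈ openPhase d s, ‖g p‖ ≤ M) {p : Phase d}
    (hp : p ∈ openPhase d s) (k : Fin d → ℤ) : ‖fourierMode g k p‖ ≤ M := by
  have h := MeasureTheory.norm_integral_le_of_norm_le_const (μ := torusMeasure d) (C := M)
    (f := fun t => UnitAddTorus.mFourier (-k) t • torusFun g p t)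
    (Filter.Eventually.of_forall fun t => by
      rw [norm_smul, norm_mFourier_apply, one_mul]
      exact hM _ (add_realVec_mem_openPhase hp _))
  simpa [fourierMode] using h

theorem fourierMode_add_realVec (hg : IsIntPeriodic (openPhase d s) g) {p : Phase d}
    (hp : p ∈ openPhase d s) (k : Fin d → ℤ) (c : Fin d → ℝ) :
    fourierMode g k (p.1 + realVec c, p.2)
      = expTwoPiI (dotInt k (realVec c)) • fourierMode g k p := by
  have h1 : ∀ t, torusFun g (p.1 + realVec c, p.2) t = torusFun g p (torusMk c + t) := fun t => by
    have h2 : torusMk c + t = torusMk (c + torusRep t) := by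
      conv_lhs => rw [← torusMk_torusRep t]
      rfl
    rw [h2, torusFun_torusMk hg hp, torusFun, realVec_add, add_assoc]
  have h3 : ∀ t, UnitAddTorus.mFourier (-k) t • torusFun g (p.1 + realVec c, p.2) t
      = expTwoPiI (dotInt k (realVec c)) • (UnitAddTorus.mFourier (-k) (torusMk c + t) •
        torusFun g p (torusMk c + t)) := fun t => by
    have h4 : UnitAddTorus.mFourier (-k) (torusMk c + t)
        = UnitAddTorus.mFourier (-k) (torusMk c) * UnitAddTorus.mFourier (-k) t := by
      simp only [UnitAddTorus.mFourier, ContinuousMap.coe_mk, Pi.add_apply, fourier_apply,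
        smul_add, AddCircle.toCircle_add, Circle.coe_mul, Finset.prod_mul_distrib]
    rw [h1, h4, smul_smul, ← mul_assoc, mFourier_torusMk, ← expTwoPiI_add, dotInt_realVec,
      dotInt_realVec]
    have h5 : ((∑ j, (k j : ℝ) * c j : ℝ) : ℂ) + ((∑ j, ((-k) j : ℝ) * c j : ℝ) : ℂ) = 0 := by
      rw [← Complex.ofReal_add, ← Finset.sum_add_distrib]
      simp
    rw [h5]
    simp [expTwoPiI]
  simp only [fourierMode, h3]
  rw [MeasureTheory.integral_smul, MeasureTheory.integral_add_left_eq_self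
    (fun t => UnitAddTorus.mFourier (-k) t • torusFun g p t)]

end Fourier

/-! ### Decay, inversion and resonances of Fourier modes -/

section Fourier

variable {d : ℕ} {G : Type*} [NormedAddCommGroup G] [NormedSpace ℂ G]
  {g : Phase d → G} {s M : ℝ}

/-- A holomorphic function that vanishes for real arguments near `0` on a convex open set of `ℂ`
vanishes identically. -/
theorem eq_zero_of_forall_real_eq_zero [CompleteSpace G] {Z : Set ℂ} (hZo : IsOpen Z)
    (hZ : Convex ℝ Z) (h0 : (0 : ℂ) ∈ Z) {f : ℂ → G} (hf : DifferentiableOn ℂ f Z)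
    (hreal : ∀ x : ℝ, (x : ℂ) ∈ Z → f x = 0) : ∀ z ∈ Z, f z = 0 := by
  refine (hf.analyticOnNhd hZo).eqOn_of_preconnected_of_frequently_eq
    (g := fun _ => 0) analyticOnNhd_const hZ.isPreconnected h0 ?_
  have h1 : Filter.Tendsto (fun n : ℕ => (((1 : ℝ) / (n + 1) : ℝ) : ℂ)) Filter.atTop
      (nhdsWithin 0 {0}ᶜ) := by
    refine tendsto_nhdsWithin_iff.2 ⟨?_, Filter.Eventually.of_forall fun n => ?_⟩
    · have := (Complex.continuous_ofReal.tendsto 0).comp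
        (tendsto_one_div_add_atTop_nhds_zero_nat (𝕜 := ℝ))
      rwa [Complex.ofReal_zero] at this
    · have : (1 : ℝ) / (n + 1) ≠ 0 := by positivity
      simpa using! Complex.ofReal_ne_zero.2 this
  refine h1.frequently (Filter.Eventually.frequently ?_)
  have h2 := (tendsto_nhdsWithin_iff.1 h1).1.eventually (hZo.mem_nhds h0)
  filter_upwards [h2] with n hn using hreal _ hn

/-- The dependence of a Fourier mode on the angle, for complex translations: both sides are
holomorphic along a complex line, on which the real points are covered by the invariance of the
integral. -/
theorem fourierMode_add [CompleteSpace G] (hg : IsIntPeriodic (openPhase d s) g)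
    (hd : DifferentiableOn ℂ g (openPhase d s)) {p : Phase d} (hp : p ∈ openPhase d s)
    {c : EuclideanSpace ℂ (Fin d)} (hpc : (p.1 + c, p.2) ∈ openPhase d s) (k : Fin d → ℤ) :
    fourierMode g k (p.1 + c, p.2) = expTwoPiI (dotInt k c) • fourierMode g k p := by
  set q : Phase d := (p.1 + realVec (reVec c), p.2) with hq
  have hqmem : q ∈ openPhase d s := add_realVec_mem_openPhase hp _
  set b := imVec c with hb
  have hline : Continuous fun z : ℂ => ((q.1 + z • realVec b, q.2) : Phase d) := by fun_prop
  set Z : Set ℂ := {z | ((q.1 + z • realVec b, q.2) : Phase d) ∈ openPhase d s} with hZ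
  have hZo : IsOpen Z := (isOpen_openPhase s).preimage hline
  have hZc : Convex ℝ Z := by
    intro z hz w hw α β hα hβ hαβ
    have h1 := convex_openPhase s hz hw hα hβ hαβ
    have h2 : α • ((q.1 + z • realVec b, q.2) : Phase d) + β • (q.1 + w • realVec b, q.2)
        = (q.1 + (α • z + β • w) • realVec b, q.2) := by
      ext1
      · simp only [Prod.fst_add, Prod.smul_fst, smul_add, add_smul, smul_assoc]
        have : α • q.1 + β • q.1 = q.1 := by rw [← add_smul, hαβ, one_smul]
        conv_rhs => rw [← this]
        abel
      · simp only [Prod.snd_add, Prod.smul_snd]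
        rw [← add_smul, hαβ, one_smul]
    rw [h2] at h1
    exact h1
  have hZ0 : (0 : ℂ) ∈ Z := by
    change ((q.1 + (0 : ℂ) • realVec b, q.2) : Phase d) ∈ openPhase d s
    rw [zero_smul, add_zero]; exact hqmem
  have hc : realVec (reVec c) + Complex.I • realVec b = c := realVec_reVec_add_I_smul c
  have hZI : Complex.I ∈ Z := by
    change ((q.1 + Complex.I • realVec b, q.2) : Phase d) ∈ openPhase d s
    rw [hq]
    dsimp only
    rw [add_assoc, hc]
    exact hpc
  have hexp := differentiable_expTwoPiI
  have key := eq_zero_of_forall_real_eq_zero hZo hZc hZ0 (f := fun z =>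
    fourierMode g k (q.1 + z • realVec b, q.2)
      - expTwoPiI (z * dotInt k (realVec b)) • fourierMode g k q) ?_ ?_ Complex.I hZI
  · rw [sub_eq_zero, hq] at key
    dsimp only at key
    rw [add_assoc, hc, fourierMode_add_realVec hg hp, smul_smul, ← expTwoPiI_add] at key
    rw [key]
    conv_rhs => rw [← hc]
    rw [map_add, map_smul, smul_eq_mul, add_comm]
  · refine DifferentiableOn.sub ?_ (DifferentiableOn.smul (by fun_prop) (by fun_prop))
    exact (differentiableOn_fourierMode hg hd k).comp
      (f := fun z : ℂ => ((q.1 + z • realVec b, q.2) : Phase d)) (by fun_prop) fun z hz => hz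
  · intro x _
    have h1 : (x : ℂ) • realVec b = realVec (x • b) := by ext j; simp
    rw [sub_eq_zero, h1, fourierMode_add_realVec hg hqmem, ← h1, map_smul, smul_eq_mul]

/-- Fourier modes decay exponentially: the torus of integration can be moved into the complex
domain by the distance to the boundary. -/
theorem norm_fourierMode_le_exp [CompleteSpace G] (hg : IsIntPeriodic (openPhase d s) g)
    (hd : DifferentiableOn ℂ g (openPhase d s)) (hM : ∀ p ∈ openPhase d s, ‖g p‖ ≤ M)
    {δ : ℝ} (hδ : 0 ≤ δ) {p : Phase d} (hp : p ∈ openPhase d (s - δ)) (k : Fin d → ℤ) :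
    ‖fourierMode g k p‖ ≤ M * ∏ j, Real.exp (-(2 * Real.pi * δ * |(k j : ℝ)|)) := by
  set c : EuclideanSpace ℂ (Fin d) :=
    WithLp.toLp 2 fun j => -((δ * (SignType.sign (k j : ℝ) : ℝ) : ℝ) : ℂ) * Complex.I with hc
  have hcim : ∀ j, (c j).im = -(δ * (SignType.sign (k j : ℝ) : ℝ)) := fun j => by simp [hc]
  have hcre : ∀ j, (c j).re = 0 := fun j => by simp [hc]
  have hp' : p ∈ openPhase d s := openPhase_mono (by linarith) hp
  have hpc : (p.1 + c, p.2) ∈ openPhase d s := by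
    have h1 := add_fst_mem_openPhase hδ hp (c := c) fun j => ?_
    · rwa [sub_add_cancel] at h1
    · rw [hcim, abs_neg, abs_mul, abs_of_nonneg hδ]
      refine mul_le_of_le_one_right hδ ?_
      rcases lt_trichotomy (k j : ℝ) 0 with h | h | h
      · simp [sign_neg h]
      · simp [h]
      · simp [sign_pos h]
  have h1 := fourierMode_add hg hd hp' hpc k
  have h2 : (dotInt k c).im = -∑ j, δ * |(k j : ℝ)| := by
    rw [dotInt_apply, Complex.im_sum, ← Finset.sum_neg_distrib]
    refine Finset.sum_congr rfl fun j _ => ?_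
    have h3 : ((k j : ℂ) * c j).im = (k j : ℝ) * (c j).im := by
      rw [Complex.mul_im, hcre]; simp
    rw [h3, hcim, ← sign_mul_self (k j : ℝ)]
    ring_nf
  have h4 := norm_fourierMode_le hM hpc k
  rw [h1, norm_smul, norm_expTwoPiI, h2] at h4
  have h5 : ∏ j, Real.exp (-(2 * Real.pi * δ * |(k j : ℝ)|))
      = (Real.exp (-(2 * Real.pi * -∑ j, δ * |(k j : ℝ)|)))⁻¹ := by
    rw [← Real.exp_sum, ← Real.exp_neg]
    congr 1
    rw [Finset.sum_neg_distrib]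
    simp only [mul_assoc, ← Finset.mul_sum]
    ring
  rw [h5, ← div_eq_mul_inv, le_div_iff₀ (Real.exp_pos _), mul_comm]
  exact h4

/-- Fourier inversion for absolutely convergent Fourier series. -/
theorem hasSum_fourierMode [CompleteSpace G] (hg : IsIntPeriodic (openPhase d s) g)
    (hc : ContinuousOn g (openPhase d s)) {p : Phase d} (hp : p ∈ openPhase d s)
    (hsum : Summable fun k => fourierMode g k p) : HasSum (fun k => fourierMode g k p) (g p) := by
  have h0 : torusFun g p 0 = g p := by
    have h1 : (0 : UnitAddTorus (Fin d)) = torusMk 0 := by ext j; simp [torusMk]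
    rw [h1, torusFun_torusMk hg hp, realVec_zero, add_zero]
  have hone : ∀ k, UnitAddTorus.mFourier k (0 : UnitAddTorus (Fin d)) = 1 := fun k => by
    simp [UnitAddTorus.mFourier]
  have key : ∑' k, fourierMode g k p = g p := by
    refine (SeparatingDual.eq_iff_forall_dual_eq (R := ℂ)).2 fun L => ?_
    set f : C(UnitAddTorus (Fin d), ℂ) :=
      ⟨fun t => L (torusFun g p t), L.continuous.comp (continuous_torusFun hg hc hp)⟩ with hf
    have hcoeff : ∀ k, UnitAddTorus.mFourierCoeff f k = L (fourierMode g k p) := fun k => by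
      rw [mFourierCoeff_eq_integral_torusMeasure, fourierMode,
        ← L.integral_comp_comm (integrable_fourierMode hg hc hp k)]
      simp [hf]
    have hs : Summable (UnitAddTorus.mFourierCoeff f) := by
      rw [funext hcoeff]; exact hsum.map L L.continuous
    have h2 := UnitAddTorus.hasSum_mFourier_series_apply_of_summable hs 0
    simp only [hcoeff, hone, smul_eq_mul, mul_one] at h2
    have h3 := hsum.hasSum.map L L.continuous
    have h4 := h3.unique h2
    rw [h4, hf]
    simp [h0]
  rw [← key]
  exact hsum.hasSum

/-- The sums of `g` over the real periodic orbits of the shear vanish. -/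
def OrbitSumsVanish (V : Set (Phase d)) (g : Phase d → G) : Prop :=
  ∀ p ∈ V, (∀ j, (p.1 j).im = 0) → (∀ j, (p.2 j).im = 0) → ∀ N : ℕ, 0 < N →
    SamePoint (shear^[N] p) p → ∑ i ∈ Finset.range N, g (shear^[i] p) = 0

theorem dense_range_ratCast : DenseRange fun (y : Fin d → ℚ) (j : Fin d) => (y j : ℝ) :=
  DenseRange.piMap fun _ => Rat.denseRange_cast

/-- Every point with a rational action vector is periodic under the shear. -/
theorem exists_samePoint_shear_iterate (y : Fin d → ℚ) (θ : EuclideanSpace ℂ (Fin d)) :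
    ∃ N : ℕ, 0 < N ∧ SamePoint (shear^[N] (θ, realVec fun j => (y j : ℝ)))
      (θ, realVec fun j => (y j : ℝ)) := by
  refine ⟨∏ j, (y j).den, Finset.prod_pos fun j _ => (y j).den_pos, ?_⟩
  have h : ∀ j, ∃ n : ℤ, ((∏ j, (y j).den : ℕ) : ℚ) * y j = n := fun j => by
    obtain ⟨e, he⟩ := Finset.dvd_prod_of_mem (fun j => (y j).den) (Finset.mem_univ j)
    refine ⟨e * (y j).num, ?_⟩
    rw [he]
    push_cast
    rw [mul_comm ((y j).den : ℚ), mul_assoc, Rat.den_mul_eq_num]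
  choose n hn using h
  rw [shear_iterate]
  refine ⟨⟨n, ?_⟩, rfl⟩
  dsimp only
  congr 1
  ext j
  have := hn j
  simp only [PiLp.smul_apply, realVec_apply, smul_eq_mul, intVec_apply]
  have h2 : (((∏ j, (y j).den : ℕ) : ℚ) * y j : ℚ) = ((n j : ℚ)) := this
  exact_mod_cast congrArg (fun q : ℚ => (q : ℂ)) h2

/-- At a rational action with `k · I` an integer, the mode `k` takes the same value at all the points
of a periodic orbit, while its sum over the orbit is a Fourier integral of orbit sums of `g`, hence
zero. -/
theorem fourierMode_eq_zero_of_rat [CompleteSpace G] (hg : IsIntPeriodic (openPhase d s) g)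
    (hd : DifferentiableOn ℂ g (openPhase d s)) (horb : OrbitSumsVanish (openPhase d s) g)
    (k : Fin d → ℤ) (y : Fin d → ℚ)
    (hy : ((0 : EuclideanSpace ℂ (Fin d)), realVec fun j => (y j : ℝ)) ∈ openPhase d s)
    (hk : expTwoPiI (dotInt k (realVec fun j => (y j : ℝ))) = 1) :
    fourierMode g k (0, realVec fun j => (y j : ℝ)) = 0 := by
  set I : Fin d → ℝ := fun j => (y j : ℝ) with hI
  obtain ⟨N, hN, hper⟩ : ∃ N : ℕ, 0 < N ∧ ∀ θ, SamePoint (shear^[N] (θ, realVec I)) (θ, realVec I) := by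
    obtain ⟨N, hN, ⟨m, hm⟩, -⟩ := exists_samePoint_shear_iterate y 0
    refine ⟨N, hN, fun θ => ?_⟩
    rw [shear_iterate] at hm ⊢
    refine ⟨⟨m, ?_⟩, rfl⟩
    simp only [zero_add] at hm
    rw [hm]
  set p : Phase d := (0, realVec I) with hp
  have hstep : ∀ i : ℕ, ((i : ℂ) • realVec I) = realVec ((i : ℝ) • I) := fun i => by
    ext j; simp
  have hmem : ∀ i : ℕ, (p.1 + realVec ((i : ℝ) • I), p.2) ∈ openPhase d s := fun i =>
    add_realVec_mem_openPhase hy _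
  have h1 : ∀ i : ℕ, fourierMode g k (p.1 + realVec ((i : ℝ) • I), p.2) = fourierMode g k p := by
    intro i
    rw [fourierMode_add_realVec hg hy, ← hstep, map_smul, smul_eq_mul]
    obtain ⟨n, hn⟩ := expTwoPiI_eq_one_iff.1 hk
    have h2 : expTwoPiI ((i : ℂ) * dotInt k (realVec I)) = 1 :=
      expTwoPiI_eq_one_iff.2 ⟨i * n, by rw [hn]; push_cast; rfl⟩
    rw [h2, one_smul]
  have h3 : ∑ i ∈ Finset.range N, fourierMode g k (p.1 + realVec ((i : ℝ) • I), p.2) = 0 := by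
    simp only [fourierMode]
    rw [← MeasureTheory.integral_finsetSum _ fun i _ =>
      integrable_fourierMode hg hd.continuousOn (hmem i) k]
    have h4 : ∀ t, ∑ i ∈ Finset.range N, UnitAddTorus.mFourier (-k) t •
        torusFun g (p.1 + realVec ((i : ℝ) • I), p.2) t = 0 := fun t => by
      rw [← Finset.smul_sum]
      have h5 := horb (realVec (torusRep t), realVec I) ?_ (fun j => by simp) (fun j => by simp)
        N hN (hper _)
      · have h6 : ∀ i ∈ Finset.range N, torusFun g (p.1 + realVec ((i : ℝ) • I), p.2) t
            = g (shear^[i] (realVec (torusRep t), realVec I)) := fun i _ => by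
          rw [torusFun, shear_iterate, ← hstep, hp]
          dsimp only
          rw [zero_add, add_comm]
        rw [Finset.sum_congr rfl h6, h5, smul_zero]
      · have h6 := add_realVec_mem_openPhase hy (torusRep t)
        rwa [hp, zero_add] at h6
    simp only [h4, MeasureTheory.integral_zero]
  simp only [h1, Finset.sum_const, Finset.card_range] at h3
  rw [← Nat.cast_smul_eq_nsmul ℂ] at h3
  exact (smul_eq_zero.1 h3).resolve_left (by exact_mod_cast hN.ne')

/-- A continuous projection to the hyperplane `k · y = n` of `ℝ^d` which maps rational vectors to
rational vectors; so these are dense in the hyperplane. -/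
theorem exists_hyperplane_projection (k : Fin d → ℤ) (n : ℤ) (x : Fin d → ℝ)
    (hx : ∑ j, (k j : ℝ) * x j = n) : ∃ f : (Fin d → ℝ) → Fin d → ℝ, Continuous f ∧ f x = x ∧
      ∀ y : Fin d → ℚ, ∃ z : Fin d → ℚ, (f fun j => (y j : ℝ)) = (fun j => (z j : ℝ)) ∧
        ∑ j, (k j : ℝ) * (z j : ℝ) = n := by
  by_cases hk : k = 0
  · subst hk
    refine ⟨id, continuous_id, rfl, fun y => ⟨y, rfl, ?_⟩⟩
    simpa using hx
  · obtain ⟨i, hi⟩ : ∃ i, k i ≠ 0 := by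
      by_contra! h; exact hk (funext h)
    have hiR : (k i : ℝ) ≠ 0 := by exact_mod_cast hi
    have hsplit : ∀ y : Fin d → ℝ, ∑ j, (k j : ℝ) * y j
        = (k i : ℝ) * y i + ∑ j ∈ Finset.univ.erase i, (k j : ℝ) * y j := fun y =>
      (Finset.add_sum_erase _ (fun j => (k j : ℝ) * y j) (Finset.mem_univ i)).symm
    refine ⟨fun y => Function.update y i
      ((n - ∑ j ∈ Finset.univ.erase i, (k j : ℝ) * y j) / k i), ?_, ?_, fun y => ?_⟩
    · exact continuous_id.update i (by fun_prop)
    · rw [hsplit] at hx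
      have : ((n : ℝ) - ∑ j ∈ Finset.univ.erase i, (k j : ℝ) * x j) / k i = x i := by
        rw [div_eq_iff hiR]; linarith
      dsimp only
      rw [this, Function.update_eq_self]
    · refine ⟨Function.update y i ((n - ∑ j ∈ Finset.univ.erase i, (k j : ℚ) * y j) / k i), ?_, ?_⟩
      · ext j
        rcases eq_or_ne j i with rfl | hj
        · simp
        · simp [hj]
      · have h2 := hsplit fun j => ((Function.update y i
          ((n - ∑ j ∈ Finset.univ.erase i, (k j : ℚ) * y j) / k i) j : ℚ) : ℝ)
        rw [h2]
        have h3 : ∑ j ∈ Finset.univ.erase i, (k j : ℝ) * ((Function.update y i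
            ((n - ∑ j ∈ Finset.univ.erase i, (k j : ℚ) * y j) / k i) j : ℚ) : ℝ)
            = ∑ j ∈ Finset.univ.erase i, (k j : ℝ) * y j := by
          refine Finset.sum_congr rfl fun j hj => ?_
          rw [Function.update_of_ne (Finset.ne_of_mem_erase hj)]
        rw [h3, Function.update_self]
        push_cast
        field_simp
        ring

/-- The rational actions are dense in the resonance hyperplane `k · I = n` of `ℝ^d`. -/
theorem fourierMode_eq_zero_of_real [CompleteSpace G] (hg : IsIntPeriodic (openPhase d s) g)
    (hd : DifferentiableOn ℂ g (openPhase d s)) (horb : OrbitSumsVanish (openPhase d s) g)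
    (k : Fin d → ℤ) (x : Fin d → ℝ)
    (hx : ((0 : EuclideanSpace ℂ (Fin d)), realVec x) ∈ openPhase d s)
    (hk : expTwoPiI (dotInt k (realVec x)) = 1) : fourierMode g k (0, realVec x) = 0 := by
  obtain ⟨n, hn⟩ := expTwoPiI_eq_one_iff.1 hk
  rw [dotInt_realVec] at hn
  have hn' : ∑ j, (k j : ℝ) * x j = n := by exact_mod_cast hn
  obtain ⟨f, hf, hfx, hfy⟩ := exists_hyperplane_projection k n x hn'
  have hF : ContinuousAt (fun y => fourierMode g k ((0 : EuclideanSpace ℂ (Fin d)), realVec (f y))) x := by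
    have h1 := (differentiableOn_fourierMode hg hd k).continuousOn.continuousAt
      ((isOpen_openPhase s).mem_nhds hx)
    have h2 : Continuous fun y => ((0 : EuclideanSpace ℂ (Fin d)), realVec (f y)) :=
      continuous_const.prodMk (continuous_realVec.comp hf)
    rw [← hfx] at h1
    exact ContinuousAt.comp (f := fun y => ((0 : EuclideanSpace ℂ (Fin d)), realVec (f y)))
      (g := fourierMode g k) h1 h2.continuousAt
  have hmem : ∀ᶠ y in nhds x, ((0 : EuclideanSpace ℂ (Fin d)), realVec (f y)) ∈ openPhase d s := by
    have h2 : Continuous fun y => ((0 : EuclideanSpace ℂ (Fin d)), realVec (f y)) :=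
      continuous_const.prodMk (continuous_realVec.comp hf)
    exact h2.continuousAt.eventually ((isOpen_openPhase s).mem_nhds (by simp only [hfx]; exact hx))
  have hfreq := (mem_closure_iff_frequently.1 (dense_range_ratCast x)).and_eventually hmem
  have hfreq2 : ∃ᶠ y in nhds x,
      fourierMode g k ((0 : EuclideanSpace ℂ (Fin d)), realVec (f y)) ∈ ({0} : Set G) := by
    refine hfreq.mono ?_
    rintro _ ⟨⟨y, rfl⟩, hy⟩
    obtain ⟨z, hz, hkz⟩ := hfy y
    rw [hz] at hy ⊢
    refine fourierMode_eq_zero_of_rat hg hd horb k z hy (expTwoPiI_eq_one_iff.2 ⟨n, ?_⟩)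
    rw [dotInt_realVec, hkz]; simp
  have := isClosed_singleton.mem_of_frequently_of_tendsto hfreq2 hF
  simp only [hfx] at this
  exact this

/-- The Fourier modes vanish on their resonances: by the identity theorem on the hyperplane
`k · I = n`, it suffices to consider real actions. -/
theorem fourierMode_eq_zero_of_resonant [CompleteSpace G] (hg : IsIntPeriodic (openPhase d s) g)
    (hd : DifferentiableOn ℂ g (openPhase d s)) (horb : OrbitSumsVanish (openPhase d s) g)
    (k : Fin d → ℤ) {p : Phase d} (hp : p ∈ openPhase d s) (hk : expTwoPiI (dotInt k p.2) = 1) :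
    fourierMode g k p = 0 := by
  obtain ⟨n, hn⟩ := expTwoPiI_eq_one_iff.1 hk
  have h0p := zero_fst_mem_openPhase hp
  have h0r := realVec_reVec_mem_openPhase h0p
  dsimp only at h0r
  set a := reVec p.2 with ha
  set b := imVec p.2 with hb
  have hab : realVec a + Complex.I • realVec b = p.2 := realVec_reVec_add_I_smul p.2
  have hsum : dotInt k (realVec a) + Complex.I * dotInt k (realVec b) = n := by
    rw [← hn, ← hab, map_add, map_smul, smul_eq_mul]
  have hkb : dotInt k (realVec b) = 0 := by
    rw [dotInt_realVec, dotInt_realVec] at hsum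
    have := congrArg Complex.im hsum
    rw [dotInt_realVec]
    simp only [Complex.add_im, Complex.ofReal_im, Complex.mul_im, Complex.I_re, Complex.I_im,
      Complex.ofReal_re, Complex.intCast_im, zero_mul, one_mul, zero_add] at this
    rw [this]; rfl
  have hka : dotInt k (realVec a) = n := by rw [hkb, mul_zero, add_zero] at hsum; exact hsum
  have hline : Continuous fun z : ℂ =>
      (((0 : EuclideanSpace ℂ (Fin d)), realVec a + z • realVec b) : Phase d) := by fun_prop
  set Z : Set ℂ := {z | (((0 : EuclideanSpace ℂ (Fin d)), realVec a + z • realVec b) : Phase d)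
    ∈ openPhase d s} with hZ
  have hZo : IsOpen Z := (isOpen_openPhase s).preimage hline
  have hZc : Convex ℝ Z := by
    intro z hz w hw α β hα hβ hαβ
    have h1 := convex_openPhase s hz hw hα hβ hαβ
    have h2 : α • (((0 : EuclideanSpace ℂ (Fin d)), realVec a + z • realVec b) : Phase d)
        + β • ((0 : EuclideanSpace ℂ (Fin d)), realVec a + w • realVec b)
        = (0, realVec a + (α • z + β • w) • realVec b) := by
      ext1
      · simp
      · simp only [Prod.snd_add, Prod.smul_snd, smul_add, add_smul, smul_assoc]
        have : α • realVec a + β • realVec a = realVec a := by rw [← add_smul, hαβ, one_smul]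
        conv_rhs => rw [← this]
        abel
    rw [h2] at h1
    exact h1
  have key := eq_zero_of_forall_real_eq_zero hZo hZc (by simpa [hZ] using h0r) (f := fun z =>
    fourierMode g k ((0 : EuclideanSpace ℂ (Fin d)), realVec a + z • realVec b)) ?_ ?_ Complex.I
    (by
      change (((0 : EuclideanSpace ℂ (Fin d)), realVec a + Complex.I • realVec b) : Phase d) ∈
        openPhase d s
      rw [hab]; exact h0p)
  · rw [hab] at key
    have h1 := fourierMode_add hg hd h0p (c := p.1) (by simpa using hp) k
    dsimp only at h1
    rw [zero_add, key, smul_zero] at h1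
    exact h1
  · exact (differentiableOn_fourierMode hg hd k).comp (f := fun z : ℂ =>
      (((0 : EuclideanSpace ℂ (Fin d)), realVec a + z • realVec b) : Phase d)) (by fun_prop)
      fun z hz => hz
  · intro x hx
    have h1 : realVec a + (x : ℂ) • realVec b = realVec (a + x • b) := by
      ext j; simp
    change (((0 : EuclideanSpace ℂ (Fin d)), realVec a + (x : ℂ) • realVec b) : Phase d) ∈
      openPhase d s at hx
    have h2 : dotInt k (realVec (a + x • b)) = n := by
      rw [← h1, map_add, map_smul, hkb, smul_zero, add_zero, hka]
    rw [h1] at hx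
    rw [h1]
    exact fourierMode_eq_zero_of_real hg hd horb k _ hx (by rw [h2, expTwoPiI_intCast])

end Fourier

/-! ### The linear cohomological equation -/

section Cohomological

variable {d : ℕ} {G : Type*} [NormedAddCommGroup G] [NormedSpace ℂ G] [CompleteSpace G]
  {g : Phase d → G} {s M : ℝ}

/-- `(θ, I) ↦ k · I`, as a linear form on the phase space. -/
def actionForm (k : Fin d → ℤ) : Phase d →L[ℂ] ℂ :=
  (dotInt k).comp (ContinuousLinearMap.snd ℂ _ _)

@[simp] theorem actionForm_apply (k : Fin d → ℤ) (p : Phase d) : actionForm k p = dotInt k p.2 := rfl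

/-- For `k ≠ 0` there is a direction in the actions of norm at most one with `k · v = 1`. -/
theorem exists_action_direction {k : Fin d → ℤ} (hk : k ≠ 0) :
    ∃ v : EuclideanSpace ℂ (Fin d), ‖v‖ ≤ 1 ∧ dotInt k v = 1 := by
  obtain ⟨i, hi⟩ : ∃ i, k i ≠ 0 := by
    by_contra! h; exact hk (funext h)
  refine ⟨EuclideanSpace.single i ((k i : ℂ)⁻¹), ?_, ?_⟩
  · rw [PiLp.norm_single, norm_inv, Complex.norm_intCast]
    refine inv_le_one_of_one_le₀ ?_
    exact_mod_cast Int.one_le_abs hi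
  · have : (k i : ℂ) ≠ 0 := by exact_mod_cast hi
    rw [dotInt_apply, Finset.sum_eq_single i]
    · simp [this]
    · intro j _ hj; simp [hj]
    · simp

/-- A direction in the actions, chosen with `k · v = 1` if `k ≠ 0`. -/
def actionDirection (k : Fin d → ℤ) : Phase d :=
  open Classical in if hk : k ≠ 0 then (0, (exists_action_direction hk).choose) else 0

theorem actionDirection_fst (k : Fin d → ℤ) : (actionDirection k).1 = 0 := by
  unfold actionDirection; split <;> rfl

theorem norm_actionDirection_snd_le (k : Fin d → ℤ) : ‖(actionDirection k).2‖ ≤ 1 := by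
  unfold actionDirection
  split
  · rename_i hk
    exact (exists_action_direction hk).choose_spec.1
  · simp

theorem actionForm_actionDirection {k : Fin d → ℤ} (hk : k ≠ 0) :
    actionForm k (actionDirection k) = 1 := by
  rw [actionForm_apply, actionDirection, dif_pos hk]
  exact (exists_action_direction hk).choose_spec.2

/-- The Fourier mode of the solution `u` of `u - u ∘ f = g`. The mode `k = 0`, which the equation
leaves free, is taken to be zero. -/
def solutionMode (g : Phase d → G) (k : Fin d → ℤ) : Phase d → G :=
  open Classical in
  if k = 0 then 0 else divOneSubExp (actionForm k) (actionDirection k) (fourierMode g k)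

theorem differentiableOn_solutionMode (hg : IsIntPeriodic (openPhase d s) g)
    (hd : DifferentiableOn ℂ g (openPhase d s)) (horb : OrbitSumsVanish (openPhase d s) g)
    (k : Fin d → ℤ) : DifferentiableOn ℂ (solutionMode g k) (openPhase d s) := by
  unfold solutionMode
  split_ifs with hk
  · exact differentiableOn_const _
  · exact differentiableOn_divOneSubExp (isOpen_openPhase s) (differentiableOn_fourierMode hg hd k)
      (fun p hp h => fourierMode_eq_zero_of_resonant hg hd horb k hp h)
      (actionForm_actionDirection hk)

theorem one_sub_expTwoPiI_smul_solutionMode (hg : IsIntPeriodic (openPhase d s) g)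
    (hd : DifferentiableOn ℂ g (openPhase d s)) (horb : OrbitSumsVanish (openPhase d s) g)
    (k : Fin d → ℤ) {p : Phase d} (hp : p ∈ openPhase d s) :
    (1 - expTwoPiI (dotInt k p.2)) • solutionMode g k p = fourierMode g k p := by
  unfold solutionMode
  split_ifs with hk
  · subst hk
    have h1 : expTwoPiI (dotInt (0 : Fin d → ℤ) p.2) = 1 := by
      rw [dotInt_apply]; simp [expTwoPiI]
    rw [h1, fourierMode_eq_zero_of_resonant hg hd horb 0 hp h1]
    simp
  · have h := one_sub_expTwoPiI_smul_divOneSubExp (ℓ := actionForm k) (v := actionDirection k)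
      (fun p hp h => fourierMode_eq_zero_of_resonant hg hd horb k hp h) hp
    rwa [actionForm_apply] at h

/-- `solutionMode g k` depends on the angle through the factor `exp (2πi k · θ)`. At a resonance
this follows by continuity, since the nearby points in the direction `actionDirection k` are not
resonant. -/
theorem solutionMode_add (hg : IsIntPeriodic (openPhase d s) g)
    (hd : DifferentiableOn ℂ g (openPhase d s)) (horb : OrbitSumsVanish (openPhase d s) g)
    (k : Fin d → ℤ) {p : Phase d} (hp : p ∈ openPhase d s) {c : EuclideanSpace ℂ (Fin d)}
    (hpc : (p.1 + c, p.2) ∈ openPhase d s) :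
    solutionMode g k (p.1 + c, p.2) = expTwoPiI (dotInt k c) • solutionMode g k p := by
  have hgen : ∀ q ∈ openPhase d s, (q.1 + c, q.2) ∈ openPhase d s → expTwoPiI (dotInt k q.2) ≠ 1 →
      solutionMode g k (q.1 + c, q.2) = expTwoPiI (dotInt k c) • solutionMode g k q := by
    intro q hq hqc hne
    have h1 := one_sub_expTwoPiI_smul_solutionMode hg hd horb k hq
    have h2 := one_sub_expTwoPiI_smul_solutionMode hg hd horb k hqc
    rw [fourierMode_add hg hd hq hqc, ← h1, smul_comm] at h2
    exact smul_right_injective G (sub_ne_zero.2 hne.symm) h2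
  rcases eq_or_ne k 0 with hk | hk
  · simp [solutionMode, hk]
  by_cases hres : expTwoPiI (dotInt k p.2) = 1
  · set v := actionDirection k with hv
    have hcd := (differentiableOn_solutionMode hg hd horb k).continuousOn
    have hO := isOpen_openPhase (d := d) s
    have hl1 : Continuous fun z : ℂ => p + z • v := by fun_prop
    have hl2 : Continuous fun z : ℂ => (((p + z • v).1 + c, (p + z • v).2) : Phase d) := by fun_prop
    have e1 : p + (0 : ℂ) • v = p := by simp
    have t1 : Filter.Tendsto (fun z : ℂ => solutionMode g k ((p + z • v).1 + c, (p + z • v).2))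
        (nhdsWithin 0 {0}ᶜ) (nhds (solutionMode g k (p.1 + c, p.2))) := by
      refine Filter.Tendsto.mono_left ?_ nhdsWithin_le_nhds
      have h1 := hcd.continuousAt (hO.mem_nhds hpc)
      have h2 := hl2.tendsto 0
      rw [e1] at h2
      exact h1.tendsto.comp h2
    have t2 : Filter.Tendsto (fun z : ℂ => expTwoPiI (dotInt k c) • solutionMode g k (p + z • v))
        (nhdsWithin 0 {0}ᶜ) (nhds (expTwoPiI (dotInt k c) • solutionMode g k p)) := by
      refine Filter.Tendsto.mono_left ?_ nhdsWithin_le_nhds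
      have h1 := hcd.continuousAt (hO.mem_nhds hp)
      have h2 := hl1.tendsto 0
      rw [e1] at h2
      exact (h1.tendsto.comp h2).const_smul _
    refine tendsto_nhds_unique (t1.congr' ?_) t2
    have m1 : ∀ᶠ z in nhds (0 : ℂ), p + z • v ∈ openPhase d s :=
      hl1.continuousAt.eventually (hO.mem_nhds (by simp only [e1]; exact hp))
    have m2 : ∀ᶠ z in nhds (0 : ℂ), (((p + z • v).1 + c, (p + z • v).2) : Phase d) ∈ openPhase d s :=
      hl2.continuousAt.eventually (hO.mem_nhds (by simp only [e1]; exact hpc))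
    have m3 : ∀ᶠ z : ℂ in nhds 0, ‖z‖ < 1 :=
      continuous_norm.continuousAt.eventually_lt_const (by simp)
    filter_upwards [m1.filter_mono nhdsWithin_le_nhds, m2.filter_mono nhdsWithin_le_nhds,
      m3.filter_mono nhdsWithin_le_nhds, self_mem_nhdsWithin] with z h1 h2 h3 h4
    refine hgen _ h1 h2 fun h5 => ?_
    have h6 : dotInt k (p + z • v).2 = dotInt k p.2 + z := by
      have := actionForm_actionDirection hk
      rw [← hv, actionForm_apply] at this
      rw [Prod.snd_add, Prod.smul_snd, map_add, map_smul, this, smul_eq_mul, mul_one]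
    rw [h6, expTwoPiI_add, hres, one_mul] at h5
    obtain ⟨n, hn⟩ := expTwoPiI_eq_one_iff.1 h5
    rw [hn, Complex.norm_intCast] at h3
    have h7 : n = 0 := Int.abs_lt_one_iff.1 (by exact_mod_cast h3)
    exact h4 (by rw [Set.mem_singleton_iff, hn, h7, Int.cast_zero])
  · exact hgen p hp hpc hres

theorem norm_solutionMode_le (hg : IsIntPeriodic (openPhase d s) g)
    (hd : DifferentiableOn ℂ g (openPhase d s)) (horb : OrbitSumsVanish (openPhase d s) g)
    (hM : ∀ p ∈ openPhase d s, ‖g p‖ ≤ M) {δ : ℝ} (hδ : 0 < δ) (hδ1 : δ ≤ 1) (k : Fin d → ℤ)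
    {p : Phase d} (hp : p ∈ openPhase d (s - δ)) :
    ‖solutionMode g k p‖ ≤ 80 * M / δ * ∏ j, Real.exp (-(Real.pi * δ * |(k j : ℝ)|)) := by
  have hps : p ∈ openPhase d s := openPhase_mono (by linarith) hp
  have hM0 : 0 ≤ M := (norm_nonneg _).trans (hM p hps)
  unfold solutionMode
  split_ifs with hk
  · simp only [Pi.zero_apply, norm_zero]; positivity
  set v := actionDirection k with hv
  have hmem : ∀ z : ℂ, ‖z‖ ≤ δ / 20 → p + z • v ∈ openPhase d (s - δ / 2) := by
    intro z hz
    have h1 := add_snd_mem_openPhase (t := δ / 2) (by positivity) hp (v := z • v.2) (by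
      rw [norm_smul]
      calc ‖z‖ * ‖v.2‖ ≤ δ / 20 * 1 := by
            gcongr
            exact norm_actionDirection_snd_le k
        _ = δ / 2 / 10 := by ring)
    have h2 : s - δ + δ / 2 = s - δ / 2 := by ring
    rw [h2] at h1
    have h3 : p + z • v = (p.1, p.2 + z • v.2) := by
      ext1
      · simp [hv, actionDirection_fst]
      · rfl
    rw [h3]; exact h1
  have h1 := norm_divOneSubExp_le (isOpen_openPhase s) (differentiableOn_fourierMode hg hd k)
    (fun p hp h => fourierMode_eq_zero_of_resonant hg hd horb k hp h)
    (actionForm_actionDirection hk) (x := p) (σ := δ / 20)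
    (M := M * ∏ j, Real.exp (-(Real.pi * δ * |(k j : ℝ)|))) (by positivity) (by linarith)
    (fun z hz => openPhase_mono (by linarith) (hmem z hz)) fun z hz => ?_
  · calc _ ≤ _ := h1
      _ = _ := by field_simp; ring
  · have h2 := norm_fourierMode_le_exp hg hd hM (δ := δ / 2) (by positivity) (hmem z hz) k
    have h3 : 2 * Real.pi * (δ / 2) = Real.pi * δ := by ring
    rwa [h3] at h2

theorem summable_exp_neg_abs {a : ℝ} (ha : 0 < a) :
    Summable (fun n : ℤ => Real.exp (-(a * |(n : ℝ)|))) ∧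
      ∑' n : ℤ, Real.exp (-(a * |(n : ℝ)|)) ≤ 2 * (1 + a) / a := by
  set q := Real.exp (-a) with hq
  have hq0 : 0 < q := Real.exp_pos _
  have hq1 : q < 1 := by rw [hq, Real.exp_lt_one_iff]; linarith
  have h1 : ∀ n : ℕ, Real.exp (-(a * |((n : ℤ) : ℝ)|)) = q ^ n := fun n => by
    rw [hq, ← Real.exp_nat_mul, Int.cast_natCast, Nat.abs_cast]; congr 1; ring
  have h2 : ∀ n : ℕ, Real.exp (-(a * |((-((n : ℤ) + 1) : ℤ) : ℝ)|)) = q * q ^ n := fun n => by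
    rw [hq, ← Real.exp_nat_mul, ← Real.exp_add]
    push_cast
    rw [abs_neg, abs_of_nonneg (by positivity)]; congr 1; ring
  have hg := hasSum_geometric_of_lt_one hq0.le hq1
  have hs := HasSum.of_nat_of_neg_add_one (f := fun n : ℤ => Real.exp (-(a * |(n : ℝ)|)))
    (m := (1 - q)⁻¹) (m' := q * (1 - q)⁻¹) (by simpa only [h1] using hg)
    (by simpa only [h2] using hg.mul_left q)
  refine ⟨hs.summable, ?_⟩
  rw [hs.tsum_eq]
  have h3 : (1 - q)⁻¹ ≤ (1 + a) / a := by
    have h4 : q ≤ (1 + a)⁻¹ := by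
      rw [hq, Real.exp_neg]
      exact inv_anti₀ (by linarith) (by linarith [Real.add_one_le_exp a])
    have h5 : a / (1 + a) ≤ 1 - q := by
      have : a / (1 + a) = 1 - (1 + a)⁻¹ := by field_simp; ring
      rw [this]; linarith
    have := inv_anti₀ (by positivity) h5
    rwa [inv_div] at this
  have h4 : q * (1 - q)⁻¹ ≤ (1 - q)⁻¹ :=
    mul_le_of_le_one_left (inv_nonneg.2 (by linarith)) hq1.le
  calc _ ≤ (1 + a) / a + (1 + a) / a := by linarith
    _ = _ := by ring

theorem summable_prod_of_summable {f : ℤ → ℝ} (hf0 : ∀ n, 0 ≤ f n) (hf : Summable f) :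
    Summable (fun k : Fin d → ℤ => ∏ j, f (k j)) ∧
      ∑' k : Fin d → ℤ, ∏ j, f (k j) ≤ (∑' n, f n) ^ d := by
  have h : ∀ t : Finset (Fin d → ℤ), ∑ k ∈ t, ∏ j, f (k j) ≤ (∑' n, f n) ^ d := by
    intro t
    set T : Fin d → Finset ℤ := fun j => t.image fun k => k j with hT
    calc ∑ k ∈ t, ∏ j, f (k j) ≤ ∑ k ∈ Fintype.piFinset T, ∏ j, f (k j) := by
          refine Finset.sum_le_sum_of_subset_of_nonneg (fun k hk => ?_)
            fun k _ _ => Finset.prod_nonneg fun j _ => hf0 _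
          rw [Fintype.mem_piFinset]
          exact fun j => Finset.mem_image_of_mem _ hk
      _ = ∏ j, ∑ n ∈ T j, f n := (Finset.prod_univ_sum T fun _ n => f n).symm
      _ ≤ ∏ _j : Fin d, ∑' n, f n := Finset.prod_le_prod
          (fun j _ => Finset.sum_nonneg fun n _ => hf0 n) fun j _ => hf.sum_le_tsum _ fun n _ => hf0 n
      _ = _ := by simp
  have hs := summable_of_sum_le (fun k => Finset.prod_nonneg fun j _ => hf0 (k j)) h
  exact ⟨hs, hs.tsum_le_of_sum_le h⟩

/-- The solution `u` of `u - u ∘ f = g`, where the sums of `g` over the real periodic orbits vanish,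
with its loss of domain and a polynomial loss of size. -/
theorem exists_sub_shear_eq (hg : IsIntPeriodic (openPhase d s) g)
    (hd : DifferentiableOn ℂ g (openPhase d s)) (horb : OrbitSumsVanish (openPhase d s) g)
    (hM : ∀ p ∈ openPhase d s, ‖g p‖ ≤ M) (hM0 : 0 ≤ M) {δ : ℝ} (hδ : 0 < δ) (hδ1 : δ ≤ 1) :
    ∃ u : Phase d → G, IsIntPeriodic (openPhase d (s - δ)) u ∧
      DifferentiableOn ℂ u (openPhase d (s - δ)) ∧
      (∀ p ∈ openPhase d (s - δ), ‖u p‖ ≤ 80 * 4 ^ d / δ ^ (d + 1) * M) ∧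
      ∀ p ∈ openPhase d (s - δ), shear p ∈ openPhase d (s - δ) → u p - u (shear p) = g p := by
  have hsub : openPhase d (s - δ) ⊆ openPhase d s := openPhase_mono (by linarith)
  have ha : 0 < Real.pi * δ := by positivity
  obtain ⟨hs1, hb1⟩ := summable_exp_neg_abs ha
  obtain ⟨hs2, hb2⟩ := summable_prod_of_summable (d := d) (fun n => (Real.exp_pos _).le) hs1
  set b : (Fin d → ℤ) → ℝ := fun k => 80 * M / δ * ∏ j, Real.exp (-(Real.pi * δ * |(k j : ℝ)|))
  have hbs : Summable b := hs2.mul_left _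
  have hb : ∀ k, ∀ p ∈ openPhase d (s - δ), ‖solutionMode g k p‖ ≤ b k := fun k p hp =>
    norm_solutionMode_le hg hd horb hM hδ hδ1 k hp
  have hsum : ∀ p ∈ openPhase d (s - δ), Summable fun k => solutionMode g k p := fun p hp =>
    Summable.of_norm_bounded hbs fun k => hb k p hp
  refine ⟨fun p => ∑' k, solutionMode g k p, ?_, ?_, ?_, ?_⟩
  · intro p hp m
    refine tsum_congr fun k => ?_
    rw [solutionMode_add hg hd horb k (hsub hp) (add_intVec_mem_openPhase (hsub hp) m),
      dotInt_intVec, expTwoPiI_intCast, one_smul]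
  · exact differentiableOn_tsum_of_norm_le (isOpen_openPhase _) hbs
      (fun k => (differentiableOn_solutionMode hg hd horb k).mono hsub) hb
  · intro p hp
    refine (tsum_of_norm_bounded hbs.hasSum fun k => hb k p hp).trans ?_
    simp only [b]
    rw [tsum_mul_left]
    have h4 : ∑' n : ℤ, Real.exp (-(Real.pi * δ * |(n : ℝ)|)) ≤ 4 / δ := by
      refine hb1.trans ?_
      rw [div_le_div_iff₀ ha hδ]
      have h3 := Real.pi_gt_three
      have h5 : 2 * (1 + Real.pi * δ) ≤ 4 * Real.pi := by
        have : Real.pi * δ ≤ Real.pi * 1 := by gcongr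
        linarith
      nlinarith
    have h0 : 0 ≤ ∑' n : ℤ, Real.exp (-(Real.pi * δ * |(n : ℝ)|)) :=
      tsum_nonneg fun n => (Real.exp_pos _).le
    calc _ ≤ 80 * M / δ * (4 / δ) ^ d := by
          gcongr
          exact hb2.trans (by gcongr)
      _ = _ := by rw [div_pow, pow_succ]; field_simp
  · intro p hp hfp
    have hmode : ∀ k, solutionMode g k p - solutionMode g k (shear p) = fourierMode g k p := fun k => by
      rw [shear, solutionMode_add hg hd horb k (hsub hp) (hsub hfp),
        ← one_sub_expTwoPiI_smul_solutionMode hg hd horb k (hsub hp), sub_smul, one_smul]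
    rw [← (hsum p hp).tsum_sub (hsum _ hfp)]
    simp only [hmode]
    have hfs : Summable fun k => fourierMode g k p := by
      simp only [← hmode]; exact (hsum p hp).sub (hsum _ hfp)
    exact (hasSum_fourierMode hg hd.continuousOn (hsub hp) hfs).tsum_eq

end Cohomological

/-! ### The Newton step -/

section NewtonStep

variable {d : ℕ} {G : Type*} [NormedRing G]

theorem samePoint_iff {p q : Phase d} : SamePoint p q ↔ ∃ m : Fin d → ℤ, p = (q.1 + intVec m, q.2) := by
  constructor
  · rintro ⟨⟨m, hm⟩, h2⟩
    exact ⟨m, Prod.ext hm h2⟩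
  · rintro ⟨m, rfl⟩
    exact ⟨⟨m, rfl⟩, rfl⟩

/-- Conjugacy of cocycles passes to the products along orbits. -/
theorem mul_orbitProduct_eq {a η η' : Phase d → G} {p : Phase d} {N : ℕ}
    (h : ∀ i < N, a (shear^[i + 1] p) * η (shear^[i] p) = η' (shear^[i] p) * a (shear^[i] p)) :
    a (shear^[N] p) * orbitProduct η p N = orbitProduct η' p N * a p := by
  induction N with
  | zero => simp [orbitProduct]
  | succ n ih =>
    rw [orbitProduct, ← mul_assoc, h n (Nat.lt_succ_self n), mul_assoc,
      ih fun i hi => h i (Nat.lt_succ_of_lt hi), orbitProduct, mul_assoc]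

theorem isUnit_one_add_and_norm_inverse_le [CompleteSpace G] {y : G} (hy : ‖y‖ ≤ 1 / 2) :
    IsUnit (1 + y) ∧ ‖Ring.inverse (1 + y)‖ ≤ ‖(1 : G)‖ + 1 := by
  have hy1 : ‖-y‖ < 1 := by rw [norm_neg]; linarith
  have h1 : 1 + y = 1 - -y := by rw [sub_neg_eq_add]
  rw [h1]
  refine ⟨isUnit_one_sub_of_norm_lt_one hy1, ?_⟩
  rw [← geom_series_eq_inverse _ hy1]
  refine (tsum_geometric_le_of_norm_lt_one _ hy1).trans ?_
  have : (1 - ‖-y‖)⁻¹ ≤ 2 := by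
    rw [norm_neg]
    exact inv_le_of_inv_le₀ (by norm_num) (by linarith)
  linarith

variable [NormedAlgebra ℂ G]

/-- The cocycle `1 + ε ^ m w` is close to the identity to order `m`, with the size of `w` normalised
by the radius `R`; it is holomorphic on the domain with parameters `R` and `s`, and satisfies the
Periodic Orbit Condition at the real periodic points. -/
structure IsReducedCocycle (R s : ℝ) (m : ℕ) (w : ℂ × Phase d → G) : Prop where
  periodic : ∀ ε ∈ paramDisk R, IsIntPeriodic (openPhase d s) fun p => w (ε, p)
  holomorphic : DifferentiableOn ℂ w (paramDisk R ×ˢ openPhase d s)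
  bound : ∀ x ∈ paramDisk R ×ˢ openPhase d s, ‖w x‖ ≤ (R ^ m)⁻¹
  orbit : ∀ ε ∈ paramDisk R, ∀ p ∈ openPhase d s, (∀ j, (p.1 j).im = 0) → (∀ j, (p.2 j).im = 0) →
    ∀ N : ℕ, 0 < N → SamePoint (shear^[N] p) p →
      orbitProduct (fun q => 1 + ε ^ m • w (ε, q)) p N = 1

theorem shear_iterate_mem_openPhase {s : ℝ} {p : Phase d} (hp : p ∈ openPhase d s)
    (hI : ∀ j, (p.2 j).im = 0) (i : ℕ) : shear^[i] p ∈ openPhase d s := by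
  rw [shear_iterate]
  have h : (i : ℂ) • p.2 = realVec fun j => i * (p.2 j).re := by
    ext j
    apply Complex.ext <;> simp [hI j]
  rw [h]
  exact add_realVec_mem_openPhase hp _

variable {R s : ℝ} {m : ℕ} {w : ℂ × Phase d → G}

theorem differentiableOn_pow_fst_smul {S : Set (ℂ × Phase d)} {v : ℂ × Phase d → G}
    (hv : DifferentiableOn ℂ v S) (j : ℕ) : DifferentiableOn ℂ (fun x => x.1 ^ j • v x) S :=
  (differentiableOn_fst.pow j).smul hv

/-- Along an orbit, the first order term of the product of `1 + ε ^ m w` is a sum. -/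
theorem exists_orbitProduct_eq (hw : DifferentiableOn ℂ w (paramDisk R ×ˢ openPhase d s))
    {p : Phase d} (hp : p ∈ openPhase d s) (hI : ∀ j, (p.2 j).im = 0) (N : ℕ) :
    ∃ Q : ℂ → G, DifferentiableOn ℂ Q (paramDisk R) ∧ ∀ ε,
      orbitProduct (fun q => 1 + ε ^ m • w (ε, q)) p N
        = 1 + ε ^ m • ∑ i ∈ Finset.range N, w (ε, shear^[i] p) + ε ^ (2 * m) • Q ε := by
  induction N with
  | zero => exact ⟨0, differentiableOn_const _, fun ε => by simp [orbitProduct]⟩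
  | succ N ih =>
    obtain ⟨Q, hQ, h⟩ := ih
    have hd : ∀ i, DifferentiableOn ℂ (fun ε => w (ε, shear^[i] p)) (paramDisk R) := fun i =>
      differentiableOn_param hw (shear_iterate_mem_openPhase hp hI i)
    refine ⟨fun ε => Q ε + w (ε, shear^[N] p) * (∑ i ∈ Finset.range N, w (ε, shear^[i] p))
      + ε ^ m • (w (ε, shear^[N] p) * Q ε), ?_, fun ε => ?_⟩
    · refine (hQ.add ((hd N).mul (DifferentiableOn.fun_sum fun i _ => hd i))).add
        ((differentiableOn_id.pow m).smul ((hd N).mul hQ))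
    · rw [orbitProduct, h ε, Finset.sum_range_succ]
      simp only [add_mul, mul_add, one_mul, mul_one, smul_mul_assoc, mul_smul_comm, smul_add,
        smul_smul, two_mul, pow_add]
      abel

/-- The Periodic Orbit Condition for `1 + ε ^ m w` holds to first order for the Taylor coefficients
of `w` of degree less than `m`. -/
theorem IsReducedCocycle.orbitSumsVanish_paramCoeff (h : IsReducedCocycle R s m w)
    {r : ℝ} (hr : 0 < r) (hrR : r < R) {j : ℕ} (hj : j < m) :
    OrbitSumsVanish (openPhase d s) (paramCoeff r w j) := by
  intro p hp hθ hI N hN hper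
  obtain ⟨Q, hQ, hprod⟩ := exists_orbitProduct_eq (m := m) h.holomorphic hp hI N
  refine sum_paramCoeff_eq_zero hr hrR h.holomorphic (Finset.range N)
    (fun i _ => shear_iterate_mem_openPhase hp hI i) hj (b := fun ε => -Q ε) hQ.neg fun z hz => ?_
  have hz0 := sphere_ne_zero hr hz
  have h1 := h.orbit z (sphere_subset_paramDisk hrR hz) p hp hθ hI N hN hper
  rw [hprod z, add_assoc, add_eq_left, two_mul, pow_add, mul_smul, ← smul_add] at h1
  have h2 := (smul_eq_zero.1 h1).resolve_left (pow_ne_zero _ hz0)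
  rw [smul_neg]
  exact eq_neg_of_add_eq_zero_left h2

/-- The constant in the estimate of the solution of the linear equation. -/
def lossConst (d : ℕ) (δ : ℝ) : ℝ := 80 * 4 ^ d / δ ^ (d + 1)

theorem one_le_lossConst {δ : ℝ} (hδ : 0 < δ) (hδ1 : δ ≤ 1) : 1 ≤ lossConst d δ := by
  rw [lossConst, le_div_iff₀ (by positivity), one_mul]
  have h1 : δ ^ (d + 1) ≤ 1 := pow_le_one₀ hδ.le hδ1
  have h2 : (1 : ℝ) ≤ 4 ^ d := one_le_pow₀ (by norm_num)
  linarith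

theorem pow_exp_neg_div {x : ℝ} {m : ℕ} (hm : 0 < m) (L : ℝ) :
    (x * Real.exp (-(L / m))) ^ m = x ^ m * Real.exp (-L) := by
  have : (m : ℝ) ≠ 0 := by exact_mod_cast hm.ne'
  rw [mul_pow, ← Real.exp_nat_mul]
  congr 2
  field_simp

/-- The radii `R exp (-L / m)` and `R exp (-L / (2 m))` differ by a fraction of order `1 / m`. -/
theorem radius_ratio_le {R L t : ℝ} {m : ℕ} (hR : 0 < R) (hm : 0 < m) (hL : 1 ≤ L)
    (ht : t < R * Real.exp (-(L / m))) :
    R * Real.exp (-(L / 2 / m)) / (R * Real.exp (-(L / 2 / m)) - t) ≤ 3 * m := by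
  set r := R * Real.exp (-(L / 2 / m)) with hr
  have hm1 : (1 : ℝ) ≤ m := by exact_mod_cast hm
  have hr0 : 0 < r := by positivity
  set y := L / 2 / m with hy
  have hy0 : 0 < y := by positivity
  have hR'y : R * Real.exp (-(L / m)) = r * Real.exp (-y) := by
    rw [hr, mul_assoc, ← Real.exp_add]
    congr 2
    rw [hy]; field_simp; ring
  rw [hR'y] at ht
  have hexp : Real.exp (-y) ≤ (1 + y)⁻¹ := by
    rw [Real.exp_neg]
    exact inv_anti₀ (by linarith) (by linarith [Real.add_one_le_exp y])
  have hmy : 1 / 2 ≤ m * y := by rw [hy]; field_simp; linarith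
  have h3 : 1 ≤ 3 * m * (1 - (1 + y)⁻¹) := by
    have h4 : 1 - (1 + y)⁻¹ = y / (1 + y) := by field_simp; ring
    rw [h4, ← mul_div_assoc, le_div_iff₀ (by linarith)]
    nlinarith
  have h5 : 3 * m * (1 - (1 + y)⁻¹) ≤ 3 * m * (1 - Real.exp (-y)) := by gcongr
  have h6 : Real.exp (-y) < 1 := by rw [Real.exp_lt_one_iff]; linarith
  have h7 : 0 < r - t := by nlinarith
  rw [div_le_iff₀ h7]
  calc r ≤ r * (3 * m * (1 - Real.exp (-y))) := le_mul_of_one_le_right hr0.le (h3.trans h5)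
    _ = 3 * m * (r - r * Real.exp (-y)) := by ring
    _ ≤ 3 * m * (r - t) := by gcongr

theorem newton_bound {c m A E : ℝ} (hc : 0 ≤ c) (hm : 1 ≤ m) (hA : 1 ≤ A) (hE : 1 ≤ E)
    (hcE : (c + 1) * (5 * m * A) ≤ E) (x : ℝ) :
    (2 * m * A * x * x + x * x * (E * (3 * m))) * (c + 1) ≤ x * x * (E * E) := by
  have e1 : m * A ≤ m * A * E := le_mul_of_one_le_right (by positivity) hE
  have e2 : m * E ≤ m * E * A := le_mul_of_one_le_right (by positivity) hA
  have h5 : 2 * m * A + 3 * m * E ≤ 5 * m * A * E := by linarith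
  have h6 : (c + 1) * (2 * m * A + 3 * m * E) ≤ E * E := by
    calc (c + 1) * (2 * m * A + 3 * m * E) ≤ (c + 1) * (5 * m * A * E) := by gcongr
      _ = (c + 1) * (5 * m * A) * E := by ring
      _ ≤ E * E := by gcongr
  calc _ = x * x * ((c + 1) * (2 * m * A + 3 * m * E)) := by ring
    _ ≤ _ := mul_le_mul_of_nonneg_left h6 (mul_self_nonneg x)

variable [CompleteSpace G]

/-- One step of the Newton scheme. The linear equation `U - U ∘ f = W` is solved for the Taylor
polynomial `W` of degree less than `m` of `w`, and `1 + ε ^ m U` conjugates `1 + ε ^ m w` to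
`1 + ε ^ (2 m) w'`. The loss in the estimates is absorbed by Schwarz' lemma in `ε`: shrinking the
radius by the factor `exp (-L / m)` gains the factor `exp (-L)`. -/
theorem IsReducedCocycle.exists_newton_step (h : IsReducedCocycle R s m w) (hR : 0 < R) (hm : 0 < m)
    {δ L : ℝ} (hδ : 0 < δ) (hδ1 : δ ≤ 1) (hL1 : 1 ≤ L)
    (hL : (‖(1 : G)‖ + 1) * (5 * m * lossConst d δ) ≤ Real.exp L) :
    ∃ U w' : ℂ × Phase d → G,
      IsReducedCocycle (R * Real.exp (-(L / m))) (s - δ) (2 * m) w' ∧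
      (∀ ε ∈ paramDisk (R * Real.exp (-(L / m))),
        IsIntPeriodic (openPhase d (s - δ)) fun p => U (ε, p)) ∧
      DifferentiableOn ℂ U (paramDisk (R * Real.exp (-(L / m))) ×ˢ openPhase d (s - δ)) ∧
      (∀ x ∈ paramDisk (R * Real.exp (-(L / m))) ×ˢ openPhase d (s - δ),
        ‖U x‖ ≤ m * lossConst d δ * (R ^ m)⁻¹) ∧
      ∀ ε ∈ paramDisk (R * Real.exp (-(L / m))), ∀ p ∈ openPhase d (s - δ),
        shear p ∈ openPhase d (s - δ) →
        (1 + ε ^ m • U (ε, shear p)) * (1 + ε ^ m • w (ε, p))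
          = (1 + ε ^ (2 * m) • w' (ε, p)) * (1 + ε ^ m • U (ε, p)) := by
  set R' := R * Real.exp (-(L / m)) with hR'
  set r := R * Real.exp (-(L / 2 / m)) with hr
  set A := lossConst d δ with hA
  have hA1 : 1 ≤ A := one_le_lossConst hδ hδ1
  have hm1 : (1 : ℝ) ≤ m := by exact_mod_cast hm
  have hm0 : (0 : ℝ) < m := by linarith
  have hone : 0 ≤ ‖(1 : G)‖ := norm_nonneg _
  have hr0 : 0 < r := by positivity
  have hR'0 : 0 < R' := by positivity
  have hrR : r < R := by
    rw [hr]; refine mul_lt_of_lt_one_right hR ?_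
    rw [Real.exp_lt_one_iff]
    have : 0 < L / 2 / m := by positivity
    linarith
  have hR'r : R' < r := by
    rw [hr, hR']; refine mul_lt_mul_of_pos_left ?_ hR
    rw [Real.exp_lt_exp]
    have : L / 2 / m < L / m := by gcongr; linarith
    linarith
  have hR'pow : R' ^ m = R ^ m * Real.exp (-L) := pow_exp_neg_div hm L
  have hrpow : r ^ m = R ^ m * Real.exp (-(L / 2)) := pow_exp_neg_div hm (L / 2)
  have hsub : openPhase d (s - δ) ⊆ openPhase d s := openPhase_mono (by linarith)
  have hsphere := sphere_subset_paramDisk hrR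
  have hdisk : paramDisk R' ⊆ paramDisk r := Metric.ball_subset_ball hR'r.le
  have hdiskR : paramDisk R' ⊆ paramDisk R := Metric.ball_subset_ball (hR'r.trans hrR).le
  have hper : ∀ p ∈ openPhase d s, ∀ n : Fin d → ℤ, ∀ z ∈ Metric.sphere (0 : ℂ) r,
      w (z, (p.1 + intVec n, p.2)) = w (z, p) := fun p hp n z hz =>
    h.periodic z (hsphere hz) p hp n
  have hMw : ∀ p ∈ openPhase d s, ∀ z ∈ Metric.sphere (0 : ℂ) r, ‖w (z, p)‖ ≤ (R ^ m)⁻¹ :=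
    fun p hp z hz => h.bound (z, p) ⟨hsphere hz, hp⟩
  have hRm : 0 < (R ^ m)⁻¹ := by positivity
  -- the solutions for the Taylor coefficients of degree less than `m`
  have hsol : ∀ j, ∃ u : Phase d → G, j < m → IsIntPeriodic (openPhase d (s - δ)) u ∧
      DifferentiableOn ℂ u (openPhase d (s - δ)) ∧
      (∀ p ∈ openPhase d (s - δ), ‖u p‖ ≤ A * ((R ^ m)⁻¹ / r ^ j)) ∧
      ∀ p ∈ openPhase d (s - δ), shear p ∈ openPhase d (s - δ) →
        u p - u (shear p) = paramCoeff r w j p := by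
    intro j
    by_cases hj : j < m
    · obtain ⟨u, hu⟩ := exists_sub_shear_eq (s := s) (g := paramCoeff r w j) (M := (R ^ m)⁻¹ / r ^ j)
        (fun p hp n => by
          simp only [paramCoeff]
          rw [circleIntegral.integral_congr hr0.le fun z hz => by rw [hper p hp n z hz]])
        (differentiableOn_paramCoeff hr0 hrR (isOpen_openPhase s) h.holomorphic j)
        (h.orbitSumsVanish_paramCoeff hr0 hrR hj)
        (fun p hp => norm_paramCoeff_le hr0 (hMw p hp) j) (by positivity) hδ hδ1
      exact ⟨u, fun _ => hu⟩
    · exact ⟨0, fun hj' => absurd hj' hj⟩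
  choose u hu using hsol
  set U : ℂ × Phase d → G := fun x => ∑ j ∈ Finset.range m, x.1 ^ j • u j x.2 with hU
  set W : ℂ × Phase d → G := fun x => ∑ j ∈ Finset.range m, x.1 ^ j • paramCoeff r w j x.2 with hW
  set w' : ℂ × Phase d → G := fun x => ((U x - W x) * w x + paramRemainder r w m x)
    * Ring.inverse (1 + x.1 ^ m • U x) with hw'
  have hUper : ∀ ε, IsIntPeriodic (openPhase d (s - δ)) fun p => U (ε, p) := fun ε p hp n =>
    Finset.sum_congr rfl fun j hj => by
      rw [(hu j (Finset.mem_range.1 hj)).1 p hp n]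
  have hUd : DifferentiableOn ℂ U (paramDisk R' ×ˢ openPhase d (s - δ)) := by
    refine DifferentiableOn.fun_sum fun j hj => differentiableOn_pow_fst_smul (v := fun x => _) ?_ j
    exact (hu j (Finset.mem_range.1 hj)).2.1.comp (f := fun x : ℂ × Phase d => x.2) (by fun_prop)
      fun x hx => hx.2
  have hWd : DifferentiableOn ℂ W (paramDisk R' ×ˢ openPhase d (s - δ)) := by
    refine DifferentiableOn.fun_sum fun j hj => differentiableOn_pow_fst_smul (v := fun x => _) ?_ j
    exact (differentiableOn_paramCoeff hr0 hrR (isOpen_openPhase s) h.holomorphic j).comp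
      (f := fun x : ℂ × Phase d => x.2) (by fun_prop) fun x hx => hsub hx.2
  have hpolybound : ∀ (v : ℕ → G) (B : ℝ) (ε : ℂ), 0 ≤ B → ε ∈ paramDisk r →
      (∀ j < m, ‖v j‖ ≤ B * ((R ^ m)⁻¹ / r ^ j)) →
      ‖∑ j ∈ Finset.range m, ε ^ j • v j‖ ≤ m * B * (R ^ m)⁻¹ := by
    intro v B ε hB hε hv
    have hε' : ‖ε‖ ≤ r := (mem_ball_zero_iff.1 hε).le
    calc ‖∑ j ∈ Finset.range m, ε ^ j • v j‖ ≤ ∑ j ∈ Finset.range m, B * (R ^ m)⁻¹ := by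
          refine norm_sum_le_of_le _ fun j hj => ?_
          rw [norm_smul, norm_pow]
          calc ‖ε‖ ^ j * ‖v j‖ ≤ r ^ j * (B * ((R ^ m)⁻¹ / r ^ j)) := by
                gcongr
                exact hv j (Finset.mem_range.1 hj)
            _ = B * (R ^ m)⁻¹ := by field_simp
      _ = m * B * (R ^ m)⁻¹ := by simp; ring
  have hUb : ∀ x ∈ paramDisk R' ×ˢ openPhase d (s - δ), ‖U x‖ ≤ m * A * (R ^ m)⁻¹ := fun x hx =>
    hpolybound (fun j => u j x.2) A x.1 (by linarith) (hdisk hx.1) fun j hj =>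
      (hu j hj).2.2.1 x.2 hx.2
  have hWb : ∀ x ∈ paramDisk R' ×ˢ openPhase d (s - δ), ‖W x‖ ≤ m * 1 * (R ^ m)⁻¹ := fun x hx =>
    hpolybound (fun j => paramCoeff r w j x.2) 1 x.1 (by linarith) (hdisk hx.1) fun j hj => by
      rw [one_mul]; exact norm_paramCoeff_le hr0 (hMw x.2 (hsub hx.2)) j
  have hsmall : ∀ x ∈ paramDisk R' ×ˢ openPhase d (s - δ), ‖x.1 ^ m • U x‖ ≤ 1 / 2 := by
    intro x hx
    have hx1 : ‖x.1‖ ≤ R' := (mem_ball_zero_iff.1 hx.1).le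
    have hexp : (0 : ℝ) < Real.exp L := Real.exp_pos L
    rw [norm_smul, norm_pow]
    calc ‖x.1‖ ^ m * ‖U x‖ ≤ R' ^ m * (m * A * (R ^ m)⁻¹) := by
          gcongr
          exact hUb x hx
      _ = m * A / Real.exp L := by
          rw [hR'pow, Real.exp_neg]; field_simp
      _ ≤ 1 / 2 := by
          rw [div_le_div_iff₀ hexp (by norm_num)]
          have : 0 ≤ (m : ℝ) * A := by positivity
          nlinarith
  have hunit : ∀ x ∈ paramDisk R' ×ˢ openPhase d (s - δ), IsUnit (1 + x.1 ^ m • U x) :=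
    fun x hx => (isUnit_one_add_and_norm_inverse_le (hsmall x hx)).1
  have hTaylor : ∀ x ∈ paramDisk R' ×ˢ openPhase d (s - δ),
      w x = W x + x.1 ^ m • paramRemainder r w m x := fun x hx =>
    eq_sum_paramCoeff_add_paramRemainder hr0 hrR h.holomorphic m ⟨hdisk hx.1, hsub hx.2⟩
  have hUshear : ∀ ε, ∀ p ∈ openPhase d (s - δ), shear p ∈ openPhase d (s - δ) →
      U (ε, shear p) = U (ε, p) - W (ε, p) := by
    intro ε p hp hfp
    simp only [hU, hW, ← Finset.sum_sub_distrib, ← smul_sub]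
    refine Finset.sum_congr rfl fun j hj => ?_
    rw [← (hu j (Finset.mem_range.1 hj)).2.2.2 p hp hfp, sub_sub_cancel]
  have hconj : ∀ ε ∈ paramDisk R', ∀ p ∈ openPhase d (s - δ), shear p ∈ openPhase d (s - δ) →
      (1 + ε ^ m • U (ε, shear p)) * (1 + ε ^ m • w (ε, p))
        = (1 + ε ^ (2 * m) • w' (ε, p)) * (1 + ε ^ m • U (ε, p)) := by
    intro ε hε p hp hfp
    have h1 : w' (ε, p) * (1 + ε ^ m • U (ε, p))
        = (U (ε, p) - W (ε, p)) * w (ε, p) + paramRemainder r w m (ε, p) := by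
      simp only [hw']
      rw [mul_assoc, Ring.inverse_mul_cancel _ (hunit (ε, p) ⟨hε, hp⟩), mul_one]
    have h0 : (1 + ε ^ (2 * m) • w' (ε, p)) * (1 + ε ^ m • U (ε, p))
        = (1 + ε ^ m • U (ε, p)) + ε ^ (2 * m) • (w' (ε, p) * (1 + ε ^ m • U (ε, p))) := by
      rw [add_mul, one_mul, smul_mul_assoc]
    rw [hUshear ε p hp hfp, h0, h1]
    have h2 := hTaylor (ε, p) ⟨hε, hp⟩
    generalize U (ε, p) = x at *
    generalize W (ε, p) = y at *
    generalize paramRemainder r w m (ε, p) = v at *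
    rw [add_mul, one_mul, mul_add, mul_one, smul_mul_assoc, mul_smul_comm, smul_smul, ← pow_add,
      ← two_mul, smul_add, two_mul, pow_add, mul_smul _ _ v, smul_sub]
    have h3 : ε ^ m • w (ε, p) = ε ^ m • y + ε ^ m • ε ^ m • v := by
      rw [h2, smul_add]
    rw [h3]
    abel
  refine ⟨U, w', ⟨?_, ?_, ?_, ?_⟩, fun ε _ => hUper ε, hUd, hUb, hconj⟩
  · intro ε hε p hp n
    have e1 := hUper ε p hp n
    have e2 : W (ε, (p.1 + intVec n, p.2)) = W (ε, p) := by
      refine Finset.sum_congr rfl fun j _ => ?_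
      congr 1
      simp only [paramCoeff]
      rw [circleIntegral.integral_congr hr0.le fun z hz => by rw [hper p (hsub hp) n z hz]]
    have e3 : paramRemainder r w m (ε, (p.1 + intVec n, p.2)) = paramRemainder r w m (ε, p) := by
      simp only [paramRemainder]
      rw [circleIntegral.integral_congr hr0.le fun z hz => by rw [hper p (hsub hp) n z hz]]
    have e4 := h.periodic ε (hdiskR hε) p (hsub hp) n
    dsimp only at e1 e4
    simp only [hw', e1, e2, e3, e4]
  · refine DifferentiableOn.mul (DifferentiableOn.add (DifferentiableOn.mul (hUd.sub hWd)
      (h.holomorphic.mono (Set.prod_mono hdiskR hsub)))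
      ((differentiableOn_paramRemainder hr0 hrR (isOpen_openPhase s) h.holomorphic m).mono
        (Set.prod_mono hdisk hsub))) ?_
    intro x hx
    obtain ⟨v, hv⟩ := hunit x hx
    have h1 : DifferentiableAt ℂ Ring.inverse (1 + x.1 ^ m • U x) := by
      rw [← hv]; exact (contDiffAt_ringInverse ℂ v).differentiableAt (n := 1) (by simp)
    have h2 : DifferentiableOn ℂ (fun x : ℂ × Phase d => 1 + x.1 ^ m • U x)
        (paramDisk R' ×ˢ openPhase d (s - δ)) :=
      (differentiableOn_const _).add (differentiableOn_pow_fst_smul hUd m)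
    exact h1.comp_differentiableWithinAt x (h2 x hx)
  · intro x hx
    have hx1 : ‖x.1‖ < R' := mem_ball_zero_iff.1 hx.1
    have hinv := (isUnit_one_add_and_norm_inverse_le (hsmall x hx)).2
    have hUW : ‖U x - W x‖ ≤ 2 * m * A * (R ^ m)⁻¹ := by
      refine (norm_sub_le _ _).trans ((add_le_add (hUb x hx) (hWb x hx)).trans ?_)
      have : m * 1 * (R ^ m)⁻¹ ≤ m * A * (R ^ m)⁻¹ := by gcongr
      linarith
    have hwx := h.bound x ⟨hdiskR hx.1, hsub hx.2⟩
    have hrem := norm_paramRemainder_le hr0 (hx1.trans hR'r) (hMw x.2 (hsub hx.2)) m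
    set E := Real.exp L with hE
    have hE1 : 1 ≤ E := Real.one_le_exp (by linarith)
    have hrem2 : ‖paramRemainder r w m x‖ ≤ (R ^ m)⁻¹ * (R ^ m)⁻¹ * (E * (3 * m)) := by
      refine hrem.trans ?_
      have t1 : (R ^ m)⁻¹ / r ^ m ≤ (R ^ m)⁻¹ * (R ^ m)⁻¹ * E := by
        rw [hrpow, div_eq_mul_inv, mul_inv, ← Real.exp_neg, neg_neg, ← mul_assoc]
        refine mul_le_mul_of_nonneg_left ?_ (by positivity)
        rw [hE, Real.exp_le_exp]
        linarith
      have t2 : r / (r - ‖x.1‖) ≤ 3 * m := radius_ratio_le hR hm hL1 hx1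
      calc _ ≤ (R ^ m)⁻¹ * (R ^ m)⁻¹ * E * (3 * m) := by
            refine mul_le_mul t1 t2 (div_nonneg hr0.le (by linarith)) (by positivity)
        _ = _ := by ring
    have hfin : (R' ^ (2 * m))⁻¹ = (R ^ m)⁻¹ * (R ^ m)⁻¹ * (E * E) := by
      rw [mul_comm 2 m, pow_mul, hR'pow, Real.exp_neg, ← hE]
      field_simp
    rw [hfin]
    calc ‖w' x‖ ≤ (‖U x - W x‖ * ‖w x‖ + ‖paramRemainder r w m x‖)
          * ‖Ring.inverse (1 + x.1 ^ m • U x)‖ := by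
          refine (norm_mul_le _ _).trans ?_
          gcongr
          exact (norm_add_le _ _).trans (add_le_add_left (norm_mul_le _ _) _)
      _ ≤ (2 * m * A * (R ^ m)⁻¹ * (R ^ m)⁻¹ + (R ^ m)⁻¹ * (R ^ m)⁻¹ * (E * (3 * m)))
          * (‖(1 : G)‖ + 1) := by gcongr
      _ ≤ (R ^ m)⁻¹ * (R ^ m)⁻¹ * (E * E) := newton_bound hone hm1 hA1 hE1 hL _
  · intro ε hε p hp hθ hI N hN hsame
    have hmem := shear_iterate_mem_openPhase hp hI
    have h1 := mul_orbitProduct_eq (a := fun q => 1 + ε ^ m • U (ε, q))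
      (η := fun q => 1 + ε ^ m • w (ε, q)) (η' := fun q => 1 + ε ^ (2 * m) • w' (ε, q))
      (p := p) (N := N) fun i _ => by
        have := hmem (i + 1)
        rw [Function.iterate_succ_apply'] at this ⊢
        exact hconj ε hε _ (hmem i) this
    rw [h.orbit ε (hdiskR hε) p (hsub hp) hθ hI N hN hsame, mul_one] at h1
    obtain ⟨n, hn⟩ := samePoint_iff.1 hsame
    have h2 : U (ε, shear^[N] p) = U (ε, p) := by rw [hn]; exact hUper ε p hp n
    rw [h2] at h1
    exact ((hunit (ε, p) ⟨hε, hp⟩).mul_right_cancel (by rw [one_mul]; exact h1)).symm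

end NewtonStep

/-! ### Convergence of the Newton scheme -/

section Iteration

/-- The losses of domain of the Newton scheme, with sum `δ`. -/
def lossSeq (δ : ℝ) (n : ℕ) : ℝ := δ / 2 ^ (n + 1)

/-- The domain parameters of the Newton scheme. -/
def widthSeq (s δ : ℝ) (n : ℕ) : ℝ := s - δ * (1 - (2 ^ n)⁻¹)

theorem widthSeq_succ (s δ : ℝ) (n : ℕ) :
    widthSeq s δ (n + 1) = widthSeq s δ n - lossSeq δ n := by
  simp only [widthSeq, lossSeq, pow_succ]
  field_simp
  ring

/-- The logarithms of the factors that the `n`-th step of the Newton scheme has to gain. The last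
factor `2 ^ n` is not needed for the step; it makes the conjugacies summable. -/
def gainSeq (d : ℕ) (c δ : ℝ) (n : ℕ) : ℝ :=
  Real.log ((c + 1) * (5 * 2 ^ n * lossConst d (lossSeq δ n)) * 2 ^ n)

theorem gainSeq_eq (d : ℕ) {c δ : ℝ} (hc : 0 ≤ c) (hδ : 0 < δ) (n : ℕ) :
    gainSeq d c δ n = Real.log ((c + 1) * (5 * lossConst d (δ / 2)))
      + n * Real.log (4 * 2 ^ (d + 1)) := by
  have hA : 0 < lossConst d (δ / 2) := by unfold lossConst; positivity
  rw [gainSeq, ← Real.log_pow, ← Real.log_mul (by positivity) (by positivity)]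
  congr 1
  have h1 : lossConst d (lossSeq δ n) = lossConst d (δ / 2) * (2 ^ (d + 1)) ^ n := by
    have h2 : lossSeq δ n = δ / 2 / 2 ^ n := by
      rw [lossSeq, pow_succ, mul_comm, div_div]
    rw [h2]
    unfold lossConst
    rw [div_pow (δ / 2) (2 ^ n), ← pow_mul, mul_comm n, pow_mul]
    field_simp
  have h4 : (4 : ℝ) = 2 * 2 := by norm_num
  rw [h1, mul_pow, h4, mul_pow]
  ring

theorem summable_gainSeq (d : ℕ) {c δ : ℝ} (hc : 0 ≤ c) (hδ : 0 < δ) :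
    Summable fun n => gainSeq d c δ n / 2 ^ n := by
  have h1 : Summable fun n : ℕ => Real.log ((c + 1) * (5 * lossConst d (δ / 2))) * (1 / 2) ^ n :=
    summable_geometric_two.mul_left _
  have h2 : Summable fun n : ℕ => Real.log (4 * 2 ^ (d + 1)) * ((n : ℝ) ^ 1 * (1 / 2) ^ n) :=
    (summable_pow_mul_geometric_of_norm_lt_one (R := ℝ) 1 (by norm_num)).mul_left _
  refine (h1.add h2).congr fun n => ?_
  rw [gainSeq_eq d hc hδ, one_div, inv_pow, pow_one]
  field_simp

theorem exp_gainSeq (d : ℕ) {c δ : ℝ} (hc : 0 ≤ c) (hδ : 0 < δ) (n : ℕ) :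
    Real.exp (gainSeq d c δ n) = (c + 1) * (5 * 2 ^ n * lossConst d (lossSeq δ n)) * 2 ^ n := by
  have : 0 < lossConst d (lossSeq δ n) := by unfold lossConst lossSeq; positivity
  exact Real.exp_log (by positivity)

theorem one_le_gainSeq (d : ℕ) {c δ : ℝ} (hc : 0 ≤ c) (hδ : 0 < δ) (hδ1 : δ ≤ 1) (n : ℕ) :
    1 ≤ gainSeq d c δ n := by
  rw [← Real.exp_le_exp, exp_gainSeq d hc hδ]
  have h2 : (1 : ℝ) ≤ 2 ^ n := one_le_pow₀ (by norm_num)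
  have h1 : 1 ≤ lossConst d (lossSeq δ n) := by
    refine one_le_lossConst (by unfold lossSeq; positivity) ?_
    unfold lossSeq
    exact (div_le_self hδ.le (one_le_pow₀ (by norm_num))).trans hδ1
  have h3 := Real.exp_one_lt_d9
  calc Real.exp 1 ≤ (0 + 1) * (5 * 1 * 1) * 1 := by linarith
    _ ≤ _ := by gcongr

/-- The radii of the Newton scheme. They stay away from zero since `∑ gainSeq n / 2 ^ n` converges. -/
def radiusSeq (d : ℕ) (R c δ : ℝ) (n : ℕ) : ℝ :=
  R * Real.exp (-∑ i ∈ Finset.range n, gainSeq d c δ i / ((2 ^ i : ℕ) : ℝ))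

theorem radiusSeq_succ (d : ℕ) (R c δ : ℝ) (n : ℕ) :
    radiusSeq d R c δ (n + 1)
      = radiusSeq d R c δ n * Real.exp (-(gainSeq d c δ n / ((2 ^ n : ℕ) : ℝ))) := by
  rw [radiusSeq, Finset.sum_range_succ, neg_add, Real.exp_add, ← mul_assoc]; rfl

theorem exists_le_radiusSeq (d : ℕ) {R c δ : ℝ} (hR : 0 < R) (hc : 0 ≤ c) (hδ : 0 < δ)
    (hδ1 : δ ≤ 1) : ∃ R' > 0, ∀ n, R' ≤ radiusSeq d R c δ n := by
  refine ⟨R * Real.exp (-∑' n, gainSeq d c δ n / 2 ^ n), by positivity, fun n => ?_⟩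
  unfold radiusSeq
  gcongr
  push_cast
  exact (summable_gainSeq d hc hδ).sum_le_tsum _ fun i _ =>
    div_nonneg (zero_le_one.trans (one_le_gainSeq d hc hδ hδ1 i)) (by positivity)

variable {d : ℕ} {G : Type*} [NormedRing G] [NormedAlgebra ℂ G] [CompleteSpace G]

/-- A sequence of conjugacies `1 + ε ^ (2 ^ n) U n` from `1 + ε ^ (2 ^ n) w n` to
`1 + ε ^ (2 ^ (n + 1)) w (n + 1)`, on a fixed domain, with sizes that are summable. -/
theorem IsReducedCocycle.exists_newton_sequence {R s : ℝ} {w₀ : ℂ × Phase d → G}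
    (h : IsReducedCocycle R s 1 w₀) (hR : 0 < R) (hs : 0 < s) :
    ∃ R' > 0, ∃ U w : ℕ → ℂ × Phase d → G, w 0 = w₀ ∧ ∀ n,
      (∀ ε ∈ paramDisk R', IsIntPeriodic (openPhase d (s / 2)) fun p => U n (ε, p)) ∧
      DifferentiableOn ℂ (U n) (paramDisk R' ×ˢ openPhase d (s / 2)) ∧
      (∀ x ∈ paramDisk R' ×ˢ openPhase d (s / 2),
        ‖x.1 ^ 2 ^ n • U n x‖ ≤ ‖x.1‖ / R' * (1 / 2) ^ n / 5) ∧
      (∀ x ∈ paramDisk R' ×ˢ openPhase d (s / 2),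
        ‖x.1 ^ 2 ^ n • w n x‖ ≤ (‖x.1‖ / R') ^ 2 ^ n) ∧
      ∀ ε ∈ paramDisk R', ∀ p ∈ openPhase d (s / 2), shear p ∈ openPhase d (s / 2) →
        (1 + ε ^ 2 ^ n • U n (ε, shear p)) * (1 + ε ^ 2 ^ n • w n (ε, p))
          = (1 + ε ^ 2 ^ (n + 1) • w (n + 1) (ε, p)) * (1 + ε ^ 2 ^ n • U n (ε, p)) := by
  set δ := min (s / 2) 1 with hδdef
  have hδ : 0 < δ := lt_min (by positivity) one_pos
  have hδ1 : δ ≤ 1 := min_le_right _ _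
  set c := ‖(1 : G)‖ with hcdef
  have hc : 0 ≤ c := norm_nonneg _
  obtain ⟨R', hR', hle⟩ := exists_le_radiusSeq d hR hc hδ hδ1
  set ρ := radiusSeq d R c δ with hρ
  have hρ0 : ∀ n, 0 < ρ n := fun n => hR'.trans_le (hle n)
  set σ := widthSeq s δ with hσ
  have hσle : ∀ n, s / 2 ≤ σ n := fun n => by
    have h1 : δ ≤ s / 2 := min_le_left _ _
    have h2 : (0 : ℝ) ≤ (2 ^ n)⁻¹ := by positivity
    have h3 : δ * (1 - (2 ^ n)⁻¹) ≤ δ := mul_le_of_le_one_right hδ.le (by linarith)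
    simp only [hσ, widthSeq]; linarith
  set State : ℕ → Type _ := fun n => {w : ℂ × Phase d → G // IsReducedCocycle (ρ n) (σ n) (2 ^ n) w}
  have hstep : ∀ n (w : State n), ∃ (U : ℂ × Phase d → G) (w' : State (n + 1)),
      (∀ ε ∈ paramDisk (ρ (n + 1)), IsIntPeriodic (openPhase d (σ (n + 1))) fun p => U (ε, p)) ∧
      DifferentiableOn ℂ U (paramDisk (ρ (n + 1)) ×ˢ openPhase d (σ (n + 1))) ∧
      (∀ x ∈ paramDisk (ρ (n + 1)) ×ˢ openPhase d (σ (n + 1)),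
        ‖U x‖ ≤ (2 ^ n : ℕ) * lossConst d (lossSeq δ n) * (ρ n ^ 2 ^ n)⁻¹) ∧
      ∀ ε ∈ paramDisk (ρ (n + 1)), ∀ p ∈ openPhase d (σ (n + 1)),
        shear p ∈ openPhase d (σ (n + 1)) →
        (1 + ε ^ 2 ^ n • U (ε, shear p)) * (1 + ε ^ 2 ^ n • w.1 (ε, p))
          = (1 + ε ^ 2 ^ (n + 1) • w'.1 (ε, p)) * (1 + ε ^ 2 ^ n • U (ε, p)) := by
    intro n w
    have hl0 : 0 < lossSeq δ n := by unfold lossSeq; positivity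
    have hl1 : lossSeq δ n ≤ 1 := by
      unfold lossSeq
      exact (div_le_self hδ.le (one_le_pow₀ (by norm_num))).trans hδ1
    obtain ⟨U, w', hw', h1, h2, h3, h4⟩ := w.2.exists_newton_step (hρ0 n) (by positivity)
      (δ := lossSeq δ n) (L := gainSeq d c δ n) hl0 hl1 (one_le_gainSeq d hc hδ hδ1 n) (by
        rw [exp_gainSeq d hc hδ]
        push_cast
        refine le_mul_of_one_le_right ?_ (one_le_pow₀ (by norm_num))
        have := one_le_lossConst (d := d) hl0 hl1
        positivity)
    rw [← radiusSeq_succ, ← widthSeq_succ] at h1 h2 h3 h4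
    rw [← radiusSeq_succ, ← widthSeq_succ, ← pow_succ'] at hw'
    refine ⟨U, ⟨w', hw'⟩, h1, h2, h3, ?_⟩
    rw [← pow_succ'] at h4
    exact h4
  choose U next hU using hstep
  have hinit : IsReducedCocycle (ρ 0) (σ 0) (2 ^ 0) w₀ := by
    have e1 : ρ 0 = R := by simp [hρ, radiusSeq]
    have e2 : σ 0 = s := by simp [hσ, widthSeq]
    rw [e1, e2, pow_zero]; exact h
  set seq : ∀ n, State n := fun n => Nat.rec ⟨w₀, hinit⟩ next n with hseq
  have hdisk : ∀ n, paramDisk R' ⊆ paramDisk (ρ n) := fun n => Metric.ball_subset_ball (hle n)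
  have hdom : ∀ n, openPhase d (s / 2) ⊆ openPhase d (σ n) := fun n => openPhase_mono (hσle n)
  refine ⟨R', hR', fun n => U n (seq n), fun n => (seq n).1, rfl, fun n => ?_⟩
  obtain ⟨h1, h2, h3, h4⟩ := hU n (seq n)
  refine ⟨fun ε hε p hp => h1 ε (hdisk _ hε) p (hdom _ hp),
    h2.mono (Set.prod_mono (hdisk _) (hdom _)), fun x hx => ?_, fun x hx => ?_,
    fun ε hε p hp hfp =>
      h4 ε (hdisk _ hε) p (hdom _ hp) (hdom _ hfp)⟩
  · have hb := h3 x ⟨hdisk _ hx.1, hdom _ hx.2⟩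
    have hx1 : ‖x.1‖ < R' := mem_ball_zero_iff.1 hx.1
    set m := 2 ^ n with hm
    set A := lossConst d (lossSeq δ n) with hA
    have hA0 : 0 < A := by simp only [hA]; unfold lossConst lossSeq; positivity
    set t := ‖x.1‖ / ρ (n + 1) with ht
    have ht0 : 0 ≤ t := div_nonneg (norm_nonneg _) (hρ0 _).le
    have ht1 : t ≤ 1 := (div_le_one (hρ0 _)).2 (hx1.le.trans (hle _))
    have htR : t ≤ ‖x.1‖ / R' := div_le_div_of_nonneg_left (norm_nonneg _) hR' (hle _)
    have hxt : ‖x.1‖ = t * ρ (n + 1) := (div_mul_cancel₀ _ (hρ0 _).ne').symm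
    have hpow : ρ (n + 1) ^ m = ρ n ^ m * Real.exp (-gainSeq d c δ n) := by
      simp only [hρ]
      rw [radiusSeq_succ]
      exact pow_exp_neg_div (by positivity) _
    have hmpos : 0 < m := by positivity
    have htm : t ^ m ≤ t := pow_le_of_le_one ht0 ht1 hmpos.ne'
    rw [norm_smul, norm_pow]
    have hρm : (0 : ℝ) < ρ n ^ m := pow_pos (hρ0 n) m
    calc ‖x.1‖ ^ m * ‖U n (seq n) x‖
        ≤ (t * ρ (n + 1)) ^ m * (m * A * (ρ n ^ m)⁻¹) := by
          rw [← hxt]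
          gcongr
      _ = t ^ m * (m * A / Real.exp (gainSeq d c δ n)) := by
          rw [mul_pow, hpow, Real.exp_neg]; field_simp
      _ = t ^ m * ((1 / 2) ^ n / 5 / (c + 1)) := by
          rw [exp_gainSeq d hc hδ]
          congr 1
          have : (m : ℝ) = 2 ^ n := by rw [hm]; push_cast; rfl
          rw [this, one_div, inv_pow, ← hA]
          field_simp
      _ ≤ ‖x.1‖ / R' * ((1 / 2) ^ n / 5) := by
          have h5 : (1 / 2 : ℝ) ^ n / 5 / (c + 1) ≤ (1 / 2) ^ n / 5 :=
            div_le_self (by positivity) (by linarith)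
          gcongr
          exact htm.trans htR
      _ = _ := by ring
  · have hb := (seq n).2.bound x ⟨hdisk _ hx.1, hdom _ hx.2⟩
    rw [norm_smul, norm_pow]
    have hρm : (0 : ℝ) < ρ n ^ 2 ^ n := pow_pos (hρ0 n) _
    calc ‖x.1‖ ^ 2 ^ n * ‖(seq n).1 x‖ ≤ ‖x.1‖ ^ 2 ^ n * (ρ n ^ 2 ^ n)⁻¹ := by gcongr
      _ = (‖x.1‖ / ρ n) ^ 2 ^ n := by rw [div_pow, div_eq_mul_inv]
      _ ≤ (‖x.1‖ / R') ^ 2 ^ n := by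
          have := hρ0 n
          gcongr
          exact hle n

/-- A cocycle `1 + ε w` with the Periodic Orbit Condition is a coboundary, with a solution near the
identity. -/
theorem IsReducedCocycle.exists_solution {R s : ℝ} {w₀ : ℂ × Phase d → G}
    (h : IsReducedCocycle R s 1 w₀) (hR : 0 < R) (hs : 0 < s) :
    ∃ R' > 0, ∃ φ : ℂ × Phase d → G,
      (∀ ε ∈ paramDisk R', IsIntPeriodic (openPhase d (s / 2)) fun p => φ (ε, p)) ∧
      DifferentiableOn ℂ φ (paramDisk R' ×ˢ openPhase d (s / 2)) ∧
      (∀ x ∈ paramDisk R' ×ˢ openPhase d (s / 2), ‖φ x - 1‖ ≤ ‖(1 : G)‖ * (‖x.1‖ / R')) ∧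
      ∀ ε ∈ paramDisk R', ∀ p ∈ openPhase d (s / 2), shear p ∈ openPhase d (s / 2) →
        φ (ε, shear p) * (1 + ε • w₀ (ε, p)) = φ (ε, p) := by
  obtain ⟨R', hR', U, w, hw0, hseq⟩ := h.exists_newton_sequence hR hs
  set D := paramDisk R' ×ˢ openPhase d (s / 2) with hD
  have hDo : IsOpen D := Metric.isOpen_ball.prod (isOpen_openPhase _)
  -- the product of the first `n` conjugacies
  set φ : ℕ → ℂ × Phase d → G := fun n =>
    Nat.rec (fun _ => 1) (fun n f x => (1 + x.1 ^ 2 ^ n • U n x) * f x) n with hφ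
  have hφ0 : ∀ x, φ 0 x = 1 := fun x => rfl
  have hφs : ∀ n x, φ (n + 1) x = (1 + x.1 ^ 2 ^ n • U n x) * φ n x := fun n x => rfl
  set c := ‖(1 : G)‖ with hc
  have hc0 : 0 ≤ c := norm_nonneg _
  have ht : ∀ x ∈ D, ‖x.1‖ / R' < 1 := fun x hx => by
    rw [div_lt_one hR']; exact mem_ball_zero_iff.1 hx.1
  have ht0 : ∀ x : ℂ × Phase d, 0 ≤ ‖x.1‖ / R' := fun x => by positivity
  have hnorm : ∀ n, ∀ x ∈ D, ‖φ n x‖ ≤ c * (2 - (1 / 2) ^ n) := by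
    intro n x hx
    induction n with
    | zero =>
      rw [hφ0, pow_zero]
      change c ≤ c * (2 - 1)
      norm_num
    | succ n ih =>
      rw [hφs, add_mul, one_mul]
      have h1 := (hseq n).2.2.1 x hx
      have h2 : (0 : ℝ) < (1 / 2) ^ n := by positivity
      have h3 : ‖x.1 ^ 2 ^ n • U n x‖ ≤ (1 / 2) ^ n / 5 := by
        refine h1.trans ?_
        have := (ht x hx).le
        have : ‖x.1‖ / R' * (1 / 2) ^ n ≤ 1 * (1 / 2) ^ n := by gcongr
        linarith
      have h4 : ‖φ n x‖ ≤ c * 2 := ih.trans (by gcongr; linarith)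
      calc _ ≤ ‖φ n x‖ + ‖x.1 ^ 2 ^ n • U n x‖ * ‖φ n x‖ :=
            (norm_add_le _ _).trans (add_le_add_right (norm_mul_le _ _) _)
        _ ≤ c * (2 - (1 / 2) ^ n) + (1 / 2) ^ n / 5 * (c * 2) := by gcongr
        _ ≤ c * (2 - (1 / 2) ^ (n + 1)) := by
            rw [pow_succ]; nlinarith [mul_nonneg hc0 h2.le]
  have hdiff : ∀ n, ∀ x ∈ D, ‖φ (n + 1) x - φ n x‖ ≤ c * (‖x.1‖ / R') * (1 / 2) / 2 ^ n := by
    intro n x hx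
    have h1 := (hseq n).2.2.1 x hx
    have h2 : (0 : ℝ) < (1 / 2) ^ n := by positivity
    have h4 : ‖φ n x‖ ≤ c * 2 := (hnorm n x hx).trans (by gcongr; linarith)
    rw [hφs, add_mul, one_mul, add_sub_cancel_left]
    calc _ ≤ ‖x.1 ^ 2 ^ n • U n x‖ * ‖φ n x‖ := norm_mul_le _ _
      _ ≤ ‖x.1‖ / R' * (1 / 2) ^ n / 5 * (c * 2) := by gcongr
      _ = c * (‖x.1‖ / R') * (2 / 5) / 2 ^ n := by
          rw [one_div, inv_pow]; ring
      _ ≤ _ := by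
          have := ht0 x
          exact div_le_div_of_nonneg_right
            (mul_le_mul_of_nonneg_left (by norm_num) (by positivity)) (by positivity)
  have hdist : ∀ x ∈ D, ∀ n, dist (φ n x) (φ (n + 1) x) ≤ c * (‖x.1‖ / R') / 2 / 2 ^ n :=
    fun x hx n => by
      rw [dist_comm, dist_eq_norm]
      refine (hdiff n x hx).trans (le_of_eq (by ring))
  have hlim : ∀ x, ∃ y, x ∈ D → Filter.Tendsto (fun n => φ n x) Filter.atTop (nhds y) := by
    intro x
    by_cases hx : x ∈ D
    · obtain ⟨y, hy⟩ := cauchySeq_tendsto_of_complete (cauchySeq_of_le_geometric_two (hdist x hx))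
      exact ⟨y, fun _ => hy⟩
    · exact ⟨0, fun h => absurd h hx⟩
  choose Φ hΦ using hlim
  have hφd : ∀ n, DifferentiableOn ℂ (φ n) D := by
    intro n
    induction n with
    | zero => exact differentiableOn_const _
    | succ n ih =>
      exact ((differentiableOn_const _).add (differentiableOn_pow_fst_smul (hseq n).2.1 _)).mul ih
  refine ⟨R', hR', Φ, ?_, ?_, ?_, ?_⟩
  · intro ε hε p hp n
    have hp' := add_intVec_mem_openPhase hp n
    have hper : ∀ k, φ k (ε, (p.1 + intVec n, p.2)) = φ k (ε, p) := by
      intro k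
      induction k with
      | zero => rfl
      | succ k ih =>
        have := (hseq k).1 ε hε p hp n
        dsimp only at this
        rw [hφs, hφs, ih]
        dsimp only
        rw [this]
    exact tendsto_nhds_unique ((hΦ _ ⟨hε, hp'⟩).congr hper) (hΦ _ ⟨hε, hp⟩)
  · have hsum : Summable fun n : ℕ => c * (1 / 2) * (1 / 2 : ℝ) ^ n :=
      summable_geometric_two.mul_left _
    refine differentiableOn_of_tendsto_of_norm_sub_le hDo hsum hφd (fun n x hx => ?_) hΦ
    refine (hdiff n x hx).trans ?_
    have h1 := (ht x hx).le
    calc c * (‖x.1‖ / R') * (1 / 2) / 2 ^ n ≤ c * 1 * (1 / 2) / 2 ^ n := by gcongr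
      _ = _ := by rw [one_div, inv_pow]; ring
  · intro x hx
    have := dist_le_of_le_geometric_two_of_tendsto₀ (hdist x hx) (hΦ x hx)
    rwa [hφ0, dist_comm, dist_eq_norm] at this
  · intro ε hε p hp hfp
    -- `φ n` conjugates the cocycle to `1 + ε ^ (2 ^ n) w n`, which tends to the identity
    have hrel : ∀ n, φ n (ε, shear p) * (1 + ε • w₀ (ε, p))
        = (1 + ε ^ 2 ^ n • w n (ε, p)) * φ n (ε, p) := by
      intro n
      induction n with
      | zero => rw [hφ0, hφ0, one_mul, mul_one, hw0, pow_zero, pow_one]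
      | succ n ih =>
        rw [hφs, hφs, mul_assoc, ih, ← mul_assoc, (hseq n).2.2.2.2 ε hε p hp hfp, mul_assoc]
    have h1 := (hΦ (ε, shear p) ⟨hε, hfp⟩).mul_const (1 + ε • w₀ (ε, p))
    have h2 : Filter.Tendsto (fun n => ε ^ 2 ^ n • w n (ε, p)) Filter.atTop (nhds 0) := by
      have ht1 := ht (ε, p) ⟨hε, hp⟩
      have ht2 := ht0 (ε, p)
      have h3 : Filter.Tendsto (fun n : ℕ => (‖ε‖ / R') ^ 2 ^ n) Filter.atTop (nhds 0) :=
        (tendsto_pow_atTop_nhds_zero_of_lt_one ht2 ht1).comp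
          (tendsto_pow_atTop_atTop_of_one_lt one_lt_two)
      exact squeeze_zero_norm (fun n => (hseq n).2.2.2.1 (ε, p) ⟨hε, hp⟩) h3
    have h4 := (h2.const_add 1).mul (hΦ (ε, p) ⟨hε, hp⟩)
    rw [add_zero, one_mul] at h4
    exact tendsto_nhds_unique h1 (h4.congr fun n => (hrel n).symm)

end Iteration

/-! ### Bounds for continuous periodic functions -/

section Compactness

variable {d : ℕ} {G : Type*} [NormedAddCommGroup G]

theorem isCompact_setOf_coordinates {S : Set ℂ} (hS : IsCompact S) :
    IsCompact {θ : EuclideanSpace ℂ (Fin d) | ∀ j, θ j ∈ S} := by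
  have h := (isCompact_univ_pi fun _ : Fin d => hS).image (PiLp.continuous_toLp 2 fun _ => ℂ)
  convert h using 1
  ext θ
  constructor
  · exact fun hθ => ⟨WithLp.ofLp θ, fun j _ => hθ j, rfl⟩
  · rintro ⟨t, ht, rfl⟩ j
    exact ht j trivial

theorem isCompact_realCube : IsCompact (realCube d) := by
  have h := isCompact_setOf_coordinates (d := d)
    ((isCompact_Icc (a := (-1 : ℝ)) (b := 1)).reProdIm (isCompact_singleton (x := (0 : ℝ))))
  convert h using 1
  ext I
  simp only [realCube, Set.mem_ofPred_eq, Complex.mem_reProdIm, Set.mem_singleton_iff]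
  exact forall_congr' fun j => and_comm

theorem isCompact_setOf_infDist_realCube_le (s : ℝ) :
    IsCompact {I : EuclideanSpace ℂ (Fin d) | Metric.infDist I (realCube d) ≤ s} := by
  refine (isCompact_realCube.cthickening (r := s + 1)).of_isClosed_subset
    (isClosed_le (Metric.continuous_infDist_pt _) continuous_const) fun I hI =>
      Metric.thickening_subset_cthickening _ _
        ((Metric.mem_thickening_iff_infDist_lt ⟨0, zero_mem_realCube⟩).2 (hI.trans_lt (lt_add_one s)))

/-- A continuous function that is `ℤ^d`-periodic in `θ` is bounded on `𝓜_s`, since the torus is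
compact. -/
theorem exists_norm_le_of_continuousOn_phaseDomain {K : Set ℂ} (hK : IsCompact K) {s : ℝ}
    {g : ℂ × Phase d → G} (hg : ContinuousOn g (K ×ˢ phaseDomain d s))
    (hper : ∀ ε ∈ K, IsPeriodicOn s fun p => g (ε, p)) :
    ∃ M, ∀ ε ∈ K, ∀ p ∈ phaseDomain d s, ‖g (ε, p)‖ ≤ M := by
  have hT := isCompact_setOf_coordinates (d := d)
    ((isCompact_Icc (a := (0 : ℝ)) (b := 1)).reProdIm (isCompact_Icc (a := -s) (b := s)))
  have hKTB := hK.prod (hT.prod (isCompact_setOf_infDist_realCube_le (d := d) (s / 10)))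
  have hsub : K ×ˢ ({θ : EuclideanSpace ℂ (Fin d) | ∀ j, θ j ∈ Set.Icc (0 : ℝ) 1 ×ℂ Set.Icc (-s) s}
      ×ˢ {I : EuclideanSpace ℂ (Fin d) | Metric.infDist I (realCube d) ≤ s / 10})
      ⊆ K ×ˢ phaseDomain d s :=
    Set.prod_mono le_rfl fun p hp => ⟨fun j => abs_le.2 (hp.1 j).2, hp.2⟩
  obtain ⟨M, hM⟩ := hKTB.exists_bound_of_continuousOn (hg.mono hsub)
  refine ⟨M, fun ε hε p hp => ?_⟩
  -- translate into the compact fundamental domain with `Re θ_j ∈ [0, 1]`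
  set m : Fin d → ℤ := fun j => -⌊(p.1 j).re⌋ with hm
  have h0 : g (ε, (p.1 + intVec m, p.2)) = g (ε, p) := hper ε hε p hp m
  rw [← h0]
  refine hM _ ⟨hε, fun j => ?_, hp.2⟩
  rw [PiLp.add_apply, intVec_apply, Complex.mem_reProdIm]
  have h1 : (p.1 j + (m j : ℂ)).re = Int.fract (p.1 j).re := by
    rw [Complex.add_re, Complex.intCast_re, hm, Int.fract]; push_cast; ring
  have h2 : (p.1 j + (m j : ℂ)).im = (p.1 j).im := by simp
  rw [h1, h2]
  exact ⟨⟨Int.fract_nonneg _, (Int.fract_lt_one _).le⟩, abs_le.1 (hp.1 j)⟩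

end Compactness

/-! ### Analytic solutions from the Periodic Orbit Condition -/

section Solution

variable {d : ℕ} {G : Type*} [NormedRing G]

theorem orbitProduct_congr {g g' : Phase d → G} {p : Phase d} {N : ℕ}
    (h : ∀ i < N, g (shear^[i] p) = g' (shear^[i] p)) : orbitProduct g p N = orbitProduct g' p N := by
  induction N with
  | zero => rfl
  | succ n ih =>
    rw [orbitProduct, orbitProduct, h n (Nat.lt_succ_self n),
      ih fun i hi => h i (Nat.lt_succ_of_lt hi)]

theorem isUnit_of_norm_sub_one_lt {x : G} [CompleteSpace G] (h : ‖x - 1‖ < 1) : IsUnit x := by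
  have h1 : ‖1 - x‖ < 1 := by rwa [norm_sub_rev]
  simpa using isUnit_one_sub_of_norm_lt_one h1

variable [NormedAlgebra ℂ G]

theorem IsAnalyticFamily.differentiableOn {ρ : ℝ} {η : ℂ → Phase d → G}
    (hη : IsAnalyticFamily ρ η) :
    DifferentiableOn ℂ (fun x : ℂ × Phase d => η x.1 x.2) (paramDisk ρ ×ˢ openPhase d ρ) :=
  hη.holomorphic.mono <| interior_maximal
    (Set.prod_mono le_rfl (openPhase_subset_phaseDomain ρ))
    (Metric.isOpen_ball.prod (isOpen_openPhase ρ))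

theorem phaseDomain_mono {d : ℕ} {s t : ℝ} (h : s ≤ t) : phaseDomain d s ⊆ phaseDomain d t := fun _ hp =>
  ⟨fun j => (hp.1 j).trans h, hp.2.trans (by linarith)⟩

theorem IsAnalyticFamily.mono {ρ ρ' : ℝ} (h : ρ' ≤ ρ) {η : ℂ → Phase d → G}
    (hη : IsAnalyticFamily ρ η) : IsAnalyticFamily ρ' η := by
  have hsub : paramDisk ρ' ×ˢ phaseDomain d ρ' ⊆ paramDisk ρ ×ˢ phaseDomain d ρ :=
    Set.prod_mono (Metric.ball_subset_ball h) (phaseDomain_mono h)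
  exact ⟨fun ε hε p hp => hη.periodic ε (Metric.ball_subset_ball h hε) p (phaseDomain_mono h hp),
    hη.continuousOn.mono hsub, hη.holomorphic.mono (interior_mono hsub)⟩

theorem closedBall_half_subset_paramDisk {ρ : ℝ} (hρ : 0 < ρ) :
    Metric.closedBall (0 : ℂ) (ρ / 2) ⊆ paramDisk ρ :=
  Metric.closedBall_subset_ball (by linarith)

theorem IsAnalyticFamily.exists_norm_le {ρ : ℝ} (hρ : 0 < ρ) {η : ℂ → Phase d → G}
    (hη : IsAnalyticFamily ρ η) :
    ∃ M, 0 ≤ M ∧ ∀ ε ∈ Metric.closedBall (0 : ℂ) (ρ / 2), ∀ p ∈ phaseDomain d ρ, ‖η ε p‖ ≤ M := by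
  have hsub := closedBall_half_subset_paramDisk hρ
  obtain ⟨M, hM⟩ := exists_norm_le_of_continuousOn_phaseDomain
    (isCompact_closedBall (0 : ℂ) (ρ / 2)) (hη.continuousOn.mono (Set.prod_mono hsub le_rfl))
    fun ε hε => hη.periodic ε (hsub hε)
  exact ⟨max M 0, le_max_right _ _, fun ε hε p hp => (hM ε hε p hp).trans (le_max_left _ _)⟩

variable [CompleteSpace G]

/-- An analytic family that equals the identity at `ε = 0` has the form `1 + ε w₀`. -/
theorem IsAnalyticFamily.eq_one_add_smul_paramRemainder {ρ : ℝ} (hρ : 0 < ρ) {η : ℂ → Phase d → G}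
    (hη : IsAnalyticFamily ρ η) (hη0 : ∀ p ∈ phaseDomain d ρ, η 0 p = 1) {ε : ℂ} {p : Phase d}
    (hε : ε ∈ paramDisk (ρ / 2)) (hp : p ∈ openPhase d ρ) :
    η ε p = 1 + ε • paramRemainder (ρ / 2) (fun x : ℂ × Phase d => η x.1 x.2) 1 (ε, p) := by
  have h : ∀ ε ∈ paramDisk (ρ / 2), η ε p
      = paramCoeff (ρ / 2) (fun x : ℂ × Phase d => η x.1 x.2) 0 p
        + ε • paramRemainder (ρ / 2) (fun x : ℂ × Phase d => η x.1 x.2) 1 (ε, p) := fun ε hε => by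
    simpa using eq_sum_paramCoeff_add_paramRemainder (by positivity) (by linarith)
      hη.differentiableOn 1 (x := (ε, p)) ⟨hε, hp⟩
  have h0 := h 0 (Metric.mem_ball_self (by positivity))
  rw [hη0 p (openPhase_subset_phaseDomain ρ hp), zero_smul, add_zero] at h0
  rw [h ε hε, ← h0]

/-- The Periodic Orbit Condition gives a solution near the identity, on open domains. -/
theorem exists_solution_of_periodicOrbitCondition {ρ ρ' : ℝ} (hρ' : 0 < ρ') (hle : ρ' ≤ ρ)
    {η : ℂ → Phase d → G} (hη : IsAnalyticFamily ρ η) (hη0 : ∀ p ∈ phaseDomain d ρ, η 0 p = 1)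
    (hpoc : ∀ ε ∈ paramDisk ρ, PeriodicOrbitCondition ρ' (η ε)) :
    ∃ R > 0, R ≤ ρ ∧ ∃ φ : ℂ × Phase d → G,
      (∀ ε ∈ paramDisk R, IsIntPeriodic (openPhase d (ρ' / 2)) fun p => φ (ε, p)) ∧
      DifferentiableOn ℂ φ (paramDisk R ×ˢ openPhase d (ρ' / 2)) ∧
      (∀ x ∈ paramDisk R ×ˢ openPhase d (ρ' / 2), ‖φ x - 1‖ ≤ ‖(1 : G)‖ / R * ‖x.1‖) ∧
      ∀ ε ∈ paramDisk R, ∀ p ∈ openPhase d (ρ' / 2), shear p ∈ openPhase d (ρ' / 2) →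
        φ (ε, shear p) * η ε p = φ (ε, p) := by
  have hρ : 0 < ρ := hρ'.trans_le hle
  obtain ⟨M, hM0, hM⟩ := hη.exists_norm_le hρ
  set r := ρ / 2 with hr
  have hr0 : 0 < r := by positivity
  have hrρ : r < ρ := by linarith
  set w : ℂ × Phase d → G := fun x => η x.1 x.2 with hw
  -- `‖w₀‖ ≤ 2 M / r` for `‖ε‖ < r / 2`, and a reduced cocycle needs `‖w₀‖ ≤ R⁻¹`
  set R := min (r / 2) (2 * M / r + 1)⁻¹ with hR
  have hR0 : 0 < R := by positivity
  have hRr : R ≤ r / 2 := min_le_left _ _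
  have hdisk : paramDisk R ⊆ paramDisk r := Metric.ball_subset_ball (by linarith)
  have hdom : openPhase d ρ' ⊆ openPhase d ρ := openPhase_mono hle
  have hηw : ∀ ε ∈ paramDisk R, ∀ p ∈ openPhase d ρ', η ε p = 1 + ε • paramRemainder r w 1 (ε, p) :=
    fun ε hε p hp => hη.eq_one_add_smul_paramRemainder hρ hη0 (hdisk hε) (hdom hp)
  have hred : IsReducedCocycle R ρ' 1 (paramRemainder r w 1) := by
    refine ⟨fun ε hε p hp n => ?_, ?_, fun x hx => ?_, fun ε hε p hp hθ hI N hN hper => ?_⟩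
    · simp only [paramRemainder]
      congr 1
      refine circleIntegral.integral_congr hr0.le fun z hz => ?_
      simp only [hw]
      rw [hη.periodic z (sphere_subset_paramDisk hrρ hz) p
        (openPhase_subset_phaseDomain ρ (hdom hp))]
    · exact (differentiableOn_paramRemainder hr0 hrρ (isOpen_openPhase ρ) hη.differentiableOn 1).mono
        (Set.prod_mono hdisk hdom)
    · have hx1 : ‖x.1‖ < R := mem_ball_zero_iff.1 hx.1
      have h := norm_paramRemainder_le (w := w) (M := M) hr0 (x := x) (by linarith) (fun z hz =>
        hM z (Metric.sphere_subset_closedBall hz) x.2 (openPhase_subset_phaseDomain ρ (hdom hx.2))) 1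
      refine h.trans ?_
      have h2 : r / (r - ‖x.1‖) ≤ 2 := by
        rw [div_le_iff₀ (by linarith)]; linarith
      have h3 : 2 * M / r + 1 ≤ R⁻¹ := by
        rw [le_inv_comm₀ (by positivity) hR0]; exact min_le_right _ _
      rw [pow_one, pow_one]
      calc M / r * (r / (r - ‖x.1‖)) ≤ M / r * 2 := by gcongr
        _ ≤ 2 * M / r + 1 := by
            rw [div_mul_eq_mul_div, mul_comm]; linarith
        _ ≤ R⁻¹ := h3
    · refine Eq.trans ?_ (hpoc ε (Metric.ball_subset_ball (by linarith) hε) p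
        (openPhase_subset_phaseDomain ρ' hp) N hN hper)
      refine orbitProduct_congr fun i _ => ?_
      rw [hηw ε hε _ (shear_iterate_mem_openPhase hp hI i), pow_one]
  obtain ⟨R', hR', φ, h1, h2, h3, h4⟩ := hred.exists_solution hR0 hρ'
  have hmin : paramDisk (min R R') ⊆ paramDisk R' := Metric.ball_subset_ball (min_le_right _ _)
  have hmin' : paramDisk (min R R') ⊆ paramDisk R := Metric.ball_subset_ball (min_le_left _ _)
  refine ⟨min R R', lt_min hR0 hR', (min_le_left _ _).trans (by linarith), φ, fun ε hε => h1 ε (hmin hε),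
    h2.mono (Set.prod_mono hmin le_rfl), fun x hx => ?_, fun ε hε p hp hfp => ?_⟩
  · refine (h3 x ⟨hmin hx.1, hx.2⟩).trans ?_
    rw [← mul_div_assoc, mul_div_right_comm]
    have := lt_min hR0 hR'
    gcongr
    exact min_le_right _ _
  · rw [hηw ε (hmin' hε) p (openPhase_mono (by linarith) hp)]
    exact h4 ε (hmin hε) p hp hfp

/-- A solution of the linear form `φ(f(p)) η(p) = φ(p)` of the coboundary equation that is near the
identity is invertible, hence an analytic solution. -/
theorem exists_isAnalyticSolution_of_norm_sub_one_le {R s c : ℝ} {η : ℂ → Phase d → G}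
    {φ : ℂ × Phase d → G} (hR : 0 < R) (hs : 0 < s) (hc : 0 ≤ c)
    (hper : ∀ ε ∈ paramDisk R, IsIntPeriodic (openPhase d s) fun p => φ (ε, p))
    (hφ : DifferentiableOn ℂ φ (paramDisk R ×ˢ openPhase d s))
    (h1 : ∀ x ∈ paramDisk R ×ˢ openPhase d s, ‖φ x - 1‖ ≤ c * ‖x.1‖)
    (heq : ∀ ε ∈ paramDisk R, ∀ p ∈ openPhase d s, shear p ∈ openPhase d s →
      φ (ε, shear p) * η ε p = φ (ε, p)) :
    ∃ ρ : ℝ, 0 < ρ ∧ ρ ≤ R ∧ IsAnalyticSolution ρ η fun ε p => φ (ε, p) := by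
  set ρ := min (min R (s / 2)) (c + 1)⁻¹ with hρ
  have hρR : ρ ≤ R := (min_le_left _ _).trans (min_le_left _ _)
  have hρs : ρ < s := ((min_le_left _ _).trans (min_le_right _ _)).trans_lt (half_lt_self hs)
  have hcρ : c * ρ ≤ 1 := by
    calc c * ρ ≤ (c + 1) * (c + 1)⁻¹ := by
          gcongr
          · linarith
          · exact min_le_right _ _
      _ = 1 := mul_inv_cancel₀ (by positivity)
  refine ⟨ρ, by positivity, hρR, ?_⟩
  have hdisk : paramDisk ρ ⊆ paramDisk R := Metric.ball_subset_ball hρR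
  have hdom : phaseDomain d ρ ⊆ openPhase d s := phaseDomain_subset_openPhase hρs
  have hsub := Set.prod_mono hdisk hdom
  have hunit : ∀ ε ∈ paramDisk ρ, ∀ p ∈ phaseDomain d ρ, IsUnit (φ (ε, p)) := by
    intro ε hε p hp
    refine isUnit_of_norm_sub_one_lt ((h1 (ε, p) ⟨hdisk hε, hdom hp⟩).trans_lt ?_)
    rcases hc.eq_or_lt with rfl | hc
    · simp
    · exact (mul_lt_mul_of_pos_left (mem_ball_zero_iff.1 hε) hc).trans_le hcρ
  refine ⟨⟨fun ε hε p hp => hper ε (hdisk hε) p (hdom hp), hφ.continuousOn.mono hsub,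
    hφ.mono (interior_subset.trans hsub)⟩, hunit, fun ε hε p hp hfp => ?_⟩
  rw [← heq ε (hdisk hε) p (hdom hp) (hdom hfp), ← mul_assoc,
    Ring.inverse_mul_cancel _ (hunit ε hε _ hfp), one_mul]

/-- The Periodic Orbit Condition implies the existence of an analytic solution. -/
theorem exists_isAnalyticSolution {ρ ρ' : ℝ} (hρ' : 0 < ρ') (hle : ρ' ≤ ρ)
    {η : ℂ → Phase d → G} (hη : IsAnalyticFamily ρ η) (hη0 : ∀ p ∈ phaseDomain d ρ, η 0 p = 1)
    (hpoc : ∀ ε ∈ paramDisk ρ, PeriodicOrbitCondition ρ' (η ε)) :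
    ∃ ρ'' : ℝ, 0 < ρ'' ∧ ρ'' ≤ ρ ∧ ∃ φ : ℂ → Phase d → G, IsAnalyticSolution ρ'' η φ := by
  obtain ⟨R, hR, hRρ, φ, h1, h2, h3, h4⟩ :=
    exists_solution_of_periodicOrbitCondition hρ' hle hη hη0 hpoc
  obtain ⟨ρ'', h0, hle', hsol⟩ := exists_isAnalyticSolution_of_norm_sub_one_le hR
    (half_pos hρ') (by positivity) h1 h2 h3 h4
  exact ⟨ρ'', h0, hle'.trans hRρ, _, hsol⟩

end Solution

/-! ### Real structures -/

section Real

variable {d : ℕ} {G : Type*} [NormedRing G] [NormedAlgebra ℂ G]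

theorem RealStructure.map_one (τ : RealStructure G) : τ.toMap 1 = 1 := by
  have h : ∀ x, τ.toMap 1 * x = x := fun x => by
    rw [← τ.involutive x, ← τ.map_mul, one_mul]
  have h1 := h 1
  rwa [mul_one] at h1

@[simp] theorem conjPhase_fst_apply (p : Phase d) (j : Fin d) : (conjPhase p).1 j = conj (p.1 j) :=
  rfl

@[simp] theorem conjPhase_snd_apply (p : Phase d) (j : Fin d) : (conjPhase p).2 j = conj (p.2 j) :=
  rfl

theorem conjPhase_conjPhase (p : Phase d) : conjPhase (conjPhase p) = p := by
  ext j <;> simp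

theorem shear_conjPhase (p : Phase d) : shear (conjPhase p) = conjPhase (shear p) := by
  ext j <;> simp [shear]

theorem conjPhase_add_intVec (p : Phase d) (m : Fin d → ℤ) :
    conjPhase (p.1 + intVec m, p.2) = ((conjPhase p).1 + intVec m, (conjPhase p).2) := by
  ext j <;> simp

/-- Conjugation is an isometry that fixes the real cube pointwise. -/
theorem infDist_conj_le (I : EuclideanSpace ℂ (Fin d)) :
    Metric.infDist (WithLp.toLp 2 fun j => conj (I j)) (realCube d)
      ≤ Metric.infDist I (realCube d) := by
  refine (Metric.le_infDist ⟨0, zero_mem_realCube⟩).2 fun y hy => ?_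
  refine (Metric.infDist_le_dist_of_mem hy).trans (le_of_eq ?_)
  rw [EuclideanSpace.dist_eq, EuclideanSpace.dist_eq]
  congr 1
  refine Finset.sum_congr rfl fun j _ => ?_
  have h : y j = conj (y j) := (Complex.conj_eq_iff_im.2 (hy j).1).symm
  rw [h]
  change dist (conj (I j)) (conj (y j)) ^ 2 = dist (I j) (conj (y j)) ^ 2
  rw [Complex.dist_conj_conj, ← h]

theorem conjPhase_mem_openPhase {s : ℝ} {p : Phase d} (hp : p ∈ openPhase d s) :
    conjPhase p ∈ openPhase d s :=
  ⟨fun j => by simpa using hp.1 j, (infDist_conj_le p.2).trans_lt hp.2⟩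

theorem conj_mem_paramDisk {R : ℝ} {ε : ℂ} (hε : ε ∈ paramDisk R) : conj ε ∈ paramDisk R := by
  rw [paramDisk, mem_ball_zero_iff] at *
  rwa [RCLike.norm_conj]

variable (d) in
/-- Complex conjugation of `(ε, θ, I)`, as a conjugate-linear map. -/
def conjMap : (ℂ × Phase d) →SL[starRingEnd ℂ] (ℂ × Phase d) where
  toFun x := (conj x.1, conjPhase x.2)
  map_add' x y := by ext j <;> simp
  map_smul' c x := by ext j <;> simp
  cont := by
    refine Continuous.prodMk (Complex.continuous_conj.comp continuous_fst) (Continuous.prodMk ?_ ?_)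
    · exact (PiLp.continuous_toLp 2 _).comp (continuous_pi fun j =>
        Complex.continuous_conj.comp (by fun_prop))
    · exact (PiLp.continuous_toLp 2 _).comp (continuous_pi fun j =>
        Complex.continuous_conj.comp (by fun_prop))

/-- Conjugation of a holomorphic function by conjugate-linear maps is holomorphic. -/
theorem DifferentiableOn.conj_comp_conj {E F : Type*} [NormedAddCommGroup E] [NormedSpace ℂ E]
    [NormedAddCommGroup F] [NormedSpace ℂ F] {f : E → F} {U : Set E} (hU : IsOpen U)
    (hf : DifferentiableOn ℂ f U) (τ : F →SL[starRingEnd ℂ] F) (κ : E →SL[starRingEnd ℂ] E)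
    (hκ : Set.MapsTo κ U U) : DifferentiableOn ℂ (fun x => τ (f (κ x))) U := by
  intro x hx
  have h := (hf.differentiableAt (hU.mem_nhds (hκ hx))).hasFDerivAt
  refine (HasFDerivAt.differentiableAt (f' := τ.comp ((fderiv ℂ f (κ x)).comp κ))
    (HasFDerivAt.of_isLittleO ?_)).differentiableWithinAt
  have h1 := h.isLittleO.comp_tendsto (κ.continuous.tendsto x)
  have h2 : (fun y => κ y - κ x) =O[nhds x] fun y => y - x := by
    simpa only [← map_sub] using κ.isBigO_comp (fun y => y - x) (nhds x)
  have h3 := (τ.isBigO_comp _ _).trans_isLittleO (h1.trans_isBigO h2)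
  refine h3.congr_left fun y => ?_
  simp [map_sub]

variable [CompleteSpace G]

/-- The linear form `φ(f(p)) η(p) = φ(p)` of the coboundary equation allows to symmetrise a solution
near the identity: `(φ + φ*) / 2`, with the conjugate `φ*` of `φ`, is a real-analytic solution. -/
theorem exists_isAnalyticSolution_isRealSymmetric {ρ ρ' : ℝ} (hρ' : 0 < ρ') (hle : ρ' ≤ ρ)
    {η : ℂ → Phase d → G} (hη : IsAnalyticFamily ρ η) (hη0 : ∀ p ∈ phaseDomain d ρ, η 0 p = 1)
    (hpoc : ∀ ε ∈ paramDisk ρ, PeriodicOrbitCondition ρ' (η ε)) (τ : RealStructure G)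
    (hτ : IsRealSymmetric τ ρ η) :
    ∃ ρ'' : ℝ, 0 < ρ'' ∧ ρ'' ≤ ρ ∧ ∃ φ : ℂ → Phase d → G,
      IsAnalyticSolution ρ'' η φ ∧ IsRealSymmetric τ ρ'' φ := by
  obtain ⟨R, hR, hRρ, φ, h1, h2, h3, h4⟩ :=
    exists_solution_of_periodicOrbitCondition hρ' hle hη hη0 hpoc
  set s := ρ' / 2 with hs
  set φ' : ℂ × Phase d → G := fun x => τ.toMap (φ (conjMap d x)) with hφ'
  set ψ : ℂ × Phase d → G := fun x => (2⁻¹ : ℂ) • (φ x + φ' x) with hψ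
  set c := ‖(1 : G)‖ / R * (1 + ‖τ.toMap‖) with hc
  have hc0 : 0 ≤ c := by positivity
  have hmaps : Set.MapsTo (conjMap d) (paramDisk R ×ˢ openPhase d s)
      (paramDisk R ×ˢ openPhase d s) := fun x hx =>
    ⟨conj_mem_paramDisk hx.1, conjPhase_mem_openPhase hx.2⟩
  have hper : ∀ ε ∈ paramDisk R, IsIntPeriodic (openPhase d s) fun p => ψ (ε, p) := by
    intro ε hε p hp m
    have e1 := h1 ε hε p hp m
    have e2 := h1 _ (conj_mem_paramDisk hε) _ (conjPhase_mem_openPhase hp) m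
    simp only [← conjPhase_add_intVec] at e1 e2
    change (2⁻¹ : ℂ) • (φ (ε, (p.1 + intVec m, p.2))
        + τ.toMap (φ (conj ε, conjPhase (p.1 + intVec m, p.2))))
      = (2⁻¹ : ℂ) • (φ (ε, p) + τ.toMap (φ (conj ε, conjPhase p)))
    rw [e1, e2]
  have hdiff : DifferentiableOn ℂ ψ (paramDisk R ×ˢ openPhase d s) :=
    (h2.add (h2.conj_comp_conj (Metric.isOpen_ball.prod (isOpen_openPhase s)) τ.toMap
      (conjMap d) hmaps)).const_smul (2⁻¹ : ℂ)
  have hnorm : ∀ x ∈ paramDisk R ×ˢ openPhase d s, ‖ψ x - 1‖ ≤ c * ‖x.1‖ := by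
    intro x hx
    have e1 := h3 x hx
    have e2 := h3 _ (hmaps hx)
    have e3 : ‖(conjMap d x).1‖ = ‖x.1‖ := RCLike.norm_conj x.1
    rw [e3] at e2
    have e4 : ψ x - 1 = (2⁻¹ : ℂ) • ((φ x - 1) + τ.toMap (φ (conjMap d x) - 1)) := by
      rw [map_sub, τ.map_one]
      simp only [hψ, hφ', smul_add, smul_sub]
      have : (1 : G) = (2⁻¹ : ℂ) • 1 + (2⁻¹ : ℂ) • 1 := by
        rw [← add_smul]; norm_num
      nth_rewrite 1 [this]
      abel
    have e5 : ‖τ.toMap (φ (conjMap d x) - 1)‖ ≤ ‖τ.toMap‖ * (‖(1 : G)‖ / R * ‖x.1‖) :=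
      (τ.toMap.le_opNorm _).trans (by gcongr)
    rw [e4, norm_smul]
    calc ‖(2⁻¹ : ℂ)‖ * ‖(φ x - 1) + τ.toMap (φ (conjMap d x) - 1)‖
        ≤ 1 * (‖(1 : G)‖ / R * ‖x.1‖ + ‖τ.toMap‖ * (‖(1 : G)‖ / R * ‖x.1‖)) := by
          gcongr
          · norm_num
          · exact (norm_add_le _ _).trans (add_le_add e1 e5)
      _ = c * ‖x.1‖ := by simp only [hc]; ring
  have heq : ∀ ε ∈ paramDisk R, ∀ p ∈ openPhase d s, shear p ∈ openPhase d s →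
      ψ (ε, shear p) * η ε p = ψ (ε, p) := by
    intro ε hε p hp hfp
    have e1 := h4 ε hε p hp hfp
    have e2 := h4 _ (conj_mem_paramDisk hε) _ (conjPhase_mem_openPhase hp)
      (by rw [shear_conjPhase]; exact conjPhase_mem_openPhase hfp)
    rw [shear_conjPhase] at e2
    have e3 := hτ ε ?_ p (openPhase_subset_phaseDomain ρ (openPhase_mono (by linarith) hp))
    · change (2⁻¹ : ℂ) • (φ (ε, shear p) + τ.toMap (φ (conj ε, conjPhase (shear p)))) * η ε p
        = (2⁻¹ : ℂ) • (φ (ε, p) + τ.toMap (φ (conj ε, conjPhase p)))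
      rw [smul_mul_assoc, add_mul, e1, ← e2, τ.map_mul, e3]
    · exact Metric.ball_subset_ball hRρ hε
  obtain ⟨ρ'', h0, hle', hsol⟩ := exists_isAnalyticSolution_of_norm_sub_one_le hR
    (half_pos hρ') hc0 hper hdiff hnorm heq
  refine ⟨ρ'', h0, hle'.trans hRρ, _, hsol, fun ε _ p _ => ?_⟩
  change τ.toMap ((2⁻¹ : ℂ) • (φ (conj ε, conjPhase p)
        + τ.toMap (φ (conj (conj ε), conjPhase (conjPhase p)))))
      = (2⁻¹ : ℂ) • (φ (ε, p) + τ.toMap (φ (conj ε, conjPhase p)))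
  rw [Complex.conj_conj, conjPhase_conjPhase, map_smulₛₗ, map_add, τ.involutive, add_comm,
      map_inv₀, map_ofNat]

end Real

/-! ### Products of truncated power series -/

section Truncation

variable {G : Type*} [NormedRing G]

/-- The coefficients of the formal inverse are bounded uniformly over all the series with given
bounds of their coefficients. -/
theorem exists_norm_inverseCoeff_le (b : ℕ → ℝ) (n : ℕ) :
    ∃ K, ∀ a : ℕ → G, (∀ j, ‖a j‖ ≤ b j) → ‖inverseCoeff a n‖ ≤ K := by
  induction n using Nat.strong_induction_on with
  | _ n ih =>
    choose! K hK using ih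
    rcases n.eq_zero_or_pos with rfl | hn
    · refine ⟨‖(1 : G)‖, fun a _ => ?_⟩
      rw [inverseCoeff, PowerSeries.coeff_invOfUnit, if_pos rfl]
      simp
    · refine ⟨∑ x ∈ Finset.HasAntidiagonal.antidiagonal n, b x.1 * |K x.2|, fun a ha => ?_⟩
      rw [inverseCoeff, PowerSeries.coeff_invOfUnit, if_neg hn.ne', inv_one, Units.val_one, neg_mul,
        one_mul, norm_neg]
      refine norm_sum_le_of_le _ fun x _ => ?_
      have hb : 0 ≤ b x.1 := (norm_nonneg _).trans (ha x.1)
      split_ifs with h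
      · rw [PowerSeries.coeff_mk]
        exact (norm_mul_le _ _).trans (mul_le_mul (ha _) ((hK _ h a ha).trans (le_abs_self _))
          (norm_nonneg _) hb)
      · rw [norm_zero]; positivity

theorem sum_antidiagonal_inverseCoeff_mul {a : ℕ → G} (ha : a 0 = 1) (n : ℕ) :
    ∑ x ∈ Finset.HasAntidiagonal.antidiagonal n, inverseCoeff a x.1 * a x.2 = if n = 0 then 1 else 0 := by
  have h := congrArg (PowerSeries.coeff n)
    (PowerSeries.invOfUnit_mul (PowerSeries.mk a) 1 (by simpa using ha))
  rw [PowerSeries.coeff_mul, PowerSeries.coeff_one] at h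
  simpa [inverseCoeff] using h

theorem sum_antidiagonal_mul_inverseCoeff {a : ℕ → G} (ha : a 0 = 1) (n : ℕ) :
    ∑ x ∈ Finset.HasAntidiagonal.antidiagonal n, a x.1 * inverseCoeff a x.2 = if n = 0 then 1 else 0 := by
  have h := congrArg (PowerSeries.coeff n)
    (PowerSeries.mul_invOfUnit (PowerSeries.mk a) 1 (by simpa using ha))
  rw [PowerSeries.coeff_mul, PowerSeries.coeff_one] at h
  simpa [inverseCoeff] using h

variable [NormedAlgebra ℂ G]

theorem norm_truncated_le (a : ℕ → G) (L : ℕ) {ε : ℂ} (hε : ‖ε‖ ≤ 1) :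
    ‖truncated a L ε‖ ≤ ∑ j ∈ Finset.range (L + 1), ‖a j‖ := by
  refine norm_sum_le_of_le _ fun j _ => ?_
  rw [norm_smul, norm_pow]
  exact mul_le_of_le_one_left (norm_nonneg _) (pow_le_one₀ (norm_nonneg _) hε)

theorem continuous_truncated (a : ℕ → G) (L : ℕ) : Continuous (truncated a L) := by
  unfold truncated
  fun_prop

/-- If the formal power series `a` and `b` are inverse to each other, the product of their
truncations is `1` up to terms of degree greater than `L`. -/
theorem exists_truncated_mul_truncated_eq {a b : ℕ → G} (hab : ∀ n,
    ∑ x ∈ Finset.HasAntidiagonal.antidiagonal n, a x.1 * b x.2 = if n = 0 then 1 else 0) (L : ℕ) {ε : ℂ}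
    (hε : ‖ε‖ ≤ 1) :
    ∃ E : G, ‖E‖ ≤ (∑ i ∈ Finset.range (L + 1), ‖a i‖) * ∑ j ∈ Finset.range (L + 1), ‖b j‖ ∧
      truncated a L ε * truncated b L ε = 1 + ε ^ (L + 1) • E := by
  refine ⟨∑ i ∈ Finset.range (L + 1), ∑ j ∈ Finset.Ico (L + 1 - i) (L + 1),
    ε ^ (i + j - (L + 1)) • (a i * b j), ?_, ?_⟩
  · rw [Finset.sum_mul]
    refine norm_sum_le_of_le _ fun i _ => ?_
    rw [Finset.mul_sum]
    refine (norm_sum_le_of_le (n := fun j => ‖a i‖ * ‖b j‖) _ fun j _ => ?_).trans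
      (Finset.sum_le_sum_of_subset_of_nonneg (fun j hj => Finset.mem_range.2 (Finset.mem_Ico.1 hj).2)
        fun j _ _ => mul_nonneg (norm_nonneg (a i)) (norm_nonneg (b j)))
    rw [norm_smul, norm_pow]
    exact (mul_le_of_le_one_left (norm_nonneg _) (pow_le_one₀ (norm_nonneg _) hε)).trans
      (norm_mul_le _ _)
  · have h1 : truncated a L ε * truncated b L ε
        = ∑ i ∈ Finset.range (L + 1), ∑ j ∈ Finset.range (L + 1), ε ^ (i + j) • (a i * b j) := by
      rw [truncated, truncated, Finset.sum_mul_sum]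
      refine Finset.sum_congr rfl fun i _ => Finset.sum_congr rfl fun j _ => ?_
      rw [smul_mul_smul_comm, pow_add]
    have h2 : ∑ i ∈ Finset.range (L + 1), ∑ j ∈ Finset.range (L + 1 - i), ε ^ (i + j) • (a i * b j)
        = 1 := by
      rw [← Finset.sum_range_diag_flip (L + 1) fun i j => ε ^ (i + j) • (a i * b j)]
      have h3 : ∀ n, ∑ k ∈ Finset.range (n + 1), ε ^ (k + (n - k)) • (a k * b (n - k))
          = if n = 0 then 1 else 0 := by
        intro n
        rw [← Finset.Nat.sum_antidiagonal_eq_sum_range_succ (fun i j => ε ^ (i + j) • (a i * b j)) n]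
        have h4 : ∀ x ∈ Finset.HasAntidiagonal.antidiagonal n, ε ^ (x.1 + x.2) • (a x.1 * b x.2)
            = ε ^ n • (a x.1 * b x.2) := fun x hx => by rw [Finset.HasAntidiagonal.mem_antidiagonal.1 hx]
        rw [Finset.sum_congr rfl h4, ← Finset.smul_sum, hab]
        split_ifs with hn <;> simp [hn]
      simp only [h3]
      simp
    rw [h1, ← h2, Finset.smul_sum, ← Finset.sum_add_distrib]
    refine Finset.sum_congr rfl fun i hi => ?_
    rw [← Finset.sum_range_add_sum_Ico _ (Nat.sub_le (L + 1) i), Finset.smul_sum]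
    congr 1
    refine Finset.sum_congr rfl fun j hj => ?_
    have hij : L + 1 ≤ i + j := by
      have := (Finset.mem_Ico.1 hj).1
      omega
    rw [smul_smul, ← pow_add, Nat.add_sub_cancel' hij]

end Truncation

/-! ### Formal solutions from analytic solutions -/

section Formal

variable {d : ℕ} {G : Type*} [NormedRing G] [NormedAlgebra ℂ G] [CompleteSpace G]

/-- An analytic solution can be normalised to be the identity at `ε = 0`: since `η_0 = 1`, the
function `φ_0` is invariant under the shear, so that `φ_0⁻¹ φ_ε` satisfies the same equation. -/
theorem IsAnalyticSolution.exists_normalized {ρ : ℝ} (hρ : 0 < ρ) {η φ : ℂ → Phase d → G}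
    (hφ : IsAnalyticSolution ρ η φ) (hη0 : ∀ p ∈ phaseDomain d ρ, η 0 p = 1) :
    ∃ ψ : ℂ × Phase d → G,
      (∀ ε ∈ paramDisk ρ, IsIntPeriodic (phaseDomain d ρ) fun p => ψ (ε, p)) ∧
      ContinuousOn ψ (paramDisk ρ ×ˢ phaseDomain d ρ) ∧
      DifferentiableOn ℂ ψ (paramDisk ρ ×ˢ openPhase d ρ) ∧
      (∀ p ∈ phaseDomain d ρ, ψ (0, p) = 1) ∧
      ∀ ε ∈ paramDisk ρ, ∀ p ∈ phaseDomain d ρ, shear p ∈ phaseDomain d ρ →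
        ψ (ε, shear p) * η ε p = ψ (ε, p) := by
  have h0 : (0 : ℂ) ∈ paramDisk ρ := Metric.mem_ball_self hρ
  have hdom := openPhase_subset_phaseDomain (d := d) ρ
  have hinv : ∀ p ∈ phaseDomain d ρ, DifferentiableAt ℂ Ring.inverse (φ 0 p) := fun p hp =>
    differentiableAt_inverse (hφ.isUnit 0 h0 p hp)
  refine ⟨fun x => Ring.inverse (φ 0 x.2) * φ x.1 x.2, fun ε hε p hp m => ?_, ?_, ?_, fun p hp => ?_,
    fun ε hε p hp hfp => ?_⟩
  · dsimp only
    rw [hφ.analytic.periodic 0 h0 p hp, hφ.analytic.periodic ε hε p hp]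
  · refine ContinuousOn.mul (fun x hx => ?_) hφ.analytic.continuousOn
    exact (hinv x.2 hx.2).continuousAt.comp_continuousWithinAt (f := fun x : ℂ × Phase d => φ 0 x.2)
      (hφ.analytic.continuousOn.comp (f := fun x : ℂ × Phase d => ((0 : ℂ), x.2)) (by fun_prop)
        (fun x hx => ⟨h0, hx.2⟩) x hx)
  · refine DifferentiableOn.mul (fun x hx => ?_) hφ.analytic.differentiableOn
    exact (hinv x.2 (hdom hx.2)).comp_differentiableWithinAt (f := fun x : ℂ × Phase d => φ 0 x.2) x
      (hφ.analytic.differentiableOn.comp (f := fun x : ℂ × Phase d => ((0 : ℂ), x.2)) (by fun_prop)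
        (fun x hx => ⟨h0, hx.2⟩) x hx)
  · exact Ring.inverse_mul_cancel _ (hφ.isUnit 0 h0 p hp)
  · have e1 := hφ.coboundary 0 h0 p hp hfp
    rw [hη0 p hp] at e1
    have e2 : φ 0 (shear p) = φ 0 p := by
      rw [← mul_one (φ 0 (shear p)), e1, ← mul_assoc,
        Ring.mul_inverse_cancel _ (hφ.isUnit 0 h0 _ hfp), one_mul]
    dsimp only
    rw [e2, hφ.coboundary ε hε p hp hfp, mul_assoc, ← mul_assoc (φ ε (shear p)),
      Ring.mul_inverse_cancel _ (hφ.isUnit ε hε _ hfp), one_mul]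

/-- An analytic solution has a Taylor expansion in `ε` that is a formal solution. -/
theorem IsAnalyticSolution.exists_isFormalSolution {ρ : ℝ} (hρ : 0 < ρ) {η φ : ℂ → Phase d → G}
    (hη : IsAnalyticFamily ρ η) (hφ : IsAnalyticSolution ρ η φ)
    (hη0 : ∀ p ∈ phaseDomain d ρ, η 0 p = 1) :
    ∃ a : ℕ → Phase d → G, IsFormalSolution (ρ / 2) η a := by
  obtain ⟨ψ, hper, hcont, hψ, hψ0, heq⟩ := hφ.exists_normalized hρ hη0
  set r := ρ / 2 with hr
  have hr0 : 0 < r := by positivity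
  have hrρ : r < ρ := by linarith
  have hdom : phaseDomain d r ⊆ openPhase d ρ := phaseDomain_subset_openPhase hrρ
  have hdom' : phaseDomain d r ⊆ phaseDomain d ρ := hdom.trans (openPhase_subset_phaseDomain ρ)
  have hcl := closedBall_half_subset_paramDisk hρ
  obtain ⟨M₀, hM₀⟩ := exists_norm_le_of_continuousOn_phaseDomain (isCompact_closedBall (0 : ℂ) r)
    (hcont.mono (Set.prod_mono hcl le_rfl)) fun ε hε => hper ε (hcl hε)
  obtain ⟨M₁, hM₁0, hM₁⟩ := hη.exists_norm_le hρ
  set a : ℕ → Phase d → G := paramCoeff r ψ with ha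
  set T : ℕ → ℂ × Phase d → G := paramRemainder r ψ with hT
  have hexp : ∀ m, ∀ ε ∈ paramDisk r, ∀ p ∈ phaseDomain d r,
      ψ (ε, p) = (∑ j ∈ Finset.range m, ε ^ j • a j p) + ε ^ m • T m (ε, p) := fun m ε hε p hp =>
    eq_sum_paramCoeff_add_paramRemainder hr0 hrρ hψ m (x := (ε, p)) ⟨hε, hdom hp⟩
  have hMs : ∀ p ∈ phaseDomain d r, ∀ z ∈ Metric.sphere (0 : ℂ) r, ‖ψ (z, p)‖ ≤ M₀ :=
    fun p hp z hz => hM₀ z (Metric.sphere_subset_closedBall hz) p (hdom' hp)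
  have ha_le : ∀ p ∈ phaseDomain d r, ∀ j, ‖a j p‖ ≤ M₀ / r ^ j := fun p hp j =>
    norm_paramCoeff_le hr0 (hMs p hp) j
  have ha0 : ∀ p ∈ phaseDomain d r, a 0 p = 1 := fun p hp => by
    have h := hexp 1 0 (Metric.mem_ball_self hr0) p hp
    rw [hψ0 p (hdom' hp)] at h
    simpa using h.symm
  refine ⟨a, ha0, fun j p hp m => ?_, fun j => ?_, fun L => ?_⟩
  · simp only [ha, paramCoeff]
    congr 1
    refine circleIntegral.integral_congr hr0.le fun z hz => ?_
    have := hper z (sphere_subset_paramDisk hrρ hz) p (hdom' hp) m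
    dsimp only at this ⊢
    rw [this]
  · exact (differentiableOn_paramCoeff hr0 hrρ (isOpen_openPhase ρ) hψ j).continuousOn.mono hdom
  · choose K hK using fun n => exists_norm_inverseCoeff_le (G := G) (fun j => M₀ / r ^ j) n
    set A := ∑ j ∈ Finset.range (L + 1), K j with hA
    set B := ∑ j ∈ Finset.range (L + 1), M₀ / r ^ j with hB
    set D := M₀ / r ^ (L + 1) * 2 with hD
    refine ⟨A * D + (A * B + A * D) * M₁, min (r / 2) 1, by positivity, fun ε hε p hp hfp => ?_⟩
    have hε1 : ‖ε‖ ≤ 1 := (hε.trans_le (min_le_right _ _)).le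
    have hεr : ‖ε‖ < r / 2 := hε.trans_le (min_le_left _ _)
    have hεr' : ε ∈ paramDisk r := mem_ball_zero_iff.2 (by linarith)
    have hερ : ε ∈ paramDisk ρ := mem_ball_zero_iff.2 (by linarith)
    have hT_le : ∀ q ∈ phaseDomain d r, ‖T (L + 1) (ε, q)‖ ≤ D := by
      intro q hq
      have hM0 : 0 ≤ M₀ := by
        have := ha_le q hq 0
        rw [pow_zero, div_one] at this
        exact (norm_nonneg _).trans this
      refine (norm_paramRemainder_le hr0 (x := (ε, q)) (by dsimp only; linarith) (hMs q hq)
        (L + 1)).trans ?_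
      have h2 : r / (r - ‖ε‖) ≤ 2 := by
        rw [div_le_iff₀ (by linarith)]; linarith
      simp only [hD]
      gcongr
    set b : ℕ → G := inverseCoeff fun j => a j (shear p) with hb
    have hb_le : ∑ j ∈ Finset.range (L + 1), ‖b j‖ ≤ A :=
      Finset.sum_le_sum fun j _ => hK j _ (ha_le _ hfp)
    obtain ⟨E, hE, hbE⟩ := exists_truncated_mul_truncated_eq (a := b) (b := fun j => a j (shear p))
      (sum_antidiagonal_inverseCoeff_mul (ha0 _ hfp)) L hε1
    have hA0 : 0 ≤ A := (Finset.sum_nonneg fun j _ => norm_nonneg _).trans hb_le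
    have hE' : ‖E‖ ≤ A * B := hE.trans (mul_le_mul hb_le
      (Finset.sum_le_sum fun j _ => ha_le _ hfp j) (Finset.sum_nonneg fun j _ => norm_nonneg _) hA0)
    have hb' : ‖truncated b L ε‖ ≤ A := (norm_truncated_le b L hε1).trans hb_le
    have e1 : ψ (ε, p) = truncated (fun j => a j p) L ε + ε ^ (L + 1) • T (L + 1) (ε, p) :=
      hexp (L + 1) ε hεr' p hp
    have e2 : ψ (ε, shear p)
        = truncated (fun j => a j (shear p)) L ε + ε ^ (L + 1) • T (L + 1) (ε, shear p) :=
      hexp (L + 1) ε hεr' (shear p) hfp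
    have e3 := heq ε hερ p (hdom' hp) (hdom' hfp)
    -- multiply `ψ (ε, f p) η = ψ (ε, p)` by the truncated inverse of the series at `f p`
    have e4 : η ε p - truncated b L ε * truncated (fun j => a j p) L ε
        = ε ^ (L + 1) • (truncated b L ε * T (L + 1) (ε, p)
          - (E + truncated b L ε * T (L + 1) (ε, shear p)) * η ε p) := by
      have e5 : truncated (fun j => a j p) L ε = ψ (ε, p) - ε ^ (L + 1) • T (L + 1) (ε, p) :=
        eq_sub_of_add_eq e1.symm
      rw [e5, ← e3, e2, mul_sub, ← mul_assoc, mul_add, hbE]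
      simp only [add_mul, mul_smul_comm, smul_mul_assoc, smul_sub, smul_add, one_mul]
      abel
    have hη1 : ‖η ε p‖ ≤ M₁ := hM₁ ε (mem_closedBall_zero_iff.2 (by linarith)) p (hdom' hp)
    have hD0 : 0 ≤ D := (norm_nonneg _).trans (hT_le p hp)
    have hB0 : 0 ≤ B := (Finset.sum_nonneg fun j _ => norm_nonneg _).trans
      (Finset.sum_le_sum fun j _ => ha_le p hp j)
    rw [e4, norm_smul, norm_pow, mul_comm]
    gcongr
    refine (norm_sub_le _ _).trans (add_le_add ?_ ?_)
    · exact (norm_mul_le _ _).trans (mul_le_mul hb' (hT_le p hp) (norm_nonneg _) hA0)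
    · refine (norm_mul_le _ _).trans (mul_le_mul ((norm_add_le _ _).trans (add_le_add hE' ?_)) hη1
        (norm_nonneg _) (by positivity))
      exact (norm_mul_le _ _).trans (mul_le_mul hb' (hT_le _ hfp) (norm_nonneg _) hA0)

end Formal

/-! ### The Periodic Orbit Condition from formal solutions -/

section Flat

open Asymptotics Filter Topology

/-- A holomorphic function on a disk that vanishes to infinite order at the centre is zero. -/
theorem eq_zero_of_forall_isBigO_pow {F : Type*} [NormedAddCommGroup F] [NormedSpace ℂ F]
    [CompleteSpace F] {R : ℝ} {g : ℂ → F} (hg : DifferentiableOn ℂ g (paramDisk R))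
    (h : ∀ L : ℕ, g =O[𝓝 0] fun ε => ε ^ (L + 1)) {ε : ℂ} (hε : ε ∈ paramDisk R) : g ε = 0 := by
  have h0 : (0 : ℂ) ∈ paramDisk R :=
    Metric.mem_ball_self ((norm_nonneg ε).trans_lt (mem_ball_zero_iff.1 hε))
  have han := hg.analyticOnNhd Metric.isOpen_ball
  refine han.eqOn_zero_of_preconnected_of_eventuallyEq_zero
    (convex_ball (0 : ℂ) R).isPreconnected h0 ?_ hε
  by_contra hne
  obtain ⟨n, u, hu, hu0, heq⟩ := (han 0 h0).exists_eventuallyEq_pow_smul_nonzero_iff.2 hne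
  obtain ⟨C, hC⟩ := (h n).bound
  have hle : ∀ᶠ z in 𝓝[≠] (0 : ℂ), ‖u z‖ ≤ C * ‖z‖ := by
    filter_upwards [heq.filter_mono nhdsWithin_le_nhds, hC.filter_mono nhdsWithin_le_nhds,
      self_mem_nhdsWithin] with z h1 h2 hz
    have hz0 : 0 < ‖z‖ ^ n := pow_pos (norm_pos_iff.2 hz) n
    rw [h1, sub_zero, norm_smul, norm_pow, norm_pow, pow_succ, mul_left_comm] at h2
    exact le_of_mul_le_mul_left h2 hz0
  have h1 : Tendsto (fun z => ‖u z‖) (𝓝[≠] (0 : ℂ)) (𝓝 ‖u 0‖) :=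
    hu.continuousAt.norm.tendsto.mono_left nhdsWithin_le_nhds
  have h2 : Tendsto (fun z : ℂ => C * ‖z‖) (𝓝[≠] (0 : ℂ)) (𝓝 0) := by
    have : Tendsto (fun z : ℂ => C * ‖z‖) (𝓝 0) (𝓝 (C * ‖(0 : ℂ)‖)) :=
      (continuous_const.mul continuous_norm).tendsto 0
    rw [norm_zero, mul_zero] at this
    exact this.mono_left nhdsWithin_le_nhds
  exact hu0 (norm_le_zero_iff.1 (le_of_tendsto_of_tendsto h1 h2 hle))

variable {d : ℕ} {G : Type*} [NormedRing G]

theorem isBigO_mul_left {u v : ℂ → G} {w : ℂ → ℂ} (hu : ContinuousAt u 0) (hv : v =O[𝓝 0] w) :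
    (fun ε => u ε * v ε) =O[𝓝 0] w := by
  simpa using (hu.tendsto.isBigO_one ℂ).mul hv

theorem isBigO_mul_right {u v : ℂ → G} {w : ℂ → ℂ} (hu : ContinuousAt u 0) (hv : v =O[𝓝 0] w) :
    (fun ε => v ε * u ε) =O[𝓝 0] w := by
  simpa using hv.mul (hu.tendsto.isBigO_one ℂ)

variable [NormedAlgebra ℂ G]

theorem truncated_mul_truncated_sub_one_isBigO {a b : ℕ → G} (hab : ∀ n,
    ∑ x ∈ Finset.HasAntidiagonal.antidiagonal n, a x.1 * b x.2 = if n = 0 then 1 else 0) (L : ℕ) :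
    (fun ε => truncated a L ε * truncated b L ε - 1) =O[𝓝 0] fun ε : ℂ => ε ^ (L + 1) := by
  refine IsBigO.of_bound ((∑ i ∈ Finset.range (L + 1), ‖a i‖) * ∑ j ∈ Finset.range (L + 1), ‖b j‖) ?_
  filter_upwards [Metric.ball_mem_nhds (0 : ℂ) one_pos] with ε hε
  obtain ⟨E, hE, h⟩ := exists_truncated_mul_truncated_eq hab L (mem_ball_zero_iff.1 hε).le
  rw [h, add_sub_cancel_left, norm_smul, mul_comm]
  gcongr

theorem differentiableOn_orbitProduct {ρ : ℝ} {η : ℂ → Phase d → G} (hη : IsAnalyticFamily ρ η)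
    {p : Phase d} (hp : ∀ i, shear^[i] p ∈ openPhase d ρ) (N : ℕ) :
    DifferentiableOn ℂ (fun ε => orbitProduct (η ε) p N) (paramDisk ρ) := by
  induction N with
  | zero => exact differentiableOn_const _
  | succ n ih => exact (differentiableOn_param hη.differentiableOn (hp n)).mul ih

theorem im_eq_zero_of_samePoint_shear_iterate {p : Phase d} {N : ℕ} (hN : 0 < N)
    (h : SamePoint (shear^[N] p) p) (j : Fin d) : (p.2 j).im = 0 := by
  obtain ⟨⟨m, hm⟩, -⟩ := h
  rw [shear_iterate, add_right_inj] at hm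
  have h1 := congrArg (fun v : EuclideanSpace ℂ (Fin d) => (v j).im) hm
  simp only [PiLp.smul_apply, smul_eq_mul, intVec_apply, Complex.intCast_im, Complex.mul_im,
    Complex.natCast_re, Complex.natCast_im, zero_mul, add_zero] at h1
  exact (mul_eq_zero.1 h1).resolve_left (by exact_mod_cast hN.ne')

variable [CompleteSpace G]

/-- A formal solution forces the products along periodic orbits to agree with the identity to
infinite order at `ε = 0`, hence for all `ε` by analytic continuation. The width is halved so that
the orbits lie in the interior of `𝓜_ρ`, where the family is holomorphic in `ε`. -/
theorem IsFormalSolution.periodicOrbitCondition {ρ ρ' : ℝ} (hρ' : 0 < ρ') (hle : ρ' ≤ ρ)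
    {η : ℂ → Phase d → G} (hη : IsAnalyticFamily ρ η) {φ : ℕ → Phase d → G}
    (hφ : IsFormalSolution ρ' η φ) {ε : ℂ} (hε : ε ∈ paramDisk ρ) :
    PeriodicOrbitCondition (ρ' / 2) (η ε) := by
  intro p hp N hN hper
  have hp' : p ∈ openPhase d ρ' := phaseDomain_subset_openPhase (half_lt_self hρ') hp
  -- the action of a periodic point is real, so that its orbit stays in the domain
  have horb : ∀ i, shear^[i] p ∈ openPhase d ρ' := fun i =>
    shear_iterate_mem_openPhase hp' (im_eq_zero_of_samePoint_shear_iterate hN hper) i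
  have horbρ : ∀ i, shear^[i] p ∈ openPhase d ρ := fun i => openPhase_mono hle (horb i)
  have horb' : ∀ i, shear^[i] p ∈ phaseDomain d ρ' := fun i =>
    openPhase_subset_phaseDomain ρ' (horb i)
  have hprod := differentiableOn_orbitProduct hη horbρ
  have h0 : paramDisk ρ ∈ 𝓝 (0 : ℂ) := Metric.ball_mem_nhds _ (hρ'.trans_le hle)
  refine sub_eq_zero.1 (eq_zero_of_forall_isBigO_pow ((hprod N).sub_const 1) (fun L => ?_) hε)
  set B : ℕ → ℂ → G := fun i => truncated (fun j => φ j (shear^[i] p)) L with hB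
  set A : ℕ → ℂ → G := fun i => truncated (inverseCoeff fun j => φ j (shear^[i] p)) L with hA
  have hBc : ∀ i, ContinuousAt (B i) 0 := fun i => (continuous_truncated _ L).continuousAt
  have hAc : ∀ i, ContinuousAt (A i) 0 := fun i => (continuous_truncated _ L).continuousAt
  have hPc : ∀ n, ContinuousAt (fun ε => orbitProduct (η ε) p n) 0 := fun n =>
    (hprod n).continuousOn.continuousAt h0
  have hBA : ∀ i, (fun ε => B i ε * A i ε - 1) =O[𝓝 0] fun ε : ℂ => ε ^ (L + 1) := fun i =>
    truncated_mul_truncated_sub_one_isBigO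
      (sum_antidiagonal_mul_inverseCoeff (hφ.zero _ (horb' i))) L
  have hAB : ∀ i, (fun ε => A i ε * B i ε - 1) =O[𝓝 0] fun ε : ℂ => ε ^ (L + 1) := fun i =>
    truncated_mul_truncated_sub_one_isBigO
      (sum_antidiagonal_inverseCoeff_mul (hφ.zero _ (horb' i))) L
  have hη1 : ∀ i, (fun ε => η ε (shear^[i] p) - A (i + 1) ε * B i ε)
      =O[𝓝 0] fun ε : ℂ => ε ^ (L + 1) := by
    intro i
    obtain ⟨C, r, hr, h⟩ := hφ.truncation L
    refine IsBigO.of_bound C ?_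
    filter_upwards [Metric.ball_mem_nhds (0 : ℂ) hr] with z hz
    have hi := horb' (i + 1)
    rw [Function.iterate_succ_apply'] at hi
    have := h z (mem_ball_zero_iff.1 hz) _ (horb' i) hi
    rw [norm_pow]
    simp only [hA, hB]
    rw [Function.iterate_succ_apply']
    exact this
  -- the telescoping product along the orbit, up to terms of degree greater than `L`
  have htel : ∀ n, (fun ε => B n ε * orbitProduct (η ε) p n - B 0 ε)
      =O[𝓝 0] fun ε : ℂ => ε ^ (L + 1) := by
    intro n
    induction n with
    | zero => simpa [orbitProduct] using isBigO_zero _ _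
    | succ n ih =>
      have h1 := isBigO_mul_left (hBc (n + 1)) (isBigO_mul_right (hPc n) (hη1 n))
      have h2 := isBigO_mul_right (u := fun ε => B n ε * orbitProduct (η ε) p n)
        ((hBc n).mul (hPc n)) (hBA (n + 1))
      -- replace the factor `η` by `A (n + 1) * B n`, then `B (n + 1) * A (n + 1)` by `1`
      refine ((h1.add h2).add ih).congr_left fun z => ?_
      rw [orbitProduct]
      noncomm_ring
  have hBN : B N = B 0 := by
    obtain ⟨m, hm⟩ := samePoint_iff.1 hper
    have : ∀ j, φ j (shear^[N] p) = φ j (shear^[0] p) := fun j => by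
      rw [hm]; exact hφ.periodic j p (horb' 0) m
    simp only [hB, this]
  have h1 := isBigO_mul_left (hAc 0) (htel N)
  rw [hBN] at h1
  have h2 := isBigO_mul_right (u := fun ε => orbitProduct (η ε) p N - 1)
    ((hPc N).sub continuousAt_const) (hAB 0)
  refine (h1.sub h2).congr_left fun z => ?_
  noncomm_ring

end Flat

end

theorem theorem1 {d : ℕ} {G : Type*} [NormedRing G] [NormedAlgebra ℂ G] [CompleteSpace G]
    (ρ : ℝ) (hρ : 0 < ρ) (η : ℂ → Phase d → G) (hη : IsAnalyticFamily ρ η)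
    (hη0 : ∀ p ∈ phaseDomain d ρ, η 0 p = 1) :
    -- values in an arbitrary complex Banach algebra
    List.TFAE
      [ ∃ ρ' : ℝ, 0 < ρ' ∧ ρ' ≤ ρ ∧ ∀ ε ∈ paramDisk ρ, PeriodicOrbitCondition ρ' (η ε),
        ∃ ρ' : ℝ, 0 < ρ' ∧ ρ' ≤ ρ ∧ ∃ φ : ℕ → Phase d → G, IsFormalSolution ρ' η φ,
        ∃ ρ' : ℝ, 0 < ρ' ∧ ρ' ≤ ρ ∧ ∃ φ : ℂ → Phase d → G, IsAnalyticSolution ρ' η φ ] ∧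
    -- the same, with the real symmetry for the data and for the analytic solution
    ∀ τ : RealStructure G, IsRealSymmetric τ ρ η →
      List.TFAE
        [ ∃ ρ' : ℝ, 0 < ρ' ∧ ρ' ≤ ρ ∧ ∀ ε ∈ paramDisk ρ, PeriodicOrbitCondition ρ' (η ε),
          ∃ ρ' : ℝ, 0 < ρ' ∧ ρ' ≤ ρ ∧ ∃ φ : ℕ → Phase d → G, IsFormalSolution ρ' η φ,
          ∃ ρ' : ℝ, 0 < ρ' ∧ ρ' ≤ ρ ∧ ∃ φ : ℂ → Phase d → G,
            IsAnalyticSolution ρ' η φ ∧ IsRealSymmetric τ ρ' φ ] := by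
  have hBA : (∃ ρ' : ℝ, 0 < ρ' ∧ ρ' ≤ ρ ∧ ∃ φ : ℕ → Phase d → G, IsFormalSolution ρ' η φ) →
      ∃ ρ' : ℝ, 0 < ρ' ∧ ρ' ≤ ρ ∧ ∀ ε ∈ paramDisk ρ, PeriodicOrbitCondition ρ' (η ε) := by
    rintro ⟨ρ', h0, hle, φ, hφ⟩
    exact ⟨ρ' / 2, by positivity, by linarith, fun ε hε => hφ.periodicOrbitCondition h0 hle hη hε⟩
  have hCB : (∃ ρ' : ℝ, 0 < ρ' ∧ ρ' ≤ ρ ∧ ∃ φ : ℂ → Phase d → G, IsAnalyticSolution ρ' η φ) →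
      ∃ ρ' : ℝ, 0 < ρ' ∧ ρ' ≤ ρ ∧ ∃ φ : ℕ → Phase d → G, IsFormalSolution ρ' η φ := by
    rintro ⟨ρ', h0, hle, φ, hφ⟩
    exact ⟨ρ' / 2, by positivity, by linarith, hφ.exists_isFormalSolution h0 (hη.mono hle)
      fun p hp => hη0 p (phaseDomain_mono hle hp)⟩
  refine ⟨?_, fun τ hτ => ?_⟩
  · tfae_have 1 → 3 := fun ⟨ρ', h0, hle, hpoc⟩ => exists_isAnalyticSolution h0 hle hη hη0 hpoc
    tfae_have 3 → 2 := hCB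
    tfae_have 2 → 1 := hBA
    tfae_finish
  · tfae_have 1 → 3 := fun ⟨ρ', h0, hle, hpoc⟩ =>
      exists_isAnalyticSolution_isRealSymmetric h0 hle hη hη0 hpoc τ hτ
    tfae_have 3 → 2 := fun ⟨ρ', h0, hle, φ, hφ, _⟩ => hCB ⟨ρ', h0, hle, φ, hφ⟩
    tfae_have 2 → 1 := hBA
    tfae_finish
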